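/- For $d\in\mathbb N$ and $r,k\in\mathbb N$ with $r\le k\le d$, let $Y_k=\{y\in\{0,1\}^d:\sum_j y_j\le k\}$, and for $x\in\{0,1\}^d$ let $f_x:\{0,1\}^d\to\{0,1\}$, $f_x(y)=1$ if $\sum_{j=1}^d y_jx_j\ge r$ and $f_x(y)=0$ otherwise. For $t\in\mathbb N$ and $T\in\mathbb R$ let $\mathcal P_{t,T}$ be the family of all $d$-variate real polynomials of total degree at most $t$ all of whose coefficients have absolute value at most $T$. **Lemma (Approximating $r$-of-$k$ queries on $Y_k$).** There are a constant $C\in\mathbb N$ and a single algorithm $A$ such that the following holds for all $r,k,d\in\mathbb N$ with $r\le k\le d$ and every real $\gamma>0$. Put $s=\sqrt{k\,r\,\max(0,\log(1/\gamma))}$ and $\tilde O(s):=C\,s\,(\log(2+s))^{C}$. There are $t\in\mathbb N$ and $T\in\mathbb R$ with $$t\le \tilde O(s),\qquad T\le d^{\,\tilde O(s)}$$ such that $\mathcal P_{t,T}$ efficiently and uniformly $\gamma$-approximates the family $(f_x)_{x\in\{0,1\}^d}$ on $Y_k$. That is, for every $x\in\{0,1\}^d$ there is $p_x\in\mathcal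 P_{t,T}$ with $$\max_{y\in Y_k}|f_x(y)-p_x(y)|\le\gamma ,$$ and $A$, given $x$ and the integers $r$, $k$, $d$ and $\max(0,\lceil\log_2(1/\gamma)\rceil)$, halts within $$C\Bigl(1+\log|\{0,1\}^d|+\tbinom{d+t}{t}+\max(0,\log T)\Bigr)^{C}$$ steps and outputs the coefficient vector of $p_x$, that is, a list of all exponent vectors of total degree at most $t$, each once, together with the (rational) coefficient of $p_x$ at it, written as a quotient of two integers. Algorithms are programs of a random access machine with integer registers and arrays and the operations $+,-,\cdot$ and integer division, and steps are counted in the logarithmic cost model (each operation is charged the binary length of the integers and addresses involved). Here $0^0=1$. -/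

import Mathlib

/-! ### Machine model: logarithmic-cost random access machine

Programs are structured (sequence, conditional, loop) and act on integer-valued registers and on
finitely many integer arrays with computed addresses. Every step is charged the binary lengths of
all the integers and addresses that it touches. -/

namespace RAM

/-- Number of binary digits of `|z|` (and `1` for `z = 0`). -/
def bitLen (z : ℤ) : ℕ := Nat.log 2 z.natAbs + 1

/-- A memory state: `reg i` is the content of register `i`, and `arr a n` is the content of
cell `n` of array `a`. -/
structure Store where
  reg : ℕ → ℤ
  arr : ℕ → ℕ → ℤ

/-- Arithmetic operations; `div` is integer division. -/
inductive Op where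
  | add
  | sub
  | mul
  | div

def Op.apply : Op → ℤ → ℤ → ℤ
  | .add, a, b => a + b
  | .sub, a, b => a - b
  | .mul, a, b => a * b
  | .div, a, b => a / b

inductive Expr where
  /-- an integer constant -/
  | lit (z : ℤ)
  /-- the content of register `i` -/
  | get (i : ℕ)
  /-- the content of the cell of array `a` at a computed address -/
  | read (a : ℕ) (e : Expr)
  | bin (o : Op) (e₁ e₂ : Expr)

def Expr.eval (s : Store) : Expr → ℤ
  | .lit z => z
  | .get i => s.reg i
  | .read a e => s.arr a (e.eval s).toNat
  | .bin o e₁ e₂ => o.apply (e₁.eval s) (e₂.eval s)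

/-- The cost of evaluating an expression: the total binary length of all the values and of all the
register, array and cell addresses that occur in the evaluation. -/
def Expr.cost (s : Store) : Expr → ℕ
  | .lit z => bitLen z
  | .get i => bitLen i + bitLen (s.reg i)
  | .read a e => e.cost s + bitLen a + bitLen (s.arr a (e.eval s).toNat)
  | .bin o e₁ e₂ => e₁.cost s + e₂.cost s + bitLen (o.apply (e₁.eval s) (e₂.eval s))

inductive Cmd where
  | nop
  /-- register `i` := `e` -/
  | assign (i : ℕ) (e : Expr)
  /-- cell `e₁` of array `a` := `e₂` -/
  | write (a : ℕ) (e₁ e₂ : Expr)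
  | seq (c₁ c₂ : Cmd)
  /-- execute `c₁` if `e > 0`, and `c₂` otherwise -/
  | cond (e : Expr) (c₁ c₂ : Cmd)
  /-- repeat `c` as long as `e > 0` -/
  | loop (e : Expr) (c : Cmd)

/-- `Exec c s n s'`: started in `s`, the program `c` halts in `s'` at total cost `n`. -/
inductive Exec : Cmd → Store → ℕ → Store → Prop where
  | nop (s : Store) : Exec .nop s 1 s
  | assign (i : ℕ) (e : Expr) (s : Store) :
      Exec (.assign i e) s (e.cost s + bitLen i + 1)
        { s with reg := Function.update s.reg i (e.eval s) }
  | write (a : ℕ) (e₁ e₂ : Expr) (s : Store) :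
      Exec (.write a e₁ e₂) s (e₁.cost s + e₂.cost s + bitLen a + 1)
        { s with
          arr := Function.update s.arr a
            (Function.update (s.arr a) (e₁.eval s).toNat (e₂.eval s)) }
  | seq {c₁ c₂ : Cmd} {s s' s'' : Store} {n₁ n₂ : ℕ} :
      Exec c₁ s n₁ s' → Exec c₂ s' n₂ s'' → Exec (.seq c₁ c₂) s (n₁ + n₂) s''
  | cond_pos {e : Expr} {c₁ c₂ : Cmd} {s s' : Store} {n : ℕ} :
      0 < e.eval s → Exec c₁ s n s' → Exec (.cond e c₁ c₂) s (e.cost s + n + 1) s'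
  | cond_neg {e : Expr} {c₁ c₂ : Cmd} {s s' : Store} {n : ℕ} :
      ¬ 0 < e.eval s → Exec c₂ s n s' → Exec (.cond e c₁ c₂) s (e.cost s + n + 1) s'
  | loop_stop {e : Expr} {c : Cmd} {s : Store} :
      ¬ 0 < e.eval s → Exec (.loop e c) s (e.cost s + 1) s
  | loop_step {e : Expr} {c : Cmd} {s s' s'' : Store} {n₁ n₂ : ℕ} :
      0 < e.eval s → Exec c s n₁ s' → Exec (.loop e c) s' n₂ s'' →
        Exec (.loop e c) s (e.cost s + n₁ + n₂ + 1) s''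

/-- Initially the input is stored in array `0`; everything else is zero. -/
def initial (input : List ℤ) : Store where
  reg := fun _ => 0
  arr := fun a n => if a = 0 then input.getD n 0 else 0

/-- `Outputs c input n output`: on `input` the program halts at cost `n`, and then register `0`
holds the length of the output and array `1` starts with the output. -/
def Outputs (c : Cmd) (input : List ℤ) (n : ℕ) (output : List ℤ) : Prop :=
  ∃ s : Store, Exec c (initial input) n s ∧ s.reg 0 = (output.length : ℤ) ∧
    ∀ i (hi : i < output.length), s.arr 1 i = output[i]

end RAM

/-! ### Approximation by polynomials -/

/-- The Boolean vector `y` as a vector of real numbers `0`, `1`. -/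
def boolPoint {m : ℕ} (y : Fin m → Bool) : Fin m → ℝ := fun j => if y j then 1 else 0

/-- The family `𝒫_{t,T}` of `m`-variate real polynomials of total degree at most `t` all of whose
coefficients have absolute value at most `T`. -/
def polyFamily (m t : ℕ) (T : ℝ) : Set (MvPolynomial (Fin m) ℝ) :=
  {p | p.totalDegree ≤ t ∧ ∀ j : Fin m →₀ ℕ, |p.coeff j| ≤ T}

/-- The list of integers `out` is the coefficient vector of `p`, indexed by the exponent vectors of
total degree at most `t`: for each such exponent vector `j`, listed exactly once, it contains a
block `j_1, …, j_m, a, b` where `b > 0` and `a / b` is the coefficient of `p` at `j`. -/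
def IsCoeffVector {m : ℕ} (t : ℕ) (p : MvPolynomial (Fin m) ℝ) (out : List ℤ) : Prop :=
  ∃ S : List ((Fin m →₀ ℕ) × ℤ × ℤ),
    (S.map Prod.fst).Nodup ∧
    (∀ j : Fin m →₀ ℕ, j ∈ S.map Prod.fst ↔ ∑ i, j i ≤ t) ∧
    (∀ q ∈ S, 0 < q.2.2 ∧ p.coeff q.1 = (q.2.1 : ℝ) / (q.2.2 : ℝ)) ∧
    out = S.flatMap fun q => List.ofFn (fun i => (q.1 i : ℤ)) ++ [q.2.1, q.2.2]

/-- The program `A` (which is given `x` in the form `enc x`) witnesses that `𝒫_{t,T}` efficiently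
and uniformly `γ`-approximates the family `F = (f_x)` on `Y`: for every `x` it outputs the
coefficient vector of some `p_x ∈ 𝒫_{t,T}` with `max_{y ∈ Y} |f_x(y) - p_x(y)| ≤ γ`, in time
polynomial, with constant and exponent `C`, in `log |X|`, `binom (m + t) t` and `log T`. -/
def EfficientlyUniformlyApproximates (A : RAM.Cmd) (C : ℕ) {X : Type} [Fintype X]
    (enc : X → List ℤ) {m : ℕ} (t : ℕ) (T γ : ℝ) (F : X → (Fin m → Bool) → ℝ)
    (Y : Set (Fin m → Bool)) : Prop :=
  ∀ x : X, ∃ p ∈ polyFamily m t T,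
    (∀ y ∈ Y, |F x y - MvPolynomial.eval (boolPoint y) p| ≤ γ) ∧
    ∃ (n : ℕ) (out : List ℤ), RAM.Outputs A (enc x) n out ∧ IsCoeffVector t p out ∧
      (n : ℝ) ≤ C * (1 + Real.log (Fintype.card X) + ((m + t).choose t : ℝ)
        + max 0 (Real.log T)) ^ C

/-- An explicit bound of the form `Õ(s)`, namely `C · s · (log (2 + s)) ^ C`. -/
noncomputable def softO (C : ℕ) (s : ℝ) : ℝ := C * s * (Real.log (2 + s)) ^ C

/-! ### Monotone `r`-of-`k` queries -/

/-- The query `q_y(x) = 1` if `∑ j, y_j x_j ≥ r`, and `0` otherwise. -/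
def thresholdQuery {d : ℕ} (r : ℕ) (y x : Fin d → Bool) : ℝ :=
  if r ≤ ∑ j, (y j).toNat * (x j).toNat then 1 else 0

/-- The function family of the queries: `f_x(y) = q_y(x)`. -/
def thresholdFamily {d : ℕ} (r : ℕ) (x y : Fin d → Bool) : ℝ := thresholdQuery r y x

/-- The index set `Y_k` of Boolean vectors of weight at most `k`. -/
def weightAtMost (d k : ℕ) : Set (Fin d → Bool) := {y | ∑ j, (y j).toNat ≤ k}

/-- The input `r, k, d, ⌈log₂ (1/γ)⌉, x_1, …, x_d` (the fourth entry is `0` if `γ ≥ 1`). -/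
noncomputable def thresholdInput {d : ℕ} (r k : ℕ) (γ : ℝ) (x : Fin d → Bool) : List ℤ :=
  [(r : ℤ), (k : ℤ), (d : ℤ), (⌈Real.logb 2 (1 / γ)⌉₊ : ℤ)]
    ++ List.ofFn fun j => ((x j).toNat : ℤ)

/-! At a Boolean point the query depends only on z = ∑ x_j y_j, which lies in {0, …, k} when y ∈
Y_k. So it suffices to approximate the step function [z ≥ r] on {0, …, k} by a univariate polynomial
of degree about √(k r log(1/γ)). If this polynomial is ∑ c_j binom(z, j), then at Boolean points it
equals the multilinear polynomial in y whose coefficient at ∏_{i ∈ S} y_i is c_{|S|} for every set S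
of ones of x. No expansion in powers of z is needed.

Let g = ⌈log₂(1/γ)⌉ and R = r g, with r ≥ 1 and g ≥ 2. The damping factor D(z) is k^(2^m) times the
Chebyshev polynomial of degree 2^m at (k + 2R - 2z)/k. On [R, R + k] it is at most k^(2^m) in
absolute value. For z < r the argument is at least 1 + R/k, and there D exceeds k^(2^m) by a factor
2^((2m+1)R) as soon as 2^m is about √(kR) up to a logarithm. Let u be the polynomial of degree < R
with u(z) = b/D(z) for z < r and u(z) = 0 for r ≤ z < R, where b = ∏_{i<r} D(i) is a common
denominator. Then 1 - u D/b is exactly the step function below R (`ParamsFit.valueNum_of_lt`). From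
R to k the growth of u under extrapolation, at most (2k+1)^R, is beaten by the gap in D, which
leaves an error of at most 2^(-g) (`ParamsFit.two_pow_mul_abs_le`). The degree is at most R - 1 +
2^m ≤ 2·2^m =: t. If R > k, interpolation alone is exact and the degree is at most k.

The numbers c_j are forward differences at 0 of values bounded by 2, so |c_j| ≤ 2^(t+1) ≤ d^(t+1)
for d ≥ 2. The cases r = 0 and γ ≥ 1/2 are served by the constants 1 and 1/2.

The program computes with integers only. It tabulates D, obtains u on {0, …, k} from difference
tables, takes differences again to find the numerators b c_j, and lists all exponent vectors of
degree at most t. All intermediate integers have bit length polynomial in d + binom(d+t, t), so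
bounding the number of elementary steps bounds the logarithmic cost (`RAM.wp_coeffCmd`,
`RAM.wp_enumCmd`, `RAM.polynomial_time`). -/

/-! ### Scaled iterates of `x ↦ 2 x² - 1` -/

/-- The integer `q ^ 2 ^ j * h^[j] (y / q)` where `h x = 2 * x ^ 2 - 1`. -/
def dbl (q y : ℤ) : ℕ → ℤ
  | 0 => y
  | j + 1 => 2 * dbl q y j ^ 2 - (q ^ 2 ^ j) ^ 2

lemma abs_two_sq_sub_sq_le {a b : ℤ} (h : |a| ≤ b) : |2 * a ^ 2 - b ^ 2| ≤ b ^ 2 := by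
  have h1 : a ^ 2 ≤ b ^ 2 := by
    rw [← sq_abs a]
    exact pow_le_pow_left₀ (abs_nonneg a) h 2
  rw [abs_le]
  constructor <;> nlinarith [sq_nonneg a]

lemma abs_dbl_le {q y : ℤ} (h : |y| ≤ q) (j : ℕ) : |dbl q y j| ≤ q ^ 2 ^ j := by
  induction j with
  | zero => simpa [dbl] using h
  | succ j ih =>
    rw [pow_succ 2 j, pow_mul]
    exact abs_two_sq_sub_sq_le ih

/-- A crude bound valid for all starting points. -/
lemma abs_dbl_le_pow {q y M : ℤ} (hq : 0 ≤ q) (hqM : q ≤ M) (h : |y| ≤ M) (j : ℕ) :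
    |dbl q y j| ≤ (2 * M) ^ 2 ^ j := by
  have hM : 0 ≤ M := hq.trans hqM
  -- The factor 2 makes the induction close: if d and q^(2^j) are both at most A/2, then |2 d² -
  -- (q^(2^j))²| is at most A²/2.
  suffices 2 * |dbl q y j| ≤ (2 * M) ^ 2 ^ j by linarith [abs_nonneg (dbl q y j)]
  induction j with
  | zero => simpa [dbl] using h
  | succ j ih =>
    rw [pow_succ 2 j, pow_mul]
    have h1 : q ^ 2 ^ j ≤ (2 * M) ^ 2 ^ j := pow_le_pow_left₀ hq (by linarith) _
    have h0 : 0 ≤ q ^ 2 ^ j := pow_nonneg hq _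
    have h3 : 2 * q ^ 2 ^ j ≤ (2 * M) ^ 2 ^ j := by
      rw [mul_pow]
      have ha : q ^ 2 ^ j ≤ M ^ 2 ^ j := pow_le_pow_left₀ hq hqM _
      have hb : (2 : ℤ) ≤ 2 ^ 2 ^ j := by
        calc (2 : ℤ) = 2 ^ 1 := by norm_num
          _ ≤ 2 ^ 2 ^ j := pow_le_pow_right₀ (by norm_num) Nat.one_le_two_pow
      nlinarith
    set A := (2 * M) ^ 2 ^ j
    set d := |dbl q y j| with hd
    have hd0 : 0 ≤ d := abs_nonneg _
    have e1 : dbl q y (j + 1) = 2 * d ^ 2 - (q ^ 2 ^ j) ^ 2 := by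
      simp [dbl, hd, sq_abs]
    have h4 : 4 * d ^ 2 ≤ A ^ 2 := by nlinarith
    have h5 : 4 * (q ^ 2 ^ j) ^ 2 ≤ A ^ 2 := by nlinarith
    rw [e1]
    have : |2 * d ^ 2 - (q ^ 2 ^ j) ^ 2| * 2 ≤ A ^ 2 := by
      have h6 : |2 * d ^ 2 - (q ^ 2 ^ j) ^ 2| ≤ A ^ 2 / 2 := by
        rw [abs_le]
        constructor <;> nlinarith [sq_nonneg d, sq_nonneg (q ^ 2 ^ j), Int.ediv_mul_le (A ^ 2) two_ne_zero, Int.lt_ediv_add_one_mul_self (A ^ 2) two_pos]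
      have := Int.ediv_mul_le (A ^ 2) two_ne_zero
      linarith
    linarith

/-- Since 2(1 + ε)² - 1 = 1 + 4ε + 2ε², the excess over 1 at least quadruples while the degree only
doubles. This is the source of the square root in the degree bound. -/
lemma le_iterate_of_one_add_le {e : ℕ → ℝ} (he : ∀ j, e (j + 1) = 2 * e j ^ 2 - 1) {δ : ℝ}
    (hδ : 0 ≤ δ) (h0 : 1 + δ ≤ e 0) (j : ℕ) : 1 + 4 ^ j * δ ≤ e j := by
  induction j with
  | zero => simpa using h0
  | succ j ih =>
    rw [he, pow_succ]
    have : 0 ≤ 4 ^ j * δ := by positivity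
    nlinarith

/-- For e ≥ 1 one step at least squares: 2e² - 1 ≥ e². -/
lemma two_pow_two_pow_le_iterate {e : ℕ → ℝ} (he : ∀ j, e (j + 1) = 2 * e j ^ 2 - 1) {l : ℕ}
    (h : 2 ≤ e l) (j : ℕ) : (2 : ℝ) ^ 2 ^ j ≤ e (l + j) := by
  induction j with
  | zero => simpa using h
  | succ j ih =>
    rw [← add_assoc, he, pow_succ 2 j, pow_mul]
    have h1 : (1 : ℝ) ≤ 2 ^ 2 ^ j := one_le_pow₀ (by norm_num)
    nlinarith

lemma dbl_div_succ {q : ℤ} (hq : 0 < q) (y : ℤ) (j : ℕ) :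
    (dbl q y (j + 1) : ℝ) / (q : ℝ) ^ 2 ^ (j + 1) =
      2 * ((dbl q y j : ℝ) / (q : ℝ) ^ 2 ^ j) ^ 2 - 1 := by
  have : (0 : ℝ) < q := by exact_mod_cast hq
  have h2 : (q : ℝ) ^ 2 ^ (j + 1) = ((q : ℝ) ^ 2 ^ j) ^ 2 := by rw [pow_succ 2 j, pow_mul]
  rw [h2]
  simp only [dbl]
  push_cast
  field_simp

lemma le_dbl {q y : ℤ} (hq : 0 < q) (h : q ≤ y) (j : ℕ) : q ^ 2 ^ j ≤ dbl q y j := by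
  induction j with
  | zero => simpa [dbl] using h
  | succ j ih =>
    rw [pow_succ 2 j, pow_mul]
    have : 0 < q ^ 2 ^ j := by positivity
    simp only [dbl]
    nlinarith

lemma exists_four_pow_mul_le {k R : ℕ} (hR : 0 < R) (hRk : R ≤ k) :
    ∃ l, k ≤ 4 ^ l * R ∧ 4 ^ l * R < 4 * k := by
  have hex : ∃ l, k ≤ 4 ^ l * R := ⟨k, by
    have : k < 4 ^ k := Nat.lt_pow_self (by norm_num)
    nlinarith⟩
  obtain ⟨l, hl, hmin⟩ : ∃ l, k ≤ 4 ^ l * R ∧ ∀ j < l, ¬ k ≤ 4 ^ j * R :=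
    ⟨_, Nat.find_spec hex, fun j hj => Nat.find_min hex hj⟩
  refine ⟨l, hl, ?_⟩
  rcases l with _ | l
  · simp; omega
  · have := hmin l (by omega)
    rw [pow_succ, mul_right_comm]
    omega

/-- The m doublings split into two phases. The first l of them lift the normalized value from 1 +
R/k to at least 2, which needs 4^l R ≥ k. The remaining j = m - l square it repeatedly and give
2^(2^j). Since 4^l R < 4k as well, `hm` yields N ≤ 2^j. -/
lemma two_pow_mul_le_dbl {k R m N : ℕ} (hR : 0 < R) (hRk : R ≤ k)
    (hm : 4 * k * N ^ 2 ≤ (2 ^ m) ^ 2 * R) (hmk : 4 * k ≤ (2 ^ m) ^ 2 * R) {y : ℤ}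
    (hy : (k : ℤ) + R ≤ y) :
    (2 : ℤ) ^ N * (k : ℤ) ^ 2 ^ m ≤ dbl k y m := by
  obtain ⟨l, hl1, hl2⟩ := exists_four_pow_mul_le hR hRk
  have hk : 0 < k := by omega
  have e4 : ∀ n : ℕ, (2 ^ n) ^ 2 = 4 ^ n := fun n => by rw [← pow_mul, mul_comm, pow_mul]; norm_num
  rw [e4] at hm hmk
  have hlm : l ≤ m := by
    have h1 : 4 ^ l * R < 4 ^ m * R := lt_of_lt_of_le hl2 hmk
    have h2 : 4 ^ l < 4 ^ m := lt_of_mul_lt_mul_right h1 (Nat.zero_le _)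
    exact ((Nat.pow_lt_pow_iff_right (by norm_num)).1 h2).le
  obtain ⟨j, rfl⟩ := Nat.exists_eq_add_of_le hlm
  have hN : N ≤ 2 ^ j := by
    have h1 : 4 * k * N ^ 2 ≤ 4 ^ j * (4 ^ l * R) := by
      rw [pow_add] at hm; nlinarith
    have h2 : 4 ^ j * (4 ^ l * R) ≤ 4 ^ j * (4 * k) := Nat.mul_le_mul_left _ hl2.le
    have h3 : 4 * k * N ^ 2 ≤ 4 * k * (2 ^ j) ^ 2 := by
      rw [e4]; linarith
    have h4 : N ^ 2 ≤ (2 ^ j) ^ 2 := Nat.le_of_mul_le_mul_left h3 (by omega)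
    exact (Nat.pow_le_pow_iff_left (by norm_num)).1 h4
  have hkz : (0 : ℤ) < k := by exact_mod_cast hk
  have hkr : (0 : ℝ) < k := by exact_mod_cast hk
  set e : ℕ → ℝ := fun j => (dbl k y j : ℝ) / ((k : ℤ) : ℝ) ^ 2 ^ j with he
  have hrec : ∀ j, e (j + 1) = 2 * e j ^ 2 - 1 := fun j => dbl_div_succ hkz y j
  have h0 : 1 + (R : ℝ) / k ≤ e 0 := by
    have : ((k : ℤ) : ℝ) + R ≤ y := by exact_mod_cast hy
    simp only [he, dbl, pow_zero, pow_one]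
    push_cast at this ⊢
    rw [one_add_div hkr.ne']
    gcongr
  have hel : 2 ≤ e l := by
    refine le_trans ?_ (le_iterate_of_one_add_le hrec (by positivity) h0 l)
    have : (k : ℝ) ≤ 4 ^ l * R := by exact_mod_cast hl1
    have : 1 ≤ 4 ^ l * ((R : ℝ) / k) := by
      rw [← mul_div_assoc, le_div_iff₀ hkr]; linarith
    linarith
  have h1 := two_pow_two_pow_le_iterate hrec hel j
  have h2 : (2 : ℝ) ^ N ≤ e (l + j) :=
    le_trans (pow_le_pow_right₀ (by norm_num) hN) h1
  rw [he] at h2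
  simp only at h2
  rw [le_div_iff₀ (by push_cast; positivity)] at h2
  exact_mod_cast h2

open Polynomial in
lemma exists_polynomial_dbl (q a : ℤ) (m : ℕ) :
    ∃ P : ℤ[X], P.natDegree ≤ 2 ^ m ∧ ∀ z : ℤ, P.eval z = dbl q (a - 2 * z) m := by
  induction m with
  | zero =>
    refine ⟨C a - C 2 * X, ?_, fun z => by simp [dbl]⟩
    rw [pow_zero]
    compute_degree
  | succ m ih =>
    obtain ⟨P, hP, hz⟩ := ih
    refine ⟨C 2 * P ^ 2 - C ((q ^ 2 ^ m) ^ 2), ?_, fun z => by simp [dbl, hz]⟩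
    rw [natDegree_sub_C]
    refine (natDegree_C_mul_le _ _).trans (natDegree_pow_le.trans ?_)
    rw [pow_succ]; omega

/-! ### Newton interpolation -/

section Newton

open fwdDiff

lemma eq_sum_choose_mul_fwdDiff (f : ℕ → ℤ) (n : ℕ) :
    f n = ∑ j ∈ Finset.range (n + 1), (n.choose j : ℤ) * (Δ_[1])^[j] f 0 := by
  have := shift_eq_sum_fwdDiff_iter 1 f n 0
  simpa using this

/-- Values of the polynomial of degree less than `R` that agrees with `u` at `0, …, R - 1`. -/
def newtonTrunc (R : ℕ) (u : ℕ → ℤ) (z : ℕ) : ℤ :=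
  ∑ j ∈ Finset.range R, (z.choose j : ℤ) * (Δ_[1])^[j] u 0

lemma newtonTrunc_of_lt {R z : ℕ} (u : ℕ → ℤ) (h : z < R) : newtonTrunc R u z = u z := by
  rw [eq_sum_choose_mul_fwdDiff u z, newtonTrunc]
  symm
  apply Finset.sum_subset
  · intro i; simp; omega
  · intro i _ hi
    simp at hi
    rw [Nat.choose_eq_zero_of_lt (by omega)]; simp

lemma abs_fwdDiff_iter_le_of_shift {u : ℕ → ℤ} {M : ℤ} {j n : ℕ}
    (h : ∀ i ≤ j, |u (n + i)| ≤ M) : |(Δ_[1])^[j] u n| ≤ 2 ^ j * M := by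
  rw [fwdDiff_iter_eq_sum_shift]
  refine (Finset.abs_sum_le_sum_abs _ _).trans ?_
  have h2 : (2 : ℤ) ^ j = ∑ i ∈ Finset.range (j + 1), (j.choose i : ℤ) := by
    exact_mod_cast (Nat.sum_range_choose j).symm
  rw [h2, Finset.sum_mul]
  apply Finset.sum_le_sum
  intro i hi
  simp at hi
  simp only [smul_eq_mul, abs_mul, abs_pow, abs_neg, abs_one, one_pow, one_mul, mul_one,
    Nat.abs_cast]
  exact mul_le_mul_of_nonneg_left (h i (by omega)) (by positivity)

lemma abs_fwdDiff_iter_le {u : ℕ → ℤ} {M : ℤ} {j : ℕ} (h : ∀ i ≤ j, |u i| ≤ M) :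
    |(Δ_[1])^[j] u 0| ≤ 2 ^ j * M :=
  abs_fwdDiff_iter_le_of_shift fun i hi => by simpa using h i hi

lemma sum_range_pow_le (a R : ℕ) : ∑ j ∈ Finset.range R, a ^ j ≤ (a + 1) ^ R := by
  induction R with
  | zero => simp
  | succ R ih =>
    rw [Finset.sum_range_succ, pow_succ]
    have h1 : a ^ R ≤ (a + 1) ^ R := Nat.pow_le_pow_left (by omega) _
    rcases Nat.eq_zero_or_pos a with rfl | h
    · rcases R with _ | R
      · simp
      · simp
    · calc _ ≤ (a + 1) ^ R + (a + 1) ^ R * 1 := by omega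
        _ ≤ (a + 1) ^ R + (a + 1) ^ R * a := by gcongr; exact h
        _ = _ := by ring

/-- The j-th Newton term is at most z^j · 2^j M, and the geometric sum of (2z)^j over j < R is at
most (2z+1)^R. This controls the interpolation polynomial beyond its nodes. -/
lemma abs_newtonTrunc_le {R : ℕ} {u : ℕ → ℤ} {M : ℤ} (hM : 0 ≤ M) (h : ∀ i < R, |u i| ≤ M)
    (z : ℕ) : |newtonTrunc R u z| ≤ (2 * z + 1) ^ R * M := by
  refine (Finset.abs_sum_le_sum_abs _ _).trans ?_
  have h1 : ((∑ j ∈ Finset.range R, (2 * z) ^ j : ℕ) : ℤ) ≤ (((2 * z + 1) ^ R : ℕ) : ℤ) := by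
    exact_mod_cast sum_range_pow_le (2 * z) R
  push_cast at h1
  refine le_trans ?_ (mul_le_mul_of_nonneg_right h1 hM)
  rw [Finset.sum_mul]
  apply Finset.sum_le_sum
  intro j hj
  simp at hj
  rw [abs_mul, Nat.abs_cast]
  have h2 := abs_fwdDiff_iter_le (u := u) (M := M) (j := j) fun i hi => h i (by omega)
  have h3 : (z.choose j : ℤ) ≤ z ^ j := by exact_mod_cast Nat.choose_le_pow z j
  calc (z.choose j : ℤ) * |(Δ_[1])^[j] u 0| ≤ z ^ j * (2 ^ j * M) := by gcongr
    _ = (2 * z) ^ j * M := by ring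

/-- A bound that does not depend on `R`. -/
lemma abs_newtonTrunc_le_three_pow {R : ℕ} {u : ℕ → ℤ} {M : ℤ} (hM : 0 ≤ M) (h : ∀ i, |u i| ≤ M)
    (z : ℕ) : |newtonTrunc R u z| ≤ 3 ^ z * M := by
  refine (Finset.abs_sum_le_sum_abs _ _).trans ?_
  have h1 : ∀ j, |(z.choose j : ℤ) * (Δ_[1])^[j] u 0| ≤ (z.choose j : ℤ) * (2 ^ j * M) := by
    intro j
    rw [abs_mul, Nat.abs_cast]
    exact mul_le_mul_of_nonneg_left (abs_fwdDiff_iter_le fun i _ => h i) (by positivity)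
  have h3 : (3 : ℤ) ^ z * M = ∑ j ∈ Finset.range (z + 1), (z.choose j : ℤ) * (2 ^ j * M) := by
    have := add_pow (2 : ℤ) 1 z
    norm_num at this
    rw [this, Finset.sum_mul]
    exact Finset.sum_congr rfl fun j _ => by ring
  rw [h3]
  refine (Finset.sum_le_sum fun j _ => h1 j).trans ?_
  refine (Finset.sum_le_sum_of_subset_of_nonneg
    (Finset.range_subset_range.2 (le_max_left R (z + 1))) fun j _ _ => by positivity).trans ?_
  refine le_of_eq (Finset.sum_subset (Finset.range_subset_range.2 (le_max_right R (z + 1))) ?_).symm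
  intro j _ hj
  simp at hj
  rw [Nat.choose_eq_zero_of_lt (by omega)]; simp

/-- Differences at 0 are the coordinates in the basis of binomial coefficients. Hence interpolation
at 0, …, R - 1 amounts to erasing all differences of order R and above, which is how the machine
performs it. -/
lemma fwdDiff_iter_newtonTrunc (R : ℕ) (u : ℕ → ℤ) (j : ℕ) :
    (Δ_[1])^[j] (newtonTrunc R u) 0 = if j < R then (Δ_[1])^[j] u 0 else 0 := by
  have h1 : newtonTrunc R u = ∑ i ∈ Finset.range R,
      ((Δ_[1])^[i] u 0) • (fun z : ℕ => (z.choose i : ℤ)) := by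
    funext z
    simp [newtonTrunc, Finset.sum_apply, mul_comm]
  rw [h1, fwdDiff_iter_finsetSum, Finset.sum_apply]
  simp only [fwdDiff_iter_const_smul, Pi.smul_apply, fwdDiff_iter_choose_zero, smul_eq_mul,
    mul_ite, mul_one, mul_zero, Finset.sum_ite_eq, Finset.mem_range]

/-! ### The numerators and the denominator of the approximating polynomial -/

section Numerators

variable (r k R m : ℕ)

/-- A scaled Chebyshev polynomial of degree `2 ^ m`: at most `k ^ 2 ^ m` on `[R, R + k]` and large
below `R`. -/
def damping (z : ℕ) : ℤ := dbl k (k + 2 * R - 2 * z) m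

/-- The common denominator of all coefficients. Every damping value at a node below `r` divides it,
so the interpolation data are integers. -/
def dampingProd : ℤ := ∏ i ∈ Finset.range r, damping k R m i

/-- The data that the interpolation polynomial must meet: after multiplication by the damping factor
it equals the denominator below `r` and vanishes from `r` on. -/
def nodeValue (z : ℕ) : ℤ := if z < r then dampingProd r k R m / damping k R m z else 0

def valueNum (z : ℕ) : ℤ :=
  dampingProd r k R m - newtonTrunc R (nodeValue r k R m) z * damping k R m z

/-- Numerators of the coefficients in the basis of binomial coefficients. -/
def coeffNum (j : ℕ) : ℤ := if j ≤ k then (Δ_[1])^[j] (valueNum r k R m) 0 else 0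

/-- The parameters fit together. -/
structure ParamsFit (r k g R m : ℕ) : Prop where
  one_le_r : 1 ≤ r
  r_le : r ≤ k
  two_le_g : 2 ≤ g
  R_eq : R = r * g
  m_large : 4 * k * R * (2 * m + 1) ^ 2 ≤ (2 ^ m) ^ 2

variable {r k R m} {g : ℕ}

namespace ParamsFit

lemma g_le (h : ParamsFit r k g R m) : g ≤ R := by
  have := h.one_le_r; rw [h.R_eq]; nlinarith

lemma two_mul_r_le (h : ParamsFit r k g R m) : 2 * r ≤ R := by
  have := h.two_le_g; rw [h.R_eq]; nlinarith

lemma four_mul_le (h : ParamsFit r k g R m) : 4 * k * R ≤ (2 ^ m) ^ 2 :=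
  le_trans (Nat.le_mul_of_pos_right _ (by positivity)) h.m_large

lemma two_mul_k_lt (h : ParamsFit r k g R m) : 2 * k + 1 ≤ 2 ^ (2 * m) := by
  have h1 := h.four_mul_le
  have h2 := h.two_mul_r_le
  have h3 := h.one_le_r
  have h4 := h.r_le
  rw [mul_comm 2 m, pow_mul]
  nlinarith

lemma R_le (h : ParamsFit r k g R m) (hR : R ≤ k) : R ≤ 2 ^ m := by
  have h1 := h.four_mul_le
  refine (Nat.pow_le_pow_iff_left two_ne_zero).1 (le_trans ?_ h1)
  nlinarith

/-- When `k < R` every point 0, …, k is an interpolation node, and the degree bound has to come from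
`k` instead of from the degree R - 1 + 2^m. -/
lemma k_le (h : ParamsFit r k g R m) (hR : k < R) : k ≤ 2 * 2 ^ m := by
  have h1 := h.four_mul_le
  refine (Nat.pow_le_pow_iff_left two_ne_zero).1 ?_
  nlinarith

lemma pos_k (h : ParamsFit r k g R m) : 0 < k := lt_of_lt_of_le h.one_le_r h.r_le

lemma damping_pos (h : ParamsFit r k g R m) {i : ℕ} (hi : i < r) : 0 < damping k R m i := by
  have hk : (0 : ℤ) < k := by exact_mod_cast h.pos_k
  refine lt_of_lt_of_le (b := (k : ℤ) ^ 2 ^ m) (by positivity) (le_dbl hk ?_ m)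
  have := h.two_mul_r_le
  omega

lemma dampingProd_pos (h : ParamsFit r k g R m) : 0 < dampingProd r k R m :=
  Finset.prod_pos fun _ hi => h.damping_pos (Finset.mem_range.1 hi)

lemma nodeValue_mul_damping (z : ℕ) :
    nodeValue r k R m z * damping k R m z = if z < r then dampingProd r k R m else 0 := by
  unfold nodeValue
  split_ifs with hz
  · exact Int.ediv_mul_cancel (Finset.dvd_prod_of_mem _ (Finset.mem_range.2 hz))
  · simp

lemma valueNum_of_lt {z : ℕ} (hz : z < R) :
    valueNum r k R m z = if r ≤ z then dampingProd r k R m else 0 := by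
  rw [valueNum, newtonTrunc_of_lt _ hz, nodeValue_mul_damping]
  split_ifs <;> omega

/-- For i < r the inequality 2r ≤ R gives k + 2R - 2i ≥ k + R. The field `m_large`, multiplied by
`R`, is precisely the hypothesis of `two_pow_mul_le_dbl` for N = (2m+1)R. -/
lemma le_damping (h : ParamsFit r k g R m) (hR : R ≤ k) {i : ℕ} (hi : i < r) :
    2 ^ ((2 * m + 1) * R) * (k : ℤ) ^ 2 ^ m ≤ damping k R m i := by
  have h2 := h.two_mul_r_le
  have h1 := h.one_le_r
  refine two_pow_mul_le_dbl (R := R) (by omega) hR ?_ ?_ (by omega)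
  · calc 4 * k * ((2 * m + 1) * R) ^ 2 = 4 * k * R * (2 * m + 1) ^ 2 * R := by ring
      _ ≤ _ := Nat.mul_le_mul_right _ h.m_large
  · have h3 := h.four_mul_le
    have : 4 * k ≤ 4 * k * R := Nat.le_mul_of_pos_right _ (by omega)
    calc 4 * k ≤ (2 ^ m) ^ 2 := this.trans h3
      _ ≤ _ := Nat.le_mul_of_pos_right _ (by omega)

lemma nodeValue_nonneg (h : ParamsFit r k g R m) (i : ℕ) : 0 ≤ nodeValue r k R m i := by
  unfold nodeValue
  split_ifs with hi
  · exact Int.ediv_nonneg h.dampingProd_pos.le (h.damping_pos hi).le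
  · rfl

/-- The node values are at most b/Q with Q = 2^((2m+1)R) k^(2^m). Extrapolation costs (2z+1)^R ≤
2^(2mR), and the damping factor is at most k^(2^m) because z lies in [R, R + k]. The product is at
most b 2^(-R), and g ≤ R. -/
lemma two_pow_mul_abs_le (h : ParamsFit r k g R m) {z : ℕ} (hz : R ≤ z) (hzk : z ≤ k) :
    2 ^ g * |newtonTrunc R (nodeValue r k R m) z * damping k R m z| ≤ dampingProd r k R m := by
  have hRk := hz.trans hzk
  set b := dampingProd r k R m with hb
  have hk : (0 : ℤ) < k := by exact_mod_cast h.pos_k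
  set Q : ℤ := 2 ^ ((2 * m + 1) * R) * (k : ℤ) ^ 2 ^ m with hQ
  have hQ0 : 0 < Q := by positivity
  have hb0 : 0 < b := h.dampingProd_pos
  have hu : ∀ i < R, |nodeValue r k R m i| ≤ b / Q := by
    intro i _
    rw [abs_of_nonneg (h.nodeValue_nonneg i), Int.le_ediv_iff_mul_le hQ0]
    by_cases hi : i < r
    · have h1 := nodeValue_mul_damping (r := r) (k := k) (R := R) (m := m) i
      rw [if_pos hi] at h1
      rw [← hb] at h1
      rw [← h1]
      exact mul_le_mul_of_nonneg_left (h.le_damping hRk hi) (h.nodeValue_nonneg i)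
    · simp [nodeValue, hi, hb0.le]
  have hM : 0 ≤ b / Q := Int.ediv_nonneg hb0.le hQ0.le
  have hv := abs_newtonTrunc_le hM hu z
  have hY : |damping k R m z| ≤ (k : ℤ) ^ 2 ^ m := by
    refine abs_dbl_le (abs_le.2 ⟨?_, ?_⟩) m <;> omega
  have hpow : (2 : ℤ) ^ g * (2 * z + 1) ^ R ≤ 2 ^ ((2 * m + 1) * R) := by
    have h1 : (2 * (z : ℤ) + 1) ≤ 2 ^ (2 * m) := by
      have := h.two_mul_k_lt
      have : 2 * z + 1 ≤ 2 ^ (2 * m) := by omega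
      exact_mod_cast this
    calc (2 : ℤ) ^ g * (2 * z + 1) ^ R ≤ 2 ^ R * (2 ^ (2 * m)) ^ R := by
          gcongr
          · norm_num
          · exact h.g_le
      _ = 2 ^ ((2 * m + 1) * R) := by rw [← pow_mul, ← pow_add]; ring_nf
  rw [abs_mul]
  calc 2 ^ g * (|newtonTrunc R (nodeValue r k R m) z| * |damping k R m z|)
      ≤ 2 ^ g * (((2 * z + 1) ^ R * (b / Q)) * (k : ℤ) ^ 2 ^ m) := by gcongr
    _ = (2 ^ g * (2 * z + 1) ^ R) * ((b / Q) * (k : ℤ) ^ 2 ^ m) := by ring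
    _ ≤ 2 ^ ((2 * m + 1) * R) * ((b / Q) * (k : ℤ) ^ 2 ^ m) := by gcongr
    _ = (b / Q) * Q := by rw [hQ]; ring
    _ ≤ b := Int.ediv_mul_le _ hQ0.ne'

lemma two_pow_mul_abs_valueNum_sub_le (h : ParamsFit r k g R m) {z : ℕ} (hzk : z ≤ k) :
    2 ^ g * |(if r ≤ z then dampingProd r k R m else 0) - valueNum r k R m z| ≤
      dampingProd r k R m := by
  rcases lt_or_ge z R with hz | hz
  · rw [valueNum_of_lt hz, sub_self, abs_zero, mul_zero]; exact h.dampingProd_pos.le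
  · have hr : r ≤ z := by have := h.two_mul_r_le; omega
    rw [if_pos hr, valueNum, sub_sub_cancel]
    exact h.two_pow_mul_abs_le hz hzk

lemma abs_valueNum_le (h : ParamsFit r k g R m) {z : ℕ} (hzk : z ≤ k) :
    |valueNum r k R m z| ≤ 2 * dampingProd r k R m := by
  have h1 := h.two_pow_mul_abs_valueNum_sub_le hzk
  have h2 : (1 : ℤ) ≤ 2 ^ g := one_le_pow₀ (by norm_num)
  have hb := h.dampingProd_pos
  set e := (if r ≤ z then dampingProd r k R m else 0) with he
  have h3 : |e - valueNum r k R m z| ≤ dampingProd r k R m :=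
    le_trans (le_mul_of_one_le_left (abs_nonneg _) h2) h1
  have h4 : 0 ≤ e ∧ e ≤ dampingProd r k R m := by
    rw [he]; split_ifs <;> constructor <;> omega
  rw [abs_le] at h3 ⊢
  constructor <;> omega

/-- A j-th difference of values bounded by 2b. This provides the coefficient bound 2^(t+1). -/
lemma abs_coeffNum_le (h : ParamsFit r k g R m) (j : ℕ) :
    |coeffNum r k R m j| ≤ 2 ^ (j + 1) * dampingProd r k R m := by
  have hb := h.dampingProd_pos
  unfold coeffNum
  split_ifs with hj
  · rw [pow_succ, mul_assoc]
    exact abs_fwdDiff_iter_le fun i hi => h.abs_valueNum_le (hi.trans hj)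
  · rw [abs_zero]; positivity

/-- Needed for d = 1, where the permitted bound is a power of 1 and leaves no room for the factor
2^(j+1). Here the polynomial is z itself. -/
lemma abs_coeffNum_le_of_k_eq_one (h : ParamsFit r 1 g R m) (j : ℕ) :
    |coeffNum r 1 R m j| ≤ dampingProd r 1 R m := by
  have hb := h.dampingProd_pos
  have hr : r = 1 := le_antisymm h.r_le h.one_le_r
  have hR := h.two_mul_r_le
  have h0 : valueNum r 1 R m 0 = 0 := by rw [valueNum_of_lt (by omega)]; simp [hr]
  have h1 : valueNum r 1 R m 1 = dampingProd r 1 R m := by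
    rw [valueNum_of_lt (by omega)]; simp [hr]
  unfold coeffNum
  split_ifs with hj
  · rcases (by omega : j = 0 ∨ j = 1) with rfl | rfl
    · simp [h0, hb.le]
    · simp [fwdDiff, h0, h1, abs_of_pos hb]
  · rw [abs_zero]; exact hb.le

open Polynomial in
-- Rational coefficients are required because binom(z, j) has denominator j! as a polynomial in z.
-- The lemma serves only to bound the degree.
lemma exists_polynomial_newtonTrunc_add (R : ℕ) (u : ℕ → ℤ) (b : ℚ) (P : ℚ[X]) :
    ∃ Q : ℚ[X], Q.natDegree ≤ R - 1 + P.natDegree ∧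
      ∀ z : ℕ, Q.eval (z : ℚ) = b - (newtonTrunc R u z : ℚ) * P.eval (z : ℚ) := by
  refine ⟨C b - (∑ j ∈ Finset.range R,
    C ((((Δ_[1])^[j] u 0 : ℤ) : ℚ) / (j.factorial : ℚ)) * descPochhammer ℚ j) * P, ?_, ?_⟩
  · refine (natDegree_sub_le _ _).trans (max_le (by simp) (natDegree_mul_le.trans ?_))
    gcongr
    refine natDegree_sum_le_of_forall_le _ _ fun j hj => ?_
    refine (natDegree_C_mul_le _ _).trans ?_
    rw [descPochhammer_natDegree]
    simp at hj; omega
  · intro z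
    simp only [eval_sub, eval_C, eval_mul, newtonTrunc, eval_finsetSum]
    push_cast
    congr 2
    refine Finset.sum_congr rfl fun j _ => ?_
    rw [descPochhammer_eval_eq_descFactorial, Nat.descFactorial_eq_factorial_mul_choose]
    have : (j.factorial : ℚ) ≠ 0 := by exact_mod_cast j.factorial_ne_zero
    push_cast
    field_simp

/-- If R ≤ k, the numerators are values of a polynomial of degree at most R - 1 + 2^m < j, whose
j-th difference vanishes. If k < R, such an index j already exceeds k. -/
lemma coeffNum_eq_zero (h : ParamsFit r k g R m) {j : ℕ} (hj : 2 * 2 ^ m < j) :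
    coeffNum r k R m j = 0 := by
  unfold coeffNum
  split_ifs with hjk
  · have hR : R ≤ k := by
      by_contra hR
      have := h.k_le (by omega)
      omega
    have hRW := h.R_le hR
    obtain ⟨P, hP, hPe⟩ := exists_polynomial_dbl k (k + 2 * R) m
    obtain ⟨Q, hQ, hQe⟩ := exists_polynomial_newtonTrunc_add R (nodeValue r k R m)
      (dampingProd r k R m) (P.map (Int.castRingHom ℚ))
    have hdeg : Q.natDegree < j := by
      have := Polynomial.natDegree_map_le (p := P) (f := Int.castRingHom ℚ)
      have h1 := h.two_mul_r_le
      omega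
    have hval : ∀ z : ℕ, Q.eval (z : ℚ) = (valueNum r k R m z : ℚ) := by
      intro z
      have h1 : (P.map (Int.castRingHom ℚ)).eval (z : ℚ) = ((P.eval (z : ℤ) : ℤ) : ℚ) := by
        simp
      rw [hQe, h1, hPe, valueNum, damping]
      push_cast
      rfl
    have hz := congr_fun (Polynomial.fwdDiff_iter_eq_zero_of_degree_lt hdeg) 0
    rw [fwdDiff_iter_eq_sum_shift] at hz ⊢
    have : ((∑ i ∈ Finset.range (j + 1), ((-1 : ℤ) ^ (j - i) * (j.choose i : ℤ)) •
        valueNum r k R m (0 + i • 1) : ℤ) : ℚ) = 0 := by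
      rw [← Pi.zero_apply (M := fun _ => ℚ) (0 : ℚ), ← hz]
      push_cast
      refine Finset.sum_congr rfl fun i _ => ?_
      simp [hval]
    exact_mod_cast this
  · rfl

lemma sum_choose_mul_coeffNum (h : ParamsFit r k g R m) {z : ℕ} (hz : z ≤ k) :
    ∑ j ∈ Finset.range (2 * 2 ^ m + 1), (z.choose j : ℤ) * coeffNum r k R m j =
      valueNum r k R m z := by
  rw [eq_sum_choose_mul_fwdDiff (valueNum r k R m) z]
  have h1 : ∑ j ∈ Finset.range (z + 1), (z.choose j : ℤ) * (Δ_[1])^[j] (valueNum r k R m) 0 =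
      ∑ j ∈ Finset.range (z + 1), (z.choose j : ℤ) * coeffNum r k R m j := by
    refine Finset.sum_congr rfl fun j hj => ?_
    simp at hj
    rw [coeffNum, if_pos (by omega)]
  rw [h1]
  rcases le_total z (2 * 2 ^ m) with hle | hle
  · symm
    apply Finset.sum_subset
    · intro i; simp; omega
    · intro i _ hi
      simp at hi
      rw [Nat.choose_eq_zero_of_lt (by omega)]; simp
  · apply Finset.sum_subset
    · intro i; simp; omega
    · intro i _ hi
      simp at hi
      rw [h.coeffNum_eq_zero (by omega)]; simp

lemma approx (h : ParamsFit r k g R m) {z : ℕ} (hz : z ≤ k) :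
    |(if r ≤ z then (1 : ℝ) else 0) - ∑ j ∈ Finset.range (2 * 2 ^ m + 1), (z.choose j : ℝ) *
      ((coeffNum r k R m j : ℝ) / dampingProd r k R m)| ≤ (1 / 2) ^ g := by
  have h1 := h.two_pow_mul_abs_valueNum_sub_le hz
  have hb : (0 : ℝ) < dampingProd r k R m := by exact_mod_cast h.dampingProd_pos
  have h2 : ∑ j ∈ Finset.range (2 * 2 ^ m + 1), (z.choose j : ℝ) *
      ((coeffNum r k R m j : ℝ) / dampingProd r k R m) =
      (valueNum r k R m z : ℝ) / dampingProd r k R m := by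
    rw [← h.sum_choose_mul_coeffNum hz]
    push_cast
    rw [Finset.sum_div]
    exact Finset.sum_congr rfl fun j _ => by ring
  have h3 : (if r ≤ z then (1 : ℝ) else 0) =
      ((if r ≤ z then dampingProd r k R m else 0 : ℤ) : ℝ) / dampingProd r k R m := by
    split_ifs
    · field_simp
    · simp
  have h4 : (2 : ℝ) ^ g * |((if r ≤ z then dampingProd r k R m else 0 : ℤ) : ℝ) -
      valueNum r k R m z| ≤ dampingProd r k R m := by exact_mod_cast h1
  rw [h2, h3, ← sub_div, abs_div, abs_of_pos hb, div_le_iff₀ hb, one_div, inv_pow,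
    inv_mul_eq_div, le_div_iff₀ (by positivity), mul_comm]
  exact h4

end ParamsFit

end Numerators

end Newton

/-! ### The size of the parameters -/

lemma sq_le_two_mul_two_pow (m : ℕ) : m ^ 2 ≤ 2 * 2 ^ m := by
  induction m with
  | zero => simp
  | succ m ih =>
    rcases le_or_gt m 2 with h | h
    · interval_cases m <;> norm_num
    · rw [pow_succ 2]; nlinarith

lemma exists_min_exponent (a : ℕ) :
    ∃ m : ℕ, a * (2 * m + 1) ^ 2 ≤ (2 ^ m) ^ 2 ∧
      ∀ j < m, (2 ^ j) ^ 2 < a * (2 * j + 1) ^ 2 := by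
  have hex : ∃ m : ℕ, a * (2 * m + 1) ^ 2 ≤ (2 ^ m) ^ 2 := by
    refine ⟨a + 10, ?_⟩
    have h : ∀ n : ℕ, (n + 10) * (2 * (n + 10) + 1) ^ 2 ≤ (2 ^ (n + 10)) ^ 2 := by
      intro n
      induction n with
      | zero => norm_num
      | succ n ih =>
        have e : (2 ^ (n + 1 + 10)) ^ 2 = 4 * (2 ^ (n + 10)) ^ 2 := by ring
        rw [e]
        refine le_trans ?_ (Nat.mul_le_mul_left 4 ih)
        nlinarith
    exact le_trans (Nat.mul_le_mul_right _ (by omega)) (h a)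
  obtain ⟨m, hm, hmin⟩ := (⟨_, Nat.find_spec hex, fun j hj => Nat.find_min hex hj⟩ :
    ∃ m : ℕ, a * (2 * m + 1) ^ 2 ≤ (2 ^ m) ^ 2 ∧ ∀ j < m, ¬ a * (2 * j + 1) ^ 2 ≤ (2 ^ j) ^ 2)
  exact ⟨m, hm, fun j hj => not_le.1 (hmin j hj)⟩

/-- Minimality of m gives 2^m ≤ 16 s m for m ≥ 1, which still contains m on the right. A crude bound
on 2^m, polynomial in s, first yields m ≤ 16 log(2 + s), and inserting this gives 2^m ≤ 256 s log(2
+ s). -/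
lemma le_softO {C : ℕ} (hC : 600 ≤ C) {a m : ℕ} {s : ℝ} (hs : 0 ≤ s) (h2 : 2 ≤ a)
    (has : (a : ℝ) ≤ 3 * s ^ 2)
    (hmin : ∀ j < m, (2 ^ j) ^ 2 < 4 * a * (2 * j + 1) ^ 2) :
    (2 * 2 ^ m + 3 : ℝ) ≤ softO C s := by
  have h2a : (2 : ℝ) ≤ a := by exact_mod_cast h2
  have hs1 : 0.8 ≤ s := by nlinarith
  set L := Real.log (2 + s) with hL
  have hL1 : 1 ≤ L := by
    rw [hL, Real.le_log_iff_exp_le (by linarith)]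
    linarith [Real.exp_one_lt_d9]
  have key : (2 ^ m : ℝ) ≤ 256 * s * L := by
    rcases m with _ | m
    · norm_num; nlinarith
    have h1 : ((2 ^ m) ^ 2 : ℝ) < 4 * a * (2 * m + 1) ^ 2 := by exact_mod_cast hmin m (by omega)
    have h3 : ((2 : ℝ) ^ m) ^ 2 ≤ (4 * s * (2 * m + 1)) ^ 2 := by
      have : (0 : ℝ) ≤ (2 * m + 1) ^ 2 := by positivity
      nlinarith
    have h4 : (2 : ℝ) ^ m ≤ 4 * s * (2 * m + 1) := by
      exact (sq_le_sq₀ (by positivity) (by positivity)).1 h3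
    have h5 : (2 : ℝ) ^ (m + 1) ≤ 16 * s * (m + 1 : ℕ) := by
      push_cast; rw [pow_succ]; nlinarith
    have h6 : (((m + 1 : ℕ) : ℝ)) ^ 2 ≤ 2 * 2 ^ (m + 1) := by
      exact_mod_cast sq_le_two_mul_two_pow (m + 1)
    set M : ℝ := ((m + 1 : ℕ) : ℝ) with hM
    set W : ℝ := (2 : ℝ) ^ (m + 1) with hW
    have hW0 : 0 < W := by positivity
    have hM0 : 0 ≤ M := by positivity
    -- Square W ≤ 16 s M and use M² ≤ 2W to eliminate M.
    have h7 : W ≤ 512 * s ^ 2 := by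
      have : W * W ≤ 512 * s ^ 2 * W := by
        calc W * W ≤ (16 * s * M) * (16 * s * M) := by gcongr
          _ = 256 * s ^ 2 * M ^ 2 := by ring
          _ ≤ 256 * s ^ 2 * (2 * W) := by gcongr
          _ = _ := by ring
      exact le_of_mul_le_mul_right this hW0
    have h8 : W ≤ (2 + s) ^ 11 := by
      have e1 : (2 : ℝ) ^ 9 ≤ (2 + s) ^ 9 := by gcongr; linarith
      have e2 : s ^ 2 ≤ (2 + s) ^ 2 := by gcongr; linarith
      calc W ≤ 2 ^ 9 * s ^ 2 := by norm_num; linarith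
        _ ≤ (2 + s) ^ 9 * (2 + s) ^ 2 := by gcongr
        _ = _ := by ring
    have h9 : M * Real.log 2 ≤ 11 * L := by
      have := Real.log_le_log hW0 h8
      rw [hW, Real.log_pow, Real.log_pow] at this
      exact_mod_cast this
    have h10 : M ≤ 16 * L := by
      have := Real.log_two_gt_d9
      nlinarith
    calc W ≤ 16 * s * M := h5
      _ ≤ 16 * s * (16 * L) := by gcongr
      _ = _ := by ring
  -- Here log(2 + s) ≥ 1 is used. It holds because 2 ≤ a ≤ 3s² forces s ≥ 0.8, so that 2 + s > e.
  have hLC : L ≤ L ^ C := by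
    calc L = L ^ 1 := (pow_one L).symm
      _ ≤ L ^ C := pow_le_pow_right₀ hL1 (by omega)
  have hCr : (600 : ℝ) ≤ C := by exact_mod_cast hC
  calc (2 * 2 ^ m + 3 : ℝ) ≤ 600 * s * L := by nlinarith
    _ ≤ C * s * L ^ C := by gcongr

lemma softO_nonneg (C : ℕ) {s : ℝ} (hs : 0 ≤ s) : 0 ≤ softO C s := by
  have : 0 ≤ Real.log (2 + s) := Real.log_nonneg (by linarith)
  unfold softO
  positivity

/-! ### The multilinear polynomial with prescribed coefficients -/

section Multilinear

variable {d : ℕ}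

/-- The exponent vector of the monomial `∏ i ∈ S, X i`. -/
noncomputable def indicatorExp (S : Finset (Fin d)) : Fin d →₀ ℕ :=
  Finsupp.equivFunOnFinite.symm fun i => if i ∈ S then 1 else 0

@[simp] lemma indicatorExp_apply (S : Finset (Fin d)) (i : Fin d) :
    indicatorExp S i = if i ∈ S then 1 else 0 := rfl

lemma sum_indicatorExp (S : Finset (Fin d)) : ∑ i, indicatorExp S i = S.card := by simp

lemma indicatorExp_injective : Function.Injective (indicatorExp (d := d)) := by
  intro S T h
  ext i
  have := DFunLike.congr_fun h i
  simp only [indicatorExp_apply] at this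
  split_ifs at this <;> simp_all

/-- The ones of `x`. -/
def ones (x : Fin d → Bool) : Finset (Fin d) := Finset.univ.filter fun i => x i = true

@[simp] lemma mem_ones {x : Fin d → Bool} {i : Fin d} : i ∈ ones x ↔ x i = true := by simp [ones]

/-- `∑ c |S| ∏ i ∈ S, X i` over the sets `S` of at most `t` ones of `x`. -/
noncomputable def multilinear (x : Fin d → Bool) (t : ℕ) (c : ℕ → ℝ) : MvPolynomial (Fin d) ℝ :=
  ∑ S ∈ (ones x).powerset with S.card ≤ t, MvPolynomial.monomial (indicatorExp S) (c S.card)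

/-- The exponent vector `j` is bounded by `x`. -/
def ExpLe (x : Fin d → Bool) (j : Fin d →₀ ℕ) : Prop := ∀ i, j i ≤ (x i).toNat

lemma expLe_iff {x : Fin d → Bool} {j : Fin d →₀ ℕ} :
    ExpLe x j ↔ ∃ S ⊆ ones x, indicatorExp S = j := by
  constructor
  · intro h
    refine ⟨Finset.univ.filter fun i => j i ≠ 0, ?_, ?_⟩
    · intro i hi
      have := h i
      simp at hi
      by_contra hx
      simp at hx
      simp [hx] at this
      exact hi this
    · ext i
      have h1 := h i
      have h2 := Bool.toNat_le (x i)
      simp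
      split_ifs <;> omega
  · rintro ⟨S, hS, rfl⟩ i
    simp only [indicatorExp_apply]
    split_ifs with hi
    · have := hS hi
      simp at this
      simp [this]
    · simp

open Classical in
lemma coeff_multilinear (x : Fin d → Bool) {t : ℕ} (c : ℕ → ℝ) {j : Fin d →₀ ℕ}
    (hj : ∑ i, j i ≤ t) :
    (multilinear x t c).coeff j = if ExpLe x j then c (∑ i, j i) else 0 := by
  simp only [multilinear, MvPolynomial.coeff_sum, MvPolynomial.coeff_monomial]
  split_ifs with h
  · obtain ⟨S, hS, rfl⟩ := expLe_iff.1 h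
    rw [sum_indicatorExp] at hj ⊢
    rw [Finset.sum_eq_single S]
    · simp
    · intro T _ hT
      rw [if_neg fun e => hT (indicatorExp_injective e)]
    · intro hS'
      simp at hS'
      exact absurd (hS' hS) (by omega)
  · refine Finset.sum_eq_zero fun S hS => if_neg fun e => h (expLe_iff.2 ⟨S, ?_, e⟩)
    simp at hS
    exact hS.1

lemma totalDegree_multilinear_le (x : Fin d → Bool) (t : ℕ) (c : ℕ → ℝ) :
    (multilinear x t c).totalDegree ≤ t := by
  refine MvPolynomial.totalDegree_finsetSum_le fun S hS => ?_
  refine (MvPolynomial.totalDegree_monomial_le _ _).trans ?_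
  rw [Finsupp.sum_fintype _ _ (fun _ => rfl)]
  simp only [Finset.mem_filter] at hS
  simpa using hS.2

open Classical in
lemma multilinear_mem_polyFamily (x : Fin d → Bool) {t : ℕ} {c : ℕ → ℝ} {T : ℝ}
    (hc : ∀ m ≤ t, |c m| ≤ T) : multilinear x t c ∈ polyFamily d t T := by
  have hT : 0 ≤ T := (abs_nonneg _).trans (hc 0 (Nat.zero_le _))
  refine ⟨totalDegree_multilinear_le x t c, fun j => ?_⟩
  rcases le_or_gt (∑ i, j i) t with hj | hj
  · rw [coeff_multilinear x c hj]
    split_ifs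
    · exact hc _ hj
    · simpa using hT
  · rw [MvPolynomial.coeff_eq_zero_of_totalDegree_lt]
    · simpa using hT
    · refine lt_of_le_of_lt (totalDegree_multilinear_le x t c) (lt_of_lt_of_eq hj ?_)
      symm
      apply Finset.sum_subset (Finset.subset_univ _)
      intro i _ hi
      simpa using hi

/-- At a Boolean point the monomial of S is 1 exactly if S consists of ones of y. The sum therefore
counts the m-element subsets of the common ones of x and y, which gives binom(z, m). -/
lemma eval_multilinear (x y : Fin d → Bool) (t : ℕ) (c : ℕ → ℝ) :
    MvPolynomial.eval (boolPoint y) (multilinear x t c) =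
      ∑ m ∈ Finset.range (t + 1), ((∑ j, (x j).toNat * (y j).toNat).choose m : ℝ) * c m := by
  have hz : ∑ j, (x j).toNat * (y j).toNat = (ones x ∩ ones y).card := by
    rw [Finset.card_eq_sum_ones, ← Finset.sum_subset (Finset.subset_univ (ones x ∩ ones y))]
    · refine Finset.sum_congr rfl fun i hi => ?_
      simp at hi
      simp [hi]
    · intro i _ hi
      simp only [Finset.mem_inter, mem_ones, not_and, Bool.not_eq_true] at hi
      cases hx : x i
      · simp
      · simp [hi hx]
  have hev : ∀ S : Finset (Fin d), MvPolynomial.eval (boolPoint y)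
      (MvPolynomial.monomial (indicatorExp S) (c S.card)) =
        if S ⊆ ones y then c S.card else 0 := by
    intro S
    rw [MvPolynomial.eval_monomial, Finsupp.prod_fintype _ _ (fun _ => pow_zero _)]
    split_ifs with h
    · rw [Finset.prod_eq_one, mul_one]
      intro i _
      by_cases hi : i ∈ S
      · have := h hi
        simp at this
        simp [boolPoint, this]
      · simp [hi]
    · obtain ⟨i, hi, hy⟩ := Finset.not_subset.1 h
      rw [Finset.prod_eq_zero (Finset.mem_univ i), mul_zero]
      simp at hy
      simp [boolPoint, hi, hy]
  rw [multilinear, map_sum, Finset.sum_congr rfl fun S _ => hev S, hz, Finset.sum_filter]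
  have h1 : ∑ S ∈ (ones x).powerset, (if S.card ≤ t then
      (if S ⊆ ones y then c S.card else 0) else 0) =
      ∑ S ∈ (ones x ∩ ones y).powerset, (if S.card ≤ t then c S.card else 0) := by
    have : (ones x ∩ ones y).powerset = (ones x).powerset.filter fun S => S ⊆ ones y := by
      ext S; simp only [Finset.mem_powerset, Finset.mem_filter, Finset.subset_inter_iff]
    rw [this, Finset.sum_filter]
    refine Finset.sum_congr rfl fun S _ => ?_
    split_ifs <;> rfl
  rw [h1, Finset.sum_powerset_apply_card fun m => if m ≤ t then c m else 0]
  set n := (ones x ∩ ones y).card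
  have h2 : ∀ M, n ≤ M → t ≤ M → ∑ m ∈ Finset.range (n + 1), n.choose m • (if m ≤ t then c m else 0)
      = ∑ m ∈ Finset.range (t + 1), (n.choose m : ℝ) * c m := by
    intro M hn ht
    trans ∑ m ∈ Finset.range (M + 1), n.choose m • (if m ≤ t then c m else 0)
    · apply Finset.sum_subset
      · intro i; simp; omega
      · intro i _ hi
        simp at hi
        rw [Nat.choose_eq_zero_of_lt (by omega)]; simp
    · symm
      refine (Finset.sum_congr rfl fun m hm => ?_).trans (Finset.sum_subset
        (f := fun m => n.choose m • (if m ≤ t then c m else 0)) ?_ ?_)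
      · simp at hm
        simp [show m ≤ t by omega]
      · intro i; simp; omega
      · intro i _ hi
        simp at hi
        simp [show ¬ i ≤ t by omega]
  exact h2 (max n t) (le_max_left _ _) (le_max_right _ _)

end Multilinear

/-! ### A program logic with costs -/

namespace RAM

lemma one_le_bitLen (z : ℤ) : 1 ≤ bitLen z := by unfold bitLen; omega

lemma bitLen_le_of_abs_lt {z : ℤ} {n : ℕ} (hn : 1 ≤ n) (h : z.natAbs < 2 ^ n) : bitLen z ≤ n := by
  unfold bitLen
  rcases Nat.eq_zero_or_pos z.natAbs with h0 | h0
  · simpa [h0] using hn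
  · exact Nat.log_lt_of_lt_pow h0.ne' h

lemma natAbs_lt_two_pow_bitLen (z : ℤ) : z.natAbs < 2 ^ bitLen z :=
  Nat.lt_pow_succ_log_self (by norm_num) _

lemma bitLen_le_of_abs_le {z : ℤ} {B : ℕ} (h : |z| ≤ B) : bitLen z ≤ Nat.log 2 B + 1 := by
  unfold bitLen
  gcongr
  rw [Int.abs_eq_natAbs] at h
  exact_mod_cast h

lemma bitLen_apply_le (o : Op) (a b : ℤ) : bitLen (o.apply a b) ≤ bitLen a + bitLen b := by
  have ha := natAbs_lt_two_pow_bitLen a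
  have hb := natAbs_lt_two_pow_bitLen b
  have ha1 := one_le_bitLen a
  have hb1 := one_le_bitLen b
  have e1 : (1 : ℕ) ≤ 2 ^ bitLen a := Nat.one_le_two_pow
  have e2 : (1 : ℕ) ≤ 2 ^ bitLen b := Nat.one_le_two_pow
  have e3 : (2 : ℕ) ≤ 2 ^ bitLen a := by
    calc 2 = 2 ^ 1 := rfl
      _ ≤ _ := Nat.pow_le_pow_right (by norm_num) ha1
  have e4 : (2 : ℕ) ≤ 2 ^ bitLen b := by
    calc 2 = 2 ^ 1 := rfl
      _ ≤ _ := Nat.pow_le_pow_right (by norm_num) hb1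
  refine bitLen_le_of_abs_lt (by omega) ?_
  rw [pow_add]
  have hsum : a.natAbs + b.natAbs < 2 ^ bitLen a * 2 ^ bitLen b := by nlinarith
  cases o
  · exact lt_of_le_of_lt (Int.natAbs_add_le a b) hsum
  · exact lt_of_le_of_lt (Int.natAbs_sub_le a b) hsum
  · change (a * b).natAbs < _
    rw [Int.natAbs_mul]
    exact Nat.mul_lt_mul'' ha hb
  · refine lt_of_le_of_lt (Int.natAbs_ediv_le_natAbs a b) (lt_of_lt_of_le ha ?_)
    exact Nat.le_mul_of_pos_right _ (by omega)

/-! ### Lengths and costs of expressions under a uniform bound on the stored numbers -/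

/-- A bound for the length of the value, in units of the length of the stored numbers. -/
def Expr.len : Expr → ℕ
  | .lit z => bitLen z
  | .get _ => 1
  | .read _ _ => 1
  | .bin _ e₁ e₂ => e₁.len + e₂.len

/-- A bound for the cost, in units of the length of the stored numbers. -/
def Expr.weight : Expr → ℕ
  | .lit z => bitLen z
  | .get i => bitLen i + 1
  | .read a e => e.weight + bitLen a + 1
  | .bin _ e₁ e₂ => e₁.weight + e₂.weight + (e₁.len + e₂.len)

/-- All cells of the input array that are read are bounded by `B`. -/
def Expr.Safe (B : ℕ) (s : Store) : Expr → Prop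
  | .lit _ => True
  | .get _ => True
  | .read a e => e.Safe B s ∧ (a = 0 → |s.arr a (e.eval s).toNat| ≤ B)
  | .bin _ e₁ e₂ => e₁.Safe B s ∧ e₂.Safe B s

/-- All registers and all cells outside of the input array are bounded by `B`. -/
structure Bounded (B : ℕ) (s : Store) : Prop where
  reg : ∀ i, |s.reg i| ≤ B
  arr : ∀ a n, a ≠ 0 → |s.arr a n| ≤ B

lemma Expr.bitLen_eval_le {B : ℕ} {s : Store} (hs : Bounded B s) (e : Expr) (he : e.Safe B s) :
    bitLen (e.eval s) ≤ e.len * (Nat.log 2 B + 1) := by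
  induction e with
  | lit z => exact Nat.le_mul_of_pos_right _ (by omega)
  | get i => simpa [Expr.len, Expr.eval] using bitLen_le_of_abs_le (hs.reg i)
  | read a e _ =>
    rw [Expr.len, one_mul]
    apply bitLen_le_of_abs_le
    by_cases ha : a = 0
    · exact he.2 ha
    · exact hs.arr _ _ ha
  | bin o e₁ e₂ h₁ h₂ =>
    rw [Expr.len, add_mul]
    exact (bitLen_apply_le _ _ _).trans (add_le_add (h₁ he.1) (h₂ he.2))

lemma Expr.cost_le {B : ℕ} {s : Store} (hs : Bounded B s) (e : Expr) (he : e.Safe B s) :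
    e.cost s ≤ e.weight * (Nat.log 2 B + 1) := by
  induction e with
  | lit z => exact Nat.le_mul_of_pos_right _ (by omega)
  | get i =>
    simp only [Expr.cost, Expr.weight]
    have := bitLen_le_of_abs_le (hs.reg i)
    rw [add_mul, one_mul]
    exact add_le_add (Nat.le_mul_of_pos_right _ (by omega)) this
  | read a e ih =>
    have h1 := ih he.1
    have h2 : bitLen (s.arr a (e.eval s).toNat) ≤ Nat.log 2 B + 1 := by
      apply bitLen_le_of_abs_le
      by_cases ha : a = 0
      · exact he.2 ha
      · exact hs.arr _ _ ha
    simp only [Expr.cost, Expr.weight]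
    rw [add_mul, add_mul, one_mul]
    exact add_le_add (add_le_add h1 (Nat.le_mul_of_pos_right _ (by omega))) h2
  | bin o e₁ e₂ h₁ h₂ =>
    simp only [Expr.cost, Expr.weight]
    have h3 := (bitLen_apply_le o (e₁.eval s) (e₂.eval s)).trans
      (add_le_add (e₁.bitLen_eval_le hs he.1) (e₂.bitLen_eval_le hs he.2))
    rw [add_mul, add_mul, add_mul]
    exact add_le_add (add_le_add (h₁ he.1) (h₂ he.2)) h3

/-- The registers that a program may change. -/
def Cmd.regs : Cmd → List ℕ
  | .nop => []
  | .assign i _ => [i]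
  | .write _ _ _ => []
  | .seq c₁ c₂ => c₁.regs ++ c₂.regs
  | .cond _ c₁ c₂ => c₁.regs ++ c₂.regs
  | .loop _ c => c.regs

/-- The arrays that a program may change. -/
def Cmd.arrs : Cmd → List ℕ
  | .nop => []
  | .assign _ _ => []
  | .write a _ _ => [a]
  | .seq c₁ c₂ => c₁.arrs ++ c₂.arrs
  | .cond _ c₁ c₂ => c₁.arrs ++ c₂.arrs
  | .loop _ c => c.arrs

/-- `s` and `s'` agree outside of what `c` may change. -/
structure Frame (c : Cmd) (s s' : Store) : Prop where
  reg : ∀ i, i ∉ c.regs → s'.reg i = s.reg i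
  arr : ∀ a, a ∉ c.arrs → s'.arr a = s.arr a

lemma Frame.refl (c : Cmd) (s : Store) : Frame c s s := ⟨fun _ _ => rfl, fun _ _ => rfl⟩

lemma Frame.trans {c : Cmd} {s s' s'' : Store} (h : Frame c s s') (h' : Frame c s' s'') :
    Frame c s s'' :=
  ⟨fun i hi => (h'.reg i hi).trans (h.reg i hi), fun i hi => (h'.arr i hi).trans (h.arr i hi)⟩

lemma Frame.mono {c c' : Cmd} {s s' : Store} (h : Frame c s s') (hr : c.regs ⊆ c'.regs)
    (ha : c.arrs ⊆ c'.arrs) : Frame c' s s' :=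
  ⟨fun i hi => h.reg i fun h' => hi (hr h'), fun i hi => h.arr i fun h' => hi (ha h')⟩

lemma Exec.frame {c : Cmd} {s s' : Store} {n : ℕ} (h : Exec c s n s') : Frame c s s' := by
  induction h with
  | nop s => exact Frame.refl _ _
  | assign i e s =>
    refine ⟨fun j hj => ?_, fun _ _ => rfl⟩
    simp only [Cmd.regs, List.mem_singleton] at hj
    exact Function.update_of_ne hj _ _
  | write a e₁ e₂ s =>
    refine ⟨fun _ _ => rfl, fun j hj => ?_⟩
    simp only [Cmd.arrs, List.mem_singleton] at hj
    exact Function.update_of_ne hj _ _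
  | seq _ _ h₁ h₂ =>
    exact (h₁.mono (c' := .seq _ _) (List.subset_append_left _ _)
      (List.subset_append_left _ _)).trans
      (h₂.mono (List.subset_append_right _ _) (List.subset_append_right _ _))
  | cond_pos _ _ h => exact h.mono (List.subset_append_left _ _) (List.subset_append_left _ _)
  | cond_neg _ _ h => exact h.mono (List.subset_append_right _ _) (List.subset_append_right _ _)
  | loop_stop _ => exact Frame.refl _ _
  | loop_step _ _ _ h₁ h₂ =>
    exact (h₁.mono (c' := .loop _ _) (List.Subset.refl _) (List.Subset.refl _)).trans h₂

/-- The cost that is charged for an elementary step. -/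
def unit (B : ℕ) : ℕ := 1000 * (Nat.log 2 B + 1)

/-- Started in the bounded store `s`, the program `c` halts after at most `N` elementary steps in
a bounded store that satisfies `Q`. -/
def wp (B : ℕ) (c : Cmd) (N : ℕ) (Q : Store → Prop) (s : Store) : Prop :=
  Bounded B s → ∃ n s', Exec c s n s' ∧ n ≤ N * unit B ∧ Bounded B s' ∧ Q s'

variable {B : ℕ} {s : Store}

lemma wp_mono {c : Cmd} {N N' : ℕ} {Q Q' : Store → Prop} (h : wp B c N Q s) (hN : N ≤ N')
    (hQ : ∀ s', Frame c s s' → Q s' → Q' s') : wp B c N' Q' s := by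
  intro hs
  obtain ⟨n, s', h1, h2, h3, h4⟩ := h hs
  exact ⟨n, s', h1, h2.trans (Nat.mul_le_mul_right _ hN), h3, hQ s' h1.frame h4⟩

lemma wp_of_bounded {c : Cmd} {N : ℕ} {Q : Store → Prop} (h : Bounded B s → wp B c N Q s) :
    wp B c N Q s := fun hs => h hs hs

/-- The constant 1000 in `unit` dominates the weights of all expressions that occur, so each
elementary command is charged a single unit and costs reduce to counting steps. -/
lemma step_le_unit {e : ℕ} {w : ℕ} (h : e ≤ w * (Nat.log 2 B + 1)) (hw : w ≤ 1000) :
    e ≤ 1 * unit B := by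
  rw [one_mul, unit]
  exact h.trans (Nat.mul_le_mul_right _ hw)

lemma wp_nop {Q : Store → Prop} (h : Q s) : wp B .nop 1 Q s := fun hs =>
  ⟨1, s, .nop s, step_le_unit (w := 1) (by omega) (by norm_num), hs, h⟩

/-- Assignment to a register. -/
def Store.setReg (s : Store) (i : ℕ) (v : ℤ) : Store where
  reg j := if j = i then v else s.reg j
  arr := s.arr

/-- Assignment to a cell of an array. -/
def Store.setArr (s : Store) (a : ℕ) (n : ℕ) (v : ℤ) : Store where
  reg := s.reg
  arr a' n' := if a' = a ∧ n' = n then v else s.arr a' n'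

@[simp] lemma Store.setReg_reg (s : Store) (i : ℕ) (v : ℤ) (j : ℕ) :
    (s.setReg i v).reg j = if j = i then v else s.reg j := rfl

@[simp] lemma Store.setReg_arr (s : Store) (i : ℕ) (v : ℤ) : (s.setReg i v).arr = s.arr := rfl

@[simp] lemma Store.setArr_reg (s : Store) (a n : ℕ) (v : ℤ) : (s.setArr a n v).reg = s.reg := rfl

@[simp] lemma Store.setArr_arr (s : Store) (a n : ℕ) (v : ℤ) (a' n' : ℕ) :
    (s.setArr a n v).arr a' n' = if a' = a ∧ n' = n then v else s.arr a' n' := rfl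

lemma Exec.assign' (i : ℕ) (e : Expr) (s : Store) :
    Exec (.assign i e) s (e.cost s + bitLen i + 1) (s.setReg i (e.eval s)) := by
  have := Exec.assign i e s
  convert this using 1
  simp only [Store.setReg, Store.mk.injEq, and_true]
  funext j
  simp [Function.update_apply]

lemma Exec.write' (a : ℕ) (e₁ e₂ : Expr) (s : Store) :
    Exec (.write a e₁ e₂) s (e₁.cost s + e₂.cost s + bitLen a + 1)
      (s.setArr a (e₁.eval s).toNat (e₂.eval s)) := by
  have := Exec.write a e₁ e₂ s
  convert this using 1
  simp only [Store.setArr, Store.mk.injEq, true_and]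
  funext j l
  by_cases hj : j = a
  · subst hj; simp [Function.update_apply]
  · simp [hj]

lemma wp_assign {i : ℕ} {e : Expr} {Q : Store → Prop} (hw : e.weight + bitLen i + 1 ≤ 1000)
    (hsafe : e.Safe B s) (hB : |e.eval s| ≤ B) (h : Q (s.setReg i (e.eval s))) :
    wp B (.assign i e) 1 Q s := fun hs => by
  refine ⟨_, _, .assign' i e s, step_le_unit (w := e.weight + bitLen i + 1) ?_ hw, ⟨?_, ?_⟩, h⟩
  · have := e.cost_le hs hsafe
    rw [add_mul, add_mul]
    have h1 : bitLen i ≤ bitLen i * (Nat.log 2 B + 1) := Nat.le_mul_of_pos_right _ (by omega)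
    omega
  · intro j
    rw [Store.setReg_reg]
    split_ifs
    · exact hB
    · exact hs.reg j
  · intro a n ha
    exact hs.arr a n ha

lemma wp_write {a : ℕ} {e₁ e₂ : Expr} {Q : Store → Prop}
    (hw : e₁.weight + e₂.weight + bitLen a + 1 ≤ 1000)
    (hsafe : e₁.Safe B s ∧ e₂.Safe B s) (hB : |e₂.eval s| ≤ B)
    (h : Q (s.setArr a (e₁.eval s).toNat (e₂.eval s))) :
    wp B (.write a e₁ e₂) 1 Q s := fun hs => by
  refine ⟨_, _, .write' a e₁ e₂ s,
    step_le_unit (w := e₁.weight + e₂.weight + bitLen a + 1) ?_ hw, ⟨?_, ?_⟩, h⟩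
  · have h1 := e₁.cost_le hs hsafe.1
    have h2 := e₂.cost_le hs hsafe.2
    rw [add_mul, add_mul, add_mul]
    have h3 : bitLen a ≤ bitLen a * (Nat.log 2 B + 1) := Nat.le_mul_of_pos_right _ (by omega)
    omega
  · exact hs.reg
  · intro a' n ha
    rw [Store.setArr_arr]
    split_ifs
    · exact hB
    · exact hs.arr a' n ha

lemma wp_seq {c₁ c₂ : Cmd} {N₁ N₂ N : ℕ} {Q : Store → Prop} (hN : N₁ + N₂ ≤ N)
    (h : wp B c₁ N₁ (fun s' => wp B c₂ N₂ Q s') s) : wp B (.seq c₁ c₂) N Q s := fun hs => by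
  obtain ⟨n₁, s₁, h1, h2, h3, h4⟩ := h hs
  obtain ⟨n₂, s₂, g1, g2, g3, g4⟩ := h4 h3
  refine ⟨_, _, .seq h1 g1, ?_, g3, g4⟩
  exact (add_le_add h2 g2).trans (by rw [← add_mul]; exact Nat.mul_le_mul_right _ hN)

lemma wp_cond {e : Expr} {c₁ c₂ : Cmd} {N : ℕ} {Q : Store → Prop} (hw : e.weight + 1 ≤ 1000)
    (hsafe : e.Safe B s) (h₁ : 0 < e.eval s → wp B c₁ N Q s)
    (h₂ : ¬ 0 < e.eval s → wp B c₂ N Q s) : wp B (.cond e c₁ c₂) (N + 1) Q s := fun hs => by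
  have hcost : e.cost s + 1 ≤ 1 * unit B := by
    refine step_le_unit (w := e.weight + 1) ?_ hw
    have := e.cost_le hs hsafe
    rw [add_mul]; omega
  by_cases he : 0 < e.eval s
  · obtain ⟨n, s', h1, h2, h3, h4⟩ := h₁ he hs
    refine ⟨_, _, .cond_pos he h1, ?_, h3, h4⟩
    rw [add_mul]; omega
  · obtain ⟨n, s', h1, h2, h3, h4⟩ := h₂ he hs
    refine ⟨_, _, .cond_neg he h1, ?_, h3, h4⟩
    rw [add_mul]; omega

/-- The invariant `I j` holds after `j` rounds; there are at most `M` rounds. -/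
lemma wp_loop {e : Expr} {c : Cmd} {M N : ℕ} {Q : Store → Prop} (I : ℕ → Store → Prop)
    (hw : e.weight + 1 ≤ 1000)
    (hsafe : ∀ j s', Frame c s s' → I j s' → e.Safe B s')
    (hstep : ∀ j s', Frame c s s' → I j s' → 0 < e.eval s' → j < M ∧ wp B c N (I (j + 1)) s')
    (h0 : I 0 s) (hQ : ∀ j s', Frame c s s' → I j s' → j ≤ M → ¬ 0 < e.eval s' → Q s') :
    wp B (.loop e c) (M * (N + 1) + 1) Q s := by
  suffices H : ∀ f j s', M = j + f → Frame c s s' → I j s' →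
      wp B (.loop e c) (f * (N + 1) + 1) Q s' from H M 0 s (by omega) (Frame.refl _ _) h0
  intro f
  induction f with
  | zero =>
    intro j s' hj hf hI hs
    have hcost : e.cost s' + 1 ≤ 1 * unit B := by
      refine step_le_unit (w := e.weight + 1) ?_ hw
      have := e.cost_le hs (hsafe j s' hf hI)
      rw [add_mul]; omega
    have he : ¬ 0 < e.eval s' := fun he => by
      have := (hstep j s' hf hI he).1; omega
    exact ⟨_, _, Exec.loop_stop he, by simpa using hcost, hs, hQ j s' hf hI (by omega) he⟩
  | succ f ih =>
    intro j s' hj hf hI hs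
    have hcost : e.cost s' + 1 ≤ 1 * unit B := by
      refine step_le_unit (w := e.weight + 1) ?_ hw
      have := e.cost_le hs (hsafe j s' hf hI)
      rw [add_mul]; omega
    by_cases he : 0 < e.eval s'
    · obtain ⟨n₁, s₁, h1, h2, h3, h4⟩ := (hstep j s' hf hI he).2 hs
      obtain ⟨n₂, s₂, g1, g2, g3, g4⟩ := ih (j + 1) s₁ (by omega) (hf.trans h1.frame) h4 h3
      refine ⟨_, _, .loop_step he h1 g1, ?_, g3, g4⟩
      have : ((f + 1) * (N + 1) + 1) * unit B =
        N * unit B + (f * (N + 1) + 1) * unit B + 1 * unit B := by ring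
      omega
    · refine ⟨_, _, Exec.loop_stop he, hcost.trans ?_, hs, hQ j s' hf hI (by omega) he⟩
      exact Nat.mul_le_mul_right _ (by omega)

/-- Execute `c` with register `i` running through `0, …, n - 1`. -/
def forCmd (i : ℕ) (n : Expr) (c : Cmd) : Cmd :=
  .seq (.assign i (.lit 0))
    (.loop (.bin .sub n (.get i)) (.seq c (.assign i (.bin .add (.get i) (.lit 1)))))

/-- A round costs N for the body, one unit for the increment and one for the test. The other two
units are the initialization and the final test. The limit `n` is evaluated afresh in every round,
so it must keep its value throughout, and the invariant must not depend on the counter, which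
changes outside of `c`. -/
lemma wp_for {i : ℕ} {n : Expr} {c : Cmd} {N' N : ℕ} {Q : Store → Prop} (m : ℕ)
    (I : ℕ → Store → Prop)
    (hw : n.weight + bitLen i + 2 + n.len + bitLen i + 10 ≤ 1000) (hi : i ∉ c.regs)
    (hB : m + 1 ≤ B) (hN' : m * (N + 2) + 2 ≤ N')
    (hn : ∀ s', Frame (forCmd i n c) s s' → n.eval s' = m ∧ n.Safe B s')
    (hI : ∀ j s' v, I j s' → I j (s'.setReg i v))
    (hstep : ∀ j s', j < m → Frame (forCmd i n c) s s' → s'.reg i = j → I j s' →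
      wp B c N (I (j + 1)) s')
    (h0 : I 0 s) (hQ : ∀ s', Frame (forCmd i n c) s s' → I m s' → Q s') :
    wp B (forCmd i n c) N' Q s := by
  have hb1 : bitLen (0 : ℤ) = 1 := by simp [bitLen]
  have hb2 : bitLen (1 : ℤ) = 1 := by simp [bitLen]
  refine wp_seq (N₁ := 1) (N₂ := m * (N + 2) + 1) (by omega) (wp_assign ?_ trivial ?_ ?_)
  · simp only [Expr.weight, hb1]; omega
  · simp [Expr.eval]
  set s₀ := s.setReg i ((Expr.lit 0).eval s) with hs₀
  have hf₀ : Frame (forCmd i n c) s s₀ := by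
    refine ⟨fun j hj => ?_, fun _ _ => rfl⟩
    rw [hs₀, Store.setReg_reg, if_neg]
    rintro rfl
    exact hj (by simp [forCmd, Cmd.regs])
  have hmono : ∀ {s'}, Frame (.seq c (.assign i (.bin .add (.get i) (.lit 1)))) s₀ s' →
      Frame (forCmd i n c) s s' := fun h => hf₀.trans <| h.mono
    (by intro x; simp [forCmd, Cmd.regs]; tauto) (by intro x; simp [forCmd, Cmd.arrs])
  refine wp_mono (wp_loop (M := m) (N := N + 1) (fun j s' => I j s' ∧ s'.reg i = j)
    ?_ ?_ ?_ ⟨hI _ _ _ h0, by simp [hs₀, Expr.eval]⟩ ?_) le_rfl (fun s' _ h => h)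
  · simp only [Expr.weight, Expr.len]; omega
  · intro j s' hf _
    exact ⟨(hn s' (hmono hf)).2, trivial⟩
  · rintro j s' hf ⟨hIj, hr⟩ he
    have hjm : j < m := by
      simp only [Expr.eval, Op.apply, (hn s' (hmono hf)).1, hr] at he
      omega
    refine ⟨hjm, wp_seq (N₁ := N) (N₂ := 1) le_rfl ?_⟩
    refine wp_mono (hstep j s' hjm (hmono hf) hr hIj) le_rfl fun s'' hf' hI' => ?_
    have hr' : s''.reg i = j := (hf'.reg i hi).trans hr
    refine wp_assign ?_ ⟨trivial, trivial⟩ ?_ ⟨hI _ _ _ hI', ?_⟩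
    · simp only [Expr.weight, Expr.len, hb2]; omega
    · simp only [Expr.eval, Op.apply, hr']
      rw [abs_of_nonneg (by positivity)]
      exact_mod_cast (by omega : j + 1 ≤ B)
    · simp [Expr.eval, Op.apply, hr']
  · rintro j s' hf ⟨hIj, hr⟩ hjm he
    have : j = m := by
      simp only [Expr.eval, Op.apply, (hn s' (hmono hf)).1, hr] at he
      omega
    subst this
    exact hQ s' (hmono hf) hIj

end RAM

/-! ### Computing the coefficients -/

namespace RAM
infixl:65 " ⊕ₑ " => Expr.bin Op.add
infixl:65 " ⊖ₑ " => Expr.bin Op.sub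
infixl:70 " ⊗ₑ " => Expr.bin Op.mul
infixl:70 " ⊘ₑ " => Expr.bin Op.div
infixr:60 " ;; " => Cmd.seq

/-- Register use in all programs: 1, 2, 3, 4 hold r, k, d, g; 15 holds R; 5 and 6 hold 2^m and m; 7
the denominator; 8 the degree t; 9 the number of listed exponent vectors; 10 and 12 are loop
counters; 11 is the position in the list; 13, 14, 16 are scratch. Array 2 holds the damping values
and array 3 the difference tables and finally the numerators. -/
def dampingCmd : Cmd :=
  forCmd 10 (.get 2 ⊕ₑ .lit 1)
    (.assign 13 (.get 2 ⊕ₑ .lit 2 ⊗ₑ .get 15 ⊖ₑ .lit 2 ⊗ₑ .get 10) ;;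
     .assign 14 (.get 2) ;;
     forCmd 12 (.get 6)
      (.assign 13 (.lit 2 ⊗ₑ .get 13 ⊗ₑ .get 13 ⊖ₑ .get 14 ⊗ₑ .get 14) ;;
       .assign 14 (.get 14 ⊗ₑ .get 14)) ;;
     .write 2 (.get 10) (.get 13))

variable {B : ℕ} {s : Store} {k R m : ℕ}

lemma wp_dampingCmd (hB : (2 * (k + 2 * R)) ^ 2 ^ m ≤ B) (hkB : k + 2 ≤ B) (hmB : m + 1 ≤ B) (hk : 1 ≤ k)
    (h2 : s.reg 2 = k) (h6 : s.reg 6 = m) (h15 : s.reg 15 = R) :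
    wp B dampingCmd ((k + 1) * (4 * m + 20) + 2) (fun s' => ∀ z ≤ k, s'.arr 2 z = damping k R m z) s := by
  have hpow : ∀ j ≤ m, (2 * ((k : ℤ) + 2 * R)) ^ 2 ^ j ≤ B := by
    intro j hj
    have h1 : (2 * (k + 2 * R)) ^ 2 ^ j ≤ (2 * (k + 2 * R)) ^ 2 ^ m :=
      Nat.pow_le_pow_right (by omega) (Nat.pow_le_pow_right (by norm_num) hj)
    exact_mod_cast h1.trans hB
  have hY : ∀ z ≤ k, ∀ j ≤ m, |dbl k (k + 2 * R - 2 * z) j| ≤ B := by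
    intro z hz j hj
    refine (abs_dbl_le_pow (M := k + 2 * R) (by positivity) (by omega) ?_ j).trans (hpow j hj)
    rw [abs_le]; constructor <;> omega
  have hq : ∀ j ≤ m, |(k : ℤ) ^ 2 ^ j| ≤ B := by
    intro j hj
    rw [abs_of_nonneg (by positivity)]
    refine le_trans ?_ (hpow j hj)
    gcongr; omega
  refine wp_for (k + 1) (fun j s' => ∀ z < j, s'.arr 2 z = damping k R m z) (N := 4 * m + 18)
    (by decide) (by decide) (by omega) (by lia) ?_ (fun _ _ _ h => h) ?_ (by simp) ?_
  · intro s' hf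
    have := hf.reg 2 (by decide)
    simp [Expr.eval, Op.apply, Expr.Safe, this, h2]
  · intro j s' hj hf hr hI
    have e2 : s'.reg 2 = k := (hf.reg 2 (by decide)).trans h2
    have e6 : s'.reg 6 = m := (hf.reg 6 (by decide)).trans h6
    have e15 : s'.reg 15 = R := (hf.reg 15 (by decide)).trans h15
    have hjk : j ≤ k := by omega
    have hv := hY j hjk 0 (Nat.zero_le _)
    refine wp_seq (N₁ := 1) (N₂ := 4 * m + 17) (by omega) (wp_assign (by decide) (by simp [Expr.Safe]) ?_ ?_)
    · simpa [Expr.eval, Op.apply, e2, e15, hr, dbl] using hv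
    refine wp_seq (N₁ := 1) (N₂ := 4 * m + 16) (by omega) (wp_assign (by decide) (by simp [Expr.Safe]) ?_ ?_)
    · simpa [Expr.eval, Op.apply, e2] using hq 0 (Nat.zero_le _)
    refine wp_seq (N₁ := 4 * m + 2) (N₂ := 1) (by omega) ?_
    refine wp_for m (fun l s'' => s''.reg 13 = dbl k (k + 2 * R - 2 * j) l ∧ s''.reg 14 = k ^ 2 ^ l)
      (N := 2) (by decide) (by decide) hmB (by lia) ?_ ?_ ?_ ?_ ?_
    · intro s'' hf'
      have := hf'.reg 6 (by decide)
      simp [Expr.eval, Expr.Safe, this, e6]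
    · intro l s'' v h
      simpa using h
    · rintro l s'' hl hf' hr' ⟨i1, i2⟩
      have b1 := hY j hjk (l + 1) hl
      have b2 := hq (l + 1) hl
      rw [pow_succ 2 l, pow_mul] at b2
      refine wp_seq (N₁ := 1) (N₂ := 1) (by omega) (wp_assign (by decide) (by simp [Expr.Safe]) ?_ ?_)
      · rw [dbl] at b1
        simpa [Expr.eval, Op.apply, i1, i2, mul_assoc, ← pow_two] using b1
      refine wp_assign (by decide) (by simp [Expr.Safe]) ?_ ?_
      · simpa [Expr.eval, Op.apply, i1, i2, mul_assoc, ← pow_two] using b2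
      · simp [Expr.eval, Op.apply, i1, i2, dbl, mul_assoc, ← pow_two, pow_succ 2 l, pow_mul]
    · simp [Expr.eval, Op.apply, e2, e15, hr, dbl]
    · rintro s'' hf' ⟨i1, i2⟩
      have e10 := hf'.reg 10 (by decide)
      have ea := hf'.arr 2 (by decide)
      refine wp_write (by decide) (by simp [Expr.Safe]) ?_ ?_
      · simpa [Expr.eval, i1] using hY j hjk m le_rfl
      · intro z hz
        simp at e10 ea
        simp [Expr.eval, i1, e10, ea, hr, damping]
        split_ifs with h
        · rw [h]
        · exact hI z (by omega)
  · intro s' _ hI z hz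
    exact hI z (by omega)

/-! #### The exponent `m` -/

def exponentCmd : Cmd :=
  .assign 5 (.lit 1) ;;
  .assign 6 (.lit 0) ;;
  .loop (.lit 4 ⊗ₑ .get 2 ⊗ₑ .get 15 ⊗ₑ (.lit 2 ⊗ₑ .get 6 ⊕ₑ .lit 1) ⊗ₑ (.lit 2 ⊗ₑ .get 6 ⊕ₑ .lit 1)
      ⊖ₑ .get 5 ⊗ₑ .get 5)
    (.assign 5 (.lit 2 ⊗ₑ .get 5) ;; .assign 6 (.get 6 ⊕ₑ .lit 1)) ;;
  .assign 8 (.lit 2 ⊗ₑ .get 5)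

lemma wp_exponentCmd (hm : 4 * k * R * (2 * m + 1) ^ 2 ≤ (2 ^ m) ^ 2)
    (hmin : ∀ j < m, (2 ^ j) ^ 2 < 4 * k * R * (2 * j + 1) ^ 2)
    (hB : 2 * 2 ^ m ≤ B) (h2 : s.reg 2 = k) (h15 : s.reg 15 = R) :
    wp B exponentCmd (3 * m + 5)
      (fun s' => s'.reg 6 = m ∧ s'.reg 8 = (2 * 2 ^ m : ℕ)) s := by
  have hm2 : m < 2 ^ m := Nat.lt_two_pow_self
  have hBz : ((2 * 2 ^ m : ℕ) : ℤ) ≤ B := by exact_mod_cast hB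
  refine wp_seq (N₁ := 1) (N₂ := 3 * m + 4) (by omega)
    (wp_assign (by decide) (by simp [Expr.Safe]) ?_ ?_)
  · simp [Expr.eval]; omega
  refine wp_seq (N₁ := 1) (N₂ := 3 * m + 3) (by omega)
    (wp_assign (by decide) (by simp [Expr.Safe]) ?_ ?_)
  · simp [Expr.eval]
  refine wp_seq (N₁ := m * (2 + 1) + 1) (N₂ := 1) (by omega) ?_
  refine wp_loop (M := m) (N := 2) (fun j s' => s'.reg 5 = 2 ^ j ∧ s'.reg 6 = j ∧ j ≤ m)
    (by decide) (by simp [Expr.Safe]) ?_ (by simp [Expr.eval]) ?_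
  · rintro j s' hf ⟨i5, i6, hj⟩ he
    have e2 := hf.reg 2 (by decide)
    have e15 := hf.reg 15 (by decide)
    simp at e2 e15
    have hjm : j < m := by
      rcases hj.lt_or_eq with h | h
      · exact h
      · subst h
        have : (4 * k * R * (2 * j + 1) ^ 2 : ℤ) ≤ (2 ^ j) ^ 2 := by exact_mod_cast hm
        simp [Expr.eval, Op.apply, e2, e15, h2, h15, i5, i6] at he
        nlinarith
    have hp : (2 : ℤ) ^ (j + 1) ≤ B := by
      have h1 : 2 ^ (j + 1) ≤ 2 ^ m := Nat.pow_le_pow_right (by norm_num) hjm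
      exact_mod_cast (by omega : 2 ^ (j + 1) ≤ B)
    refine ⟨hjm, wp_seq (N₁ := 1) (N₂ := 1) (by omega)
      (wp_assign (by decide) (by simp [Expr.Safe]) ?_ ?_)⟩
    · simp only [Expr.eval, Op.apply, i5]
      rw [abs_of_nonneg (by positivity), mul_comm, ← pow_succ]
      exact hp
    refine wp_assign (by decide) (by simp [Expr.Safe]) ?_ ?_
    · simp [Expr.eval, Op.apply, i6]
      rw [abs_of_nonneg (by positivity)]
      omega
    · simp [Expr.eval, Op.apply, i5, i6, pow_succ, mul_comm]
      omega
  · rintro j s' hf ⟨i5, i6, hj⟩ _ he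
    have e2 := hf.reg 2 (by decide)
    have e15 := hf.reg 15 (by decide)
    simp at e2 e15
    have hjm : j = m := by
      by_contra hne
      have h1 := hmin j (by omega)
      have : ((2 ^ j) ^ 2 : ℤ) < (4 * k * R * (2 * j + 1) ^ 2 : ℤ) := by exact_mod_cast h1
      apply he
      simp [Expr.eval, Op.apply, e2, e15, h2, h15, i5, i6]
      nlinarith
    subst hjm
    refine wp_assign (by decide) (by simp [Expr.Safe]) ?_ ?_
    · simp only [Expr.eval, Op.apply, i5]
      rw [abs_of_nonneg (by positivity)]
      exact_mod_cast hB
    · simp [Expr.eval, Op.apply, i5, i6]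

/-! #### The denominator and the node values -/

def prodCmd : Cmd :=
  .assign 7 (.lit 1) ;;
  forCmd 10 (.get 1) (.assign 7 (.get 7 ⊗ₑ .read 2 (.get 10)))

variable {r : ℕ}

lemma wp_prodCmd (hB : ∀ j ≤ r, |dampingProd j k R m| ≤ B) (hrB : r + 1 ≤ B)
    (h1 : s.reg 1 = r) (hY : ∀ z < r, s.arr 2 z = damping k R m z) :
    wp B prodCmd (3 * r + 3) (fun s' => s'.reg 7 = dampingProd r k R m) s := by
  refine wp_seq (N₁ := 1) (N₂ := 3 * r + 2) (by omega)
    (wp_assign (by decide) (by simp [Expr.Safe]) ?_ ?_)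
  · simp [Expr.eval]; omega
  refine wp_for r (fun j s' => s'.reg 7 = dampingProd j k R m) (N := 1)
    (by decide) (by decide) hrB (by omega) ?_ (fun j s' v h => by simpa using h) ?_ ?_ ?_
  · intro s' hf
    have := hf.reg 1 (by decide)
    simp [Expr.eval, Expr.Safe, this, h1]
  · intro j s' hj hf hr hI
    have ea := hf.arr 2 (by decide)
    have e : s'.reg 7 * s'.arr 2 j = dampingProd (j + 1) k R m := by
      rw [hI, ea, Store.setReg_arr, hY j hj, dampingProd, dampingProd, Finset.prod_range_succ]
    refine wp_assign (by decide) (by simp [Expr.Safe]) ?_ ?_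
    · simpa [Expr.eval, Op.apply, hr, e] using hB (j + 1) hj
    · simpa [Expr.eval, Op.apply, hr] using e
  · simp [Expr.eval, dampingProd]
  · intro s' _ hI
    exact hI

def nodeCmd : Cmd :=
  forCmd 10 (.get 1) (.write 3 (.get 10) (.get 7 ⊘ₑ .read 2 (.get 10)))

lemma wp_nodeCmd (hB : ∀ z, |nodeValue r k R m z| ≤ B) (hrB : r + 1 ≤ B)
    (h1 : s.reg 1 = r) (h7 : s.reg 7 = dampingProd r k R m)
    (hY : ∀ z < r, s.arr 2 z = damping k R m z) (h3 : ∀ z, s.arr 3 z = 0) :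
    wp B nodeCmd (3 * r + 2) (fun s' => s'.arr 3 = nodeValue r k R m) s := by
  refine wp_for r (fun j s' => ∀ z, s'.arr 3 z = if z < j then nodeValue r k R m z else 0) (N := 1)
    (by decide) (by decide) hrB (by omega) ?_ (fun j s' v h => by simpa using h) ?_ ?_ ?_
  · intro s' hf
    have := hf.reg 1 (by decide)
    simp [Expr.eval, Expr.Safe, this, h1]
  · intro j s' hj hf hr hI
    have ea := hf.arr 2 (by decide)
    have e7 := hf.reg 7 (by decide)
    have e : s'.reg 7 / s'.arr 2 j = nodeValue r k R m j := by
      rw [e7, h7, ea, hY j hj, nodeValue, if_pos hj]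
    refine wp_write (by decide) (by simp [Expr.Safe]) ?_ ?_
    · simpa [Expr.eval, Op.apply, hr, e] using hB j
    · intro z
      simp only [Expr.eval, Op.apply, hr, Int.toNat_natCast, e, Store.setArr_arr, hI, true_and]
      split_ifs <;> first | omega | simp_all
  · simpa using h3
  · intro s' _ hI
    funext z
    rw [hI]
    split_ifs with hz
    · rfl
    · simp [nodeValue, hz]

/-! #### Difference tables in place -/

/-- The array after `j` rounds of forming differences of the array `v 0, …, v k, 0, 0, …`. -/
def diffTable (k j : ℕ) (v : ℕ → ℤ) (n : ℕ) : ℤ :=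
  if n ≤ k then (fwdDiff 1)^[min j n] v (n - min j n) else 0

lemma diffTable_sub (v : ℕ → ℤ) {i n : ℕ} (hi : i < n) (hn : n ≤ k) :
    diffTable k i v n - diffTable k i v (n - 1) = diffTable k (i + 1) v n := by
  have e1 : min i n = i := by omega
  have e2 : min i (n - 1) = i := by omega
  have e3 : min (i + 1) n = i + 1 := by omega
  rw [diffTable, diffTable, diffTable, if_pos hn, if_pos hn, if_pos (by omega), e1, e2, e3,
    Function.iterate_succ_apply', fwdDiff, show n - (i + 1) + 1 = n - i by omega,
    show n - 1 - i = n - (i + 1) by omega]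

lemma diffTable_succ_of_le (v : ℕ → ℤ) {i n : ℕ} (h : n ≤ i) :
    diffTable k (i + 1) v n = diffTable k i v n := by
  have e1 : min i n = n := by omega
  have e3 : min (i + 1) n = n := by omega
  rw [diffTable, diffTable, e1, e3]

lemma diffTable_of_lt (v : ℕ → ℤ) {i n : ℕ} (h : k < n) : diffTable k i v n = 0 := by
  rw [diffTable, if_neg (by omega)]

lemma diffTable_zero (v : ℕ → ℤ) (n : ℕ) : diffTable k 0 v n = if n ≤ k then v n else 0 := by
  simp [diffTable]

lemma diffTable_self (v : ℕ → ℤ) (n : ℕ) :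
    diffTable k k v n = if n ≤ k then (fwdDiff 1)^[n] v 0 else 0 := by
  rw [diffTable]
  split_ifs with h
  · rw [min_eq_right h, Nat.sub_self]
  · rfl

lemma abs_diffTable_le {v : ℕ → ℤ} {M : ℤ} (hv : ∀ z ≤ k, |v z| ≤ M) (j n : ℕ) :
    |diffTable k j v n| ≤ 2 ^ k * M := by
  have hM : 0 ≤ M := (abs_nonneg _).trans (hv 0 (Nat.zero_le _))
  unfold diffTable
  split_ifs with h
  · refine (abs_fwdDiff_iter_le_of_shift (M := M) fun i hi => hv _ (by omega)).trans ?_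
    gcongr
    · norm_num
    · omega
  · rw [abs_zero]; positivity

/-- Round i treats the cells k, k-1, …, i+1 in descending order, so the left neighbour still has its
old value when it is read. -/
def diffCmd : Cmd :=
  forCmd 10 (.get 2)
    (forCmd 12 (.get 2 ⊖ₑ .get 10)
      (.write 3 (.get 2 ⊖ₑ .get 12)
        (.read 3 (.get 2 ⊖ₑ .get 12) ⊖ₑ .read 3 (.get 2 ⊖ₑ .get 12 ⊖ₑ .lit 1))))

lemma wp_diffCmd (v : ℕ → ℤ) (hB : ∀ j n, |diffTable k j v n| ≤ B) (hkB : k + 1 ≤ B)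
    (h2 : s.reg 2 = k) (h3 : s.arr 3 = diffTable k 0 v) :
    wp B diffCmd (k * (3 * k + 4) + 2) (fun s' => s'.arr 3 = diffTable k k v) s := by
  refine wp_for k (fun j s' => s'.arr 3 = diffTable k j v) (N := 3 * k + 2)
    (by decide) (by decide) hkB (by lia) ?_ (fun j s' v h => by simpa using h) ?_ h3 (fun _ _ h => h)
  · intro s' hf
    have := hf.reg 2 (by decide)
    simp [Expr.eval, Expr.Safe, this, h2]
  intro i s' hi hf hr hI
  have e2 : s'.reg 2 = k := (hf.reg 2 (by decide)).trans h2
  refine wp_for (k - i) (fun l s'' => ∀ n, s''.arr 3 n =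
    if k - l < n then diffTable k (i + 1) v n else diffTable k i v n) (N := 1)
    (by decide) (by decide) (by omega) (by omega) ?_ (fun j s' v h => by simpa using h) ?_ ?_ ?_
  · intro s'' hf'
    have := hf'.reg 2 (by decide)
    have := hf'.reg 10 (by decide)
    simp [Expr.eval, Expr.Safe, Op.apply, *]
    omega
  · intro l s'' hl hf' hr' hJ
    have e2' : s''.reg 2 = k := (hf'.reg 2 (by decide)).trans e2
    have t1 : ((k : ℤ) - l).toNat = k - l := by omega
    have t2 : ((k : ℤ) - l - 1).toNat = k - l - 1 := by omega
    have e : s''.arr 3 (k - l) - s''.arr 3 (k - l - 1) = diffTable k (i + 1) v (k - l) := by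
      rw [hJ, hJ, if_neg (by omega), if_neg (by omega), diffTable_sub v (by omega) (by omega)]
    refine wp_write (by decide) (by simp [Expr.Safe]) ?_ ?_
    · simpa [Expr.eval, Op.apply, hr', e2', t1, t2, e] using hB (i + 1) (k - l)
    · intro n
      simp only [Expr.eval, Op.apply, hr', e2', t1, t2, Store.setArr_arr, true_and, hJ]
      split_ifs <;> first | rfl | omega | simp_all
  · intro n
    rw [hI]
    split_ifs with hn
    · rw [diffTable_of_lt _ (by omega), diffTable_of_lt _ (by omega)]
    · rfl
  · intro s'' _ hJ
    funext n
    rw [hJ]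
    split_ifs with hn
    · rfl
    · rw [diffTable_succ_of_le _ (by omega)]

/-- Undoes `diffCmd` round by round. The cells are now treated in ascending order, so the left
neighbour has already been restored. -/
def sumCmd : Cmd :=
  forCmd 10 (.get 2)
    (forCmd 12 (.get 10 ⊕ₑ .lit 1)
      (.write 3 (.get 2 ⊖ₑ .get 10 ⊕ₑ .get 12)
        (.read 3 (.get 2 ⊖ₑ .get 10 ⊕ₑ .get 12) ⊕ₑ
          .read 3 (.get 2 ⊖ₑ .get 10 ⊕ₑ .get 12 ⊖ₑ .lit 1))))

lemma wp_sumCmd (v : ℕ → ℤ) (hB : ∀ j n, |diffTable k j v n| ≤ B) (hkB : k + 1 ≤ B)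
    (h2 : s.reg 2 = k) (h3 : s.arr 3 = diffTable k k v) :
    wp B sumCmd (k * (3 * k + 4) + 2) (fun s' => s'.arr 3 = diffTable k 0 v) s := by
  refine wp_for k (fun j s' => s'.arr 3 = diffTable k (k - j) v) (N := 3 * k + 2)
    (by decide) (by decide) hkB (by lia) ?_ (fun j s' v h => by simpa using h) ?_ h3
    (fun _ _ h => by simpa using h)
  · intro s' hf
    have := hf.reg 2 (by decide)
    simp [Expr.eval, Expr.Safe, this, h2]
  intro j s' hj hf hr hI
  have e2 : s'.reg 2 = k := (hf.reg 2 (by decide)).trans h2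
  obtain ⟨i, hi⟩ : ∃ i, k - j = i + 1 := ⟨k - j - 1, by omega⟩
  have hi' : k - (j + 1) = i := by omega
  rw [hi] at hI
  simp only [hi']
  refine wp_for (j + 1) (fun l s'' => ∀ n, s''.arr 3 n =
    if n ≤ i + l then diffTable k i v n else diffTable k (i + 1) v n) (N := 1)
    (by decide) (by decide) (by omega) (by omega) ?_ (fun j s' v h => by simpa using h) ?_ ?_ ?_
  · intro s'' hf'
    have := hf'.reg 10 (by decide)
    simp [Expr.eval, Expr.Safe, Op.apply, *]
  · intro l s'' hl hf' hr' hJ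
    have e2' : s''.reg 2 = k := (hf'.reg 2 (by decide)).trans e2
    have e10 : s''.reg 10 = j := (hf'.reg 10 (by decide)).trans hr
    have t1 : ((k : ℤ) - j + l).toNat = i + l + 1 := by omega
    have t2 : ((k : ℤ) - j + l - 1).toNat = i + l := by omega
    have e : s''.arr 3 (i + l + 1) + s''.arr 3 (i + l) = diffTable k i v (i + l + 1) := by
      rw [hJ, hJ, if_neg (by omega), if_pos (by omega),
        ← diffTable_sub v (n := i + l + 1) (by omega) (by omega)]
      simp
    refine wp_write (by decide) (by simp [Expr.Safe]) ?_ ?_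
    · simpa [Expr.eval, Op.apply, hr', e2', e10, t1, t2, e] using hB i (i + l + 1)
    · intro n
      simp only [Expr.eval, Op.apply, hr', e2', e10, t1, t2, Store.setArr_arr, true_and, hJ]
      split_ifs <;> first | rfl | omega | simp_all
  · intro n
    rw [hI]
    split_ifs with hn
    · rw [diffTable_succ_of_le _ (by omega)]
    · rfl
  · intro s'' _ hJ
    funext n
    rw [hJ]
    split_ifs with hn
    · rfl
    · rw [diffTable_of_lt _ (by omega), diffTable_of_lt _ (by omega)]

def truncCmd : Cmd :=
  forCmd 10 (.get 2 ⊕ₑ .lit 1)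
    (.cond (.get 10 ⊕ₑ .lit 1 ⊖ₑ .get 15) (.write 3 (.get 10) (.lit 0)) .nop)

lemma wp_truncCmd (u : ℕ → ℤ) (hkB : k + 2 ≤ B) (h2 : s.reg 2 = k) (h15 : s.reg 15 = R)
    (h3 : s.arr 3 = diffTable k k u) :
    wp B truncCmd (4 * k + 6) (fun s' => s'.arr 3 = diffTable k k (newtonTrunc R u)) s := by
  refine wp_for (k + 1) (fun j s' => ∀ n, s'.arr 3 n =
    if n < j ∧ R ≤ n then 0 else diffTable k k u n) (N := 2)
    (by decide) (by decide) (by omega) (by omega) ?_ (fun j s' v h => by simpa using h) ?_ ?_ ?_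
  · intro s' hf
    have := hf.reg 2 (by decide)
    simp [Expr.eval, Expr.Safe, Op.apply, this, h2]
  · intro j s' hj hf hr hI
    have e15 : s'.reg 15 = R := (hf.reg 15 (by decide)).trans h15
    refine wp_cond (by decide) (by simp [Expr.Safe]) (fun he => ?_) (fun he => ?_)
    · simp [Expr.eval, Op.apply, hr, e15] at he
      refine wp_write (by decide) (by simp [Expr.Safe]) (by simp [Expr.eval]) ?_
      intro n
      simp only [Expr.eval, hr, Int.toNat_natCast, Store.setArr_arr, true_and, hI]
      split_ifs <;> first | rfl | omega
    · simp [Expr.eval, Op.apply, hr, e15] at he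
      refine wp_nop fun n => ?_
      rw [hI]
      split_ifs <;> first | rfl | omega
  · intro n
    simp [h3]
  · intro s' _ hI
    funext n
    rw [hI, diffTable_self, diffTable_self, fwdDiff_iter_newtonTrunc]
    split_ifs <;> first | rfl | omega

def valueCmd : Cmd :=
  forCmd 10 (.get 2 ⊕ₑ .lit 1)
    (.write 3 (.get 10) (.get 7 ⊖ₑ .read 3 (.get 10) ⊗ₑ .read 2 (.get 10)))

lemma wp_valueCmd (hkB : k + 2 ≤ B) (hB : ∀ z ≤ k, |valueNum r k R m z| ≤ B)
    (h2 : s.reg 2 = k) (h7 : s.reg 7 = dampingProd r k R m)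
    (hY : ∀ z ≤ k, s.arr 2 z = damping k R m z)
    (h3 : s.arr 3 = diffTable k 0 (newtonTrunc R (nodeValue r k R m))) :
    wp B valueCmd (3 * k + 5) (fun s' => s'.arr 3 = diffTable k 0 (valueNum r k R m)) s := by
  refine wp_for (k + 1) (fun j s' => ∀ n, s'.arr 3 n = if n < j then valueNum r k R m n else
    diffTable k 0 (newtonTrunc R (nodeValue r k R m)) n) (N := 1)
    (by decide) (by decide) (by omega) (by omega) ?_ (fun j s' v h => by simpa using h) ?_ ?_ ?_
  · intro s' hf
    have := hf.reg 2 (by decide)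
    simp [Expr.eval, Expr.Safe, Op.apply, this, h2]
  · intro j s' hj hf hr hI
    have ea := hf.arr 2 (by decide)
    have e7 := hf.reg 7 (by decide)
    have e : s'.reg 7 - s'.arr 3 j * s'.arr 2 j = valueNum r k R m j := by
      rw [e7, h7, ea, hY j (by omega), hI, if_neg (by omega), diffTable_zero, if_pos (by omega),
        valueNum]
    refine wp_write (by decide) (by simp [Expr.Safe]) ?_ ?_
    · simpa [Expr.eval, Op.apply, hr, e] using hB j (by omega)
    · intro n
      simp only [Expr.eval, Op.apply, hr, Int.toNat_natCast, Store.setArr_arr, hI, true_and]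
      split_ifs <;> first | rfl | omega | simp_all
  · intro n
    simp [h3]
  · intro s' _ hI
    funext n
    rw [hI, diffTable_zero, diffTable_zero]
    split_ifs <;> first | rfl | omega

/-! #### The whole computation -/

/-- The interpolation polynomial is evaluated at all of 0, …, k by passing to differences, erasing
those of order at least R and summing back. This takes O(k²) additions and subtractions. The last
`diffCmd` turns the values into binomial-basis coefficients. -/
def coeffCmd : Cmd :=
  exponentCmd ;; dampingCmd ;; prodCmd ;; nodeCmd ;; diffCmd ;; truncCmd ;; sumCmd ;; valueCmd ;;
    diffCmd

/-- `B` bounds all numbers that occur. -/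
structure CoeffBounds (B r k R m : ℕ) : Prop where
  size : (2 * (k + 2 * R)) ^ 2 ^ m ≤ B
  two_pow : 2 * 2 ^ m ≤ B
  le : k + 2 ≤ B
  node : ∀ z, |nodeValue r k R m z| ≤ (B : ℤ)
  prod : ∀ j ≤ r, |dampingProd j k R m| ≤ (B : ℤ)
  value : ∀ z ≤ k, |valueNum r k R m z| ≤ (B : ℤ)
  diff_node : ∀ j n, |diffTable k j (nodeValue r k R m) n| ≤ (B : ℤ)
  diff_newton : ∀ j n, |diffTable k j (newtonTrunc R (nodeValue r k R m)) n| ≤ (B : ℤ)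
  diff_value : ∀ j n, |diffTable k j (valueNum r k R m) n| ≤ (B : ℤ)

/-- With H bounding every damping value on 0, …, k, the product and the node values are at most H^r,
the interpolation polynomial at most 3^k H^r, and the numerator values at most 2·3^k H^(r+1).
Difference tables contribute a further 2^k. -/
lemma coeffBounds {g : ℕ} (h : ParamsFit r k g R m)
    (hB : 2 * 6 ^ k * ((2 * (k + 2 * R)) ^ 2 ^ m) ^ (r + 1) ≤ B) : CoeffBounds B r k R m := by
  have hr := h.one_le_r
  have hrk := h.r_le
  have hR := h.two_mul_r_le
  set H : ℕ := (2 * (k + 2 * R)) ^ 2 ^ m with hH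
  have hm2 : m < 2 ^ m := Nat.lt_two_pow_self
  have hH1 : 2 ^ m + 1 ≤ H := by
    calc 2 ^ m + 1 ≤ 2 ^ 2 ^ m := Nat.lt_two_pow_self
      _ ≤ H := Nat.pow_le_pow_left (by omega) _
  have hHpos : 0 < H := by omega
  have hk3 : k + 1 ≤ 3 ^ k := Nat.lt_pow_self (by norm_num)
  have h26 : (2 : ℕ) ^ k * 3 ^ k = 6 ^ k := by rw [← mul_pow]; norm_num
  have h2k : 1 ≤ 2 ^ k := Nat.one_le_two_pow
  have hHr : H ≤ H ^ (r + 1) := Nat.le_self_pow (by omega) _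
  have hHr' : H ^ r ≤ H ^ (r + 1) := Nat.pow_le_pow_right hHpos (by omega)
  have hHr1 : 1 ≤ H ^ r := Nat.one_le_pow _ _ hHpos
  have b1 : H ^ (r + 1) ≤ B := le_trans (Nat.le_mul_of_pos_left _ (by positivity)) hB
  have b2 : 2 * H ≤ B := by
    refine le_trans ?_ hB
    calc 2 * H ≤ 2 * H ^ (r + 1) := by omega
      _ ≤ 2 * 6 ^ k * H ^ (r + 1) :=
        Nat.mul_le_mul_right _ (Nat.le_mul_of_pos_right _ (by positivity))
  have b3 : 2 * 6 ^ k ≤ B := le_trans (Nat.le_mul_of_pos_right _ (by positivity)) hB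
  have b4 : k + 2 ≤ B := by
    have : 3 ^ k ≤ 6 ^ k := Nat.pow_le_pow_left (by norm_num) k
    omega
  have b5 : 6 ^ k * H ^ r ≤ B := by
    refine le_trans ?_ hB
    exact Nat.mul_le_mul (by omega) hHr'
  have b6 : 2 ^ k * H ^ r ≤ B :=
    le_trans (Nat.mul_le_mul_right _ (Nat.pow_le_pow_left (by norm_num) k)) b5
  have hd : ∀ z ≤ k, |damping k R m z| ≤ (H : ℤ) := by
    intro z hz
    have := abs_dbl_le_pow (q := k) (y := k + 2 * R - 2 * z) (M := k + 2 * R) (by positivity)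
      (by omega) (by rw [abs_le]; constructor <;> omega) m
    rw [hH]
    push_cast
    exact this
  have hprod : ∀ j ≤ r, |dampingProd j k R m| ≤ (H : ℤ) ^ r := by
    intro j hj
    rw [dampingProd, Finset.abs_prod]
    refine (Finset.prod_le_prod (g := fun _ => (H : ℤ)) (fun i _ => abs_nonneg _)
      fun i hi => hd i ?_).trans ?_
    · simp at hi; omega
    · rw [Finset.prod_const, Finset.card_range]
      exact pow_le_pow_right₀ (by exact_mod_cast hHpos) hj
  have hnode : ∀ z, |nodeValue r k R m z| ≤ (H : ℤ) ^ r := by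
    intro z
    unfold nodeValue
    split_ifs
    · refine le_trans ?_ (hprod r le_rfl)
      rw [Int.abs_eq_natAbs, Int.abs_eq_natAbs]
      exact_mod_cast Int.natAbs_ediv_le_natAbs _ _
    · rw [abs_zero]; positivity
  have hnewt : ∀ z ≤ k, |newtonTrunc R (nodeValue r k R m) z| ≤ 3 ^ k * (H : ℤ) ^ r := by
    intro z hz
    refine (abs_newtonTrunc_le_three_pow (by positivity) hnode z).trans ?_
    gcongr
    norm_num
  have hval : ∀ z ≤ k, |valueNum r k R m z| ≤ 2 * 3 ^ k * (H : ℤ) ^ (r + 1) := by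
    intro z hz
    have e1 := hprod r le_rfl
    have e2 : |newtonTrunc R (nodeValue r k R m) z * damping k R m z| ≤
        3 ^ k * (H : ℤ) ^ r * H := by
      rw [abs_mul]
      exact mul_le_mul (hnewt z hz) (hd z hz) (abs_nonneg _) (by positivity)
    have e3 : (H : ℤ) ^ r ≤ 3 ^ k * (H : ℤ) ^ (r + 1) := by
      have a1 : (H : ℤ) ^ r ≤ (H : ℤ) ^ (r + 1) := by exact_mod_cast hHr'
      have a2 : (1 : ℤ) ≤ 3 ^ k := one_le_pow₀ (by norm_num)
      have a3 : (0 : ℤ) ≤ (H : ℤ) ^ (r + 1) := by positivity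
      nlinarith
    rw [valueNum]
    refine (abs_sub _ _).trans ?_
    rw [pow_succ] at e3 ⊢
    linarith
  have hBz : ∀ {x : ℤ} {n : ℕ}, |x| ≤ (n : ℤ) → n ≤ B → |x| ≤ (B : ℤ) := fun hx hn =>
    hx.trans (by exact_mod_cast hn)
  have B1 : ∀ j n, |diffTable k j (nodeValue r k R m) n| ≤ (B : ℤ) := fun j n =>
    hBz (by exact_mod_cast abs_diffTable_le (fun z _ => hnode z) j n) b6
  have B2 : ∀ j n, |diffTable k j (newtonTrunc R (nodeValue r k R m)) n| ≤ (B : ℤ) := fun j n => by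
    refine hBz (n := 6 ^ k * H ^ r) ?_ b5
    refine (abs_diffTable_le hnewt j n).trans (le_of_eq ?_)
    push_cast
    rw [← mul_assoc, ← mul_pow]; norm_num
  have B3 : ∀ j n, |diffTable k j (valueNum r k R m) n| ≤ (B : ℤ) := fun j n => by
    refine hBz (n := 2 * 6 ^ k * H ^ (r + 1)) ?_ hB
    refine (abs_diffTable_le hval j n).trans (le_of_eq ?_)
    push_cast
    rw [show (6 : ℤ) = 2 * 3 by norm_num, mul_pow]; ring
  have B4 : ∀ z ≤ k, |valueNum r k R m z| ≤ (B : ℤ) := fun z hz => by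
    have := B3 0 z
    rwa [diffTable_zero, if_pos hz] at this
  have B5 : ∀ z, |nodeValue r k R m z| ≤ (B : ℤ) := fun z =>
    hBz (n := H ^ r) (by exact_mod_cast hnode z) (hHr'.trans b1)
  have B6 : ∀ j ≤ r, |dampingProd j k R m| ≤ (B : ℤ) := fun j hj =>
    hBz (n := H ^ r) (by exact_mod_cast hprod j hj) (hHr'.trans b1)
  exact ⟨by omega, by omega, b4, B5, B6, B4, B1, B2, B3⟩

set_option maxHeartbeats 1000000 in
lemma wp_coeffCmd {g : ℕ} (h : ParamsFit r k g R m)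
    (hmin : ∀ j < m, (2 ^ j) ^ 2 < 4 * k * R * (2 * j + 1) ^ 2) (hB : CoeffBounds B r k R m)
    (h1 : s.reg 1 = r) (h2 : s.reg 2 = k) (h15 : s.reg 15 = R) (h3 : ∀ z, s.arr 3 z = 0) :
    wp B coeffCmd (100 * ((k + 1) * (k + m + 1)))
      (fun s' => s'.reg 7 = dampingProd r k R m ∧ s'.reg 8 = (2 * 2 ^ m : ℕ) ∧
        s'.arr 3 = coeffNum r k R m) s := by
  obtain ⟨b2, b2', b4, B5, B6, B4, B1, B2, B3⟩ := hB
  have hr := h.one_le_r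
  have hrk := h.r_le
  have hm2 : m < 2 ^ m := Nat.lt_two_pow_self
  -- All step counts are compared with the one quantity D, so that the remaining budget inequalities
  -- are linear.
  obtain ⟨D, hD⟩ : ∃ D, D = (k + 1) * (k + m + 1) := ⟨_, rfl⟩
  have hD1 : k * k + k * m + 2 * k + m + 1 = D := by rw [hD]; ring
  have hD2 : 1 ≤ D ∧ k ≤ D ∧ m ≤ D ∧ k * (3 * k + 4) ≤ 4 * D ∧
      (k + 1) * (4 * m + 20) ≤ 24 * D := by
    refine ⟨?_, ?_, ?_, ?_, ?_⟩ <;> nlinarith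
  obtain ⟨D1, D2, D3, D4, D5⟩ := hD2
  rw [← hD]
  refine wp_seq (N₁ := 3 * m + 5) (N₂ := 90 * D) (by omega) ?_
  refine wp_mono (wp_exponentCmd h.m_large hmin (by omega) h2 h15) le_rfl ?_
  rintro s₁ f₁ ⟨c6, c8⟩
  have a1 : s₁.reg 1 = r := (f₁.reg 1 (by decide)).trans h1
  have a2 : s₁.reg 2 = k := (f₁.reg 2 (by decide)).trans h2
  have a15 : s₁.reg 15 = R := (f₁.reg 15 (by decide)).trans h15
  have a3 : ∀ z, s₁.arr 3 z = 0 := fun z => (congr_fun (f₁.arr 3 (by decide)) z).trans (h3 z)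
  refine wp_seq (N₁ := (k + 1) * (4 * m + 20) + 2) (N₂ := 60 * D)
    (by omega) ?_
  refine wp_mono (wp_dampingCmd b2 b4 (by omega) (by omega) a2 c6 a15) le_rfl ?_
  intro s₂ f₂ cY
  have a1' : s₂.reg 1 = r := (f₂.reg 1 (by decide)).trans a1
  have a2' : s₂.reg 2 = k := (f₂.reg 2 (by decide)).trans a2
  have a15' : s₂.reg 15 = R := (f₂.reg 15 (by decide)).trans a15
  have a8' : s₂.reg 8 = (2 * 2 ^ m : ℕ) := (f₂.reg 8 (by decide)).trans c8
  have a3' : ∀ z, s₂.arr 3 z = 0 := fun z => (congr_fun (f₂.arr 3 (by decide)) z).trans (a3 z)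
  refine wp_seq (N₁ := 3 * r + 3) (N₂ := 50 * D) (by omega) ?_
  refine wp_mono (wp_prodCmd B6 (by omega) a1' fun z hz => cY z (by omega)) le_rfl ?_
  intro s₃ f₃ c7
  have a2₃ : s₃.reg 2 = k := (f₃.reg 2 (by decide)).trans a2'
  have a1₃ : s₃.reg 1 = r := (f₃.reg 1 (by decide)).trans a1'
  have a3₃ : ∀ z, s₃.arr 3 z = 0 := fun z => (congr_fun (f₃.arr 3 (by decide)) z).trans (a3' z)
  have cY₃ : ∀ z ≤ k, s₃.arr 2 z = damping k R m z := fun z hz =>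
    (congr_fun (f₃.arr 2 (by decide)) z).trans (cY z hz)
  refine wp_seq (N₁ := 3 * r + 2) (N₂ := 40 * D) (by omega) ?_
  refine wp_mono (wp_nodeCmd B5 (by omega) a1₃ c7 (fun z hz => cY₃ z (by omega)) a3₃) le_rfl ?_
  intro s₄ f₄ d₄
  have g₄ : Frame (prodCmd ;; nodeCmd) s₂ s₄ :=
    (f₃.mono (by decide) (by decide)).trans (f₄.mono (by decide) (by decide))
  have e₄ : s₄.arr 3 = diffTable k 0 (nodeValue r k R m) := by
    funext n
    rw [d₄, diffTable_zero]
    split_ifs with hn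
    · rfl
    · rw [nodeValue, if_neg (by omega)]
  refine wp_seq (N₁ := k * (3 * k + 4) + 2) (N₂ := 30 * D) (by omega) ?_
  refine wp_mono (wp_diffCmd _ B1 (by omega) ((f₄.reg 2 (by decide)).trans a2₃) e₄) le_rfl ?_
  intro s₅ f₅ d₅
  have g₅ : Frame (prodCmd ;; nodeCmd ;; diffCmd) s₂ s₅ :=
    (g₄.mono (by decide) (by decide)).trans (f₅.mono (by decide) (by decide))
  refine wp_seq (N₁ := 4 * k + 6) (N₂ := 24 * D) (by omega) ?_
  refine wp_mono (wp_truncCmd _ b4 ((g₅.reg 2 (by decide)).trans a2')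
    ((g₅.reg 15 (by decide)).trans a15') d₅) le_rfl ?_
  intro s₆ f₆ d₆
  have g₆ : Frame (prodCmd ;; nodeCmd ;; diffCmd ;; truncCmd) s₂ s₆ :=
    (g₅.mono (by decide) (by decide)).trans (f₆.mono (by decide) (by decide))
  refine wp_seq (N₁ := k * (3 * k + 4) + 2) (N₂ := 16 * D) (by omega) ?_
  refine wp_mono (wp_sumCmd _ B2 (by omega) ((g₆.reg 2 (by decide)).trans a2') d₆) le_rfl ?_
  intro s₇ f₇ d₇
  have g₇ : Frame (prodCmd ;; nodeCmd ;; diffCmd ;; truncCmd ;; sumCmd) s₂ s₇ :=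
    (g₆.mono (by decide) (by decide)).trans (f₇.mono (by decide) (by decide))
  have g₇' : Frame (nodeCmd ;; diffCmd ;; truncCmd ;; sumCmd) s₃ s₇ :=
    (f₄.mono (by decide) (by decide)).trans <| (f₅.mono (by decide) (by decide)).trans <|
      (f₆.mono (by decide) (by decide)).trans <| f₇.mono (by decide) (by decide)
  refine wp_seq (N₁ := 3 * k + 5) (N₂ := 8 * D) (by omega) ?_
  refine wp_mono (wp_valueCmd b4 B4 ((g₇.reg 2 (by decide)).trans a2')
    ((g₇'.reg 7 (by decide)).trans c7)
    (fun z hz => (congr_fun (g₇.arr 2 (by decide)) z).trans (cY z hz)) d₇) le_rfl ?_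
  intro s₈ f₈ d₈
  refine wp_mono (wp_diffCmd _ B3 (by omega)
    ((f₈.reg 2 (by decide)).trans ((g₇.reg 2 (by decide)).trans a2')) d₈) (by omega) ?_
  intro s₉ f₉ d₉
  have g₉ : Frame (valueCmd ;; diffCmd) s₇ s₉ :=
    (f₈.mono (by decide) (by decide)).trans (f₉.mono (by decide) (by decide))
  refine ⟨(g₉.reg 7 (by decide)).trans ((g₇'.reg 7 (by decide)).trans c7),
    (g₉.reg 8 (by decide)).trans ((g₇.reg 8 (by decide)).trans a8'), ?_⟩
  funext n
  rw [d₉, diffTable_self]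
  rfl

end RAM

/-! ### Enumerating the exponent vectors -/

section Enumeration

variable {d : ℕ}

/-- A slack coordinate turns degree at most t in d variables into degree exactly t in d + 1
variables. -/
lemma length_le_choose {t : ℕ} {l : List (Fin d →₀ ℕ)} (hl : l.Nodup)
    (h : ∀ j ∈ l, ∑ i, j i ≤ t) : l.length ≤ (d + t).choose t := by
  classical
  have h1 : (Finset.finsuppAntidiag (Finset.univ : Finset (Fin (d + 1))) t).card =
      (d + t).choose t := by
    rw [Finset.card_finsuppAntidiag_nat_eq_choose, Finset.card_univ, Fintype.card_fin]
    congr 1; omega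
  rw [← h1, ← List.toFinset_card_of_nodup hl]
  refine Finset.card_le_card_of_injOn (fun j => Finsupp.cons (t - ∑ i, j i) j) ?_ ?_
  · intro j hj
    have := h j (by simpa using hj)
    simp only [Finset.mem_coe, Finset.mem_finsuppAntidiag, Finset.subset_univ, and_true]
    rw [Fin.sum_univ_succ]
    simp only [Finsupp.cons_zero, Finsupp.cons_succ]
    omega
  · intro j _ j' _ hjj
    have := congrArg Finsupp.tail hjj
    simpa using this

/-- `l` lists the exponent vectors of degree at most `t` that vanish from `i` on. -/
structure ListsBelow (t i : ℕ) (l : List (Fin d →₀ ℕ)) : Prop where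
  nodup : l.Nodup
  mem_iff : ∀ j, j ∈ l ↔ ∑ a, j a ≤ t ∧ ∀ a : Fin d, i ≤ a → j a = 0

/-- The state of the enumeration after `u + X i` has been appended for the first `p` vectors `u`. -/
structure Extending (t : ℕ) (i : Fin d) (p : ℕ) (l : List (Fin d →₀ ℕ)) : Prop where
  le : p ≤ l.length
  nodup : l.Nodup
  of_mem : ∀ j ∈ l, ∑ a, j a ≤ t ∧ ∀ a, i < a → j a = 0
  mem_of : ∀ j, ∑ a, j a ≤ t → (∀ a, i ≤ a → j a = 0) → j ∈ l
  parent : ∀ j ∈ l, j i ≠ 0 → ∃ u ∈ l.take p, u + Finsupp.single i 1 = j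
  child : ∀ u ∈ l.take p, ∑ a, u a < t → u + Finsupp.single i 1 ∈ l

lemma sum_add_single (u : Fin d →₀ ℕ) (i : Fin d) :
    ∑ a, (u + Finsupp.single i 1 : Fin d →₀ ℕ) a = ∑ a, u a + 1 := by
  simp [Finset.sum_add_distrib, Finsupp.single_apply]

lemma ListsBelow.extending {t : ℕ} {i : Fin d} {l : List (Fin d →₀ ℕ)} (h : ListsBelow t i l) :
    Extending t i 0 l where
  le := Nat.zero_le _
  nodup := h.nodup
  of_mem j hj := ⟨((h.mem_iff j).1 hj).1, fun a ha => ((h.mem_iff j).1 hj).2 a (by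
    have : (i : ℕ) < a := ha
    omega)⟩
  mem_of j h1 h2 := (h.mem_iff j).2 ⟨h1, fun a ha => h2 a ha⟩
  parent j hj hi := absurd (((h.mem_iff j).1 hj).2 i le_rfl) hi
  child u hu := by simp at hu

/-- The new vector cannot be in the list already: its parent would be among the first p entries, but
the only candidate is the entry at position p, and the list has no repetitions. -/
lemma Extending.step_push {t : ℕ} {i : Fin d} {p : ℕ} {l : List (Fin d →₀ ℕ)}
    (h : Extending t i p l) (hp : p < l.length) (hdeg : ∑ a, l[p] a < t) :
    Extending t i (p + 1) (l ++ [l[p] + Finsupp.single i 1]) := by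
  have htake : (l ++ [l[p] + Finsupp.single i 1]).take (p + 1) = l.take p ++ [l[p]] := by
    rw [List.take_append_of_le_length (by omega), List.take_succ_eq_append_getElem hp]
  have hnot : l[p] ∉ l.take p := by
    intro hmem
    have := h.nodup
    rw [← List.take_append_drop p l, List.nodup_append] at this
    refine this.2.2 _ hmem _ ?_ rfl
    rw [List.drop_eq_getElem_cons hp]
    exact List.mem_cons_self
  have hmem : l[p] ∈ l := List.getElem_mem hp
  refine ⟨by simp; omega, ?_, ?_, ?_, ?_, ?_⟩
  · rw [List.nodup_append]
    refine ⟨h.nodup, List.nodup_singleton _, ?_⟩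
    intro a ha b hb hab
    rw [List.mem_singleton] at hb
    subst hab hb
    obtain ⟨u, hu, he⟩ := h.parent _ ha (by simp)
    exact hnot (add_right_cancel he ▸ hu)
  · intro j hj
    rw [List.mem_append, List.mem_singleton] at hj
    rcases hj with hj | rfl
    · exact h.of_mem j hj
    · refine ⟨by rw [sum_add_single]; exact hdeg, fun a ha => ?_⟩
      simp [(h.of_mem _ hmem).2 a ha, ha.ne]
  · intro j h1 h2
    exact List.mem_append_left _ (h.mem_of j h1 h2)
  · intro j hj hi
    rw [htake]
    rw [List.mem_append, List.mem_singleton] at hj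
    rcases hj with hj | rfl
    · obtain ⟨u, hu, he⟩ := h.parent j hj hi
      exact ⟨u, List.mem_append_left _ hu, he⟩
    · exact ⟨l[p], List.mem_append_right _ (List.mem_singleton_self _), rfl⟩
  · intro u hu hut
    rw [htake, List.mem_append, List.mem_singleton] at hu
    rw [List.mem_append, List.mem_singleton]
    rcases hu with hu | rfl
    · exact Or.inl (h.child u hu hut)
    · exact Or.inr rfl

lemma Extending.step_skip {t : ℕ} {i : Fin d} {p : ℕ} {l : List (Fin d →₀ ℕ)}
    (h : Extending t i p l) (hp : p < l.length) (hdeg : ¬ ∑ a, l[p] a < t) :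
    Extending t i (p + 1) l where
  le := hp
  nodup := h.nodup
  of_mem := h.of_mem
  mem_of := h.mem_of
  parent j hj hi := by
    obtain ⟨u, hu, he⟩ := h.parent j hj hi
    exact ⟨u, List.take_subset_take_left l (Nat.le_succ p) hu, he⟩
  child u hu hut := by
    rw [List.take_succ_eq_append_getElem hp, List.mem_append, List.mem_singleton] at hu
    rcases hu with hu | rfl
    · exact h.child u hu hut
    · exact absurd hut hdeg

/-- Once every entry has been treated, induction on the i-th exponent applies: lowering it by one
gives a listed vector of degree less than t, whose child is listed too. -/
lemma Extending.listsBelow {t : ℕ} {i : Fin d} {l : List (Fin d →₀ ℕ)}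
    (h : Extending t i l.length l) : ListsBelow t (i + 1) l where
  nodup := h.nodup
  mem_iff j := by
    constructor
    · exact fun hj => ⟨(h.of_mem j hj).1, fun a ha => (h.of_mem j hj).2 a ha⟩
    · rintro ⟨h1, h2⟩
      obtain ⟨n, hn⟩ : ∃ n, j i = n := ⟨_, rfl⟩
      induction n generalizing j with
      | zero =>
        refine h.mem_of j h1 fun a ha => ?_
        rcases ha.eq_or_lt with rfl | ha
        · exact hn
        · exact h2 a ha
      | succ n ih =>
        have hsub : j - Finsupp.single i 1 + Finsupp.single i 1 = j := by
          apply tsub_add_cancel_of_le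
          rw [Finsupp.single_le_iff]; omega
        have hsum := sum_add_single (j - Finsupp.single i 1) i
        rw [hsub] at hsum
        rw [← hsub]
        refine h.child _ ?_ (by omega)
        rw [List.take_length]
        refine ih _ (by omega) (fun a ha => ?_) (by simp [hn])
        simp [h2 a ha]

lemma listsBelow_zero (t : ℕ) : ListsBelow t 0 [(0 : Fin d →₀ ℕ)] where
  nodup := List.nodup_singleton _
  mem_iff j := by
    rw [List.mem_singleton]
    constructor
    · rintro rfl; simp
    · rintro ⟨-, h⟩
      ext a
      exact h a (Nat.zero_le _)

end Enumeration

/-! ### Writing the listed exponent vectors and their coefficients into memory -/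

namespace RAM

lemma eq_getElem_flatMap {α : Type*} (f : α → List ℤ) {n : ℕ} (hf : ∀ a, (f a).length = n)
    (l : List α) (A : ℕ → ℤ)
    (h : ∀ q (hq : q < l.length) i (hi : i < (f l[q]).length), A (q * n + i) = (f l[q])[i]) :
    ∀ i (hi : i < (l.flatMap f).length), A i = (l.flatMap f)[i] := by
  induction l generalizing A with
  | nil => intro i hi; simp at hi
  | cons a l ih =>
    intro i hi
    simp only [List.flatMap_cons, List.getElem_append]
    split_ifs with hia
    · have := h 0 (by simp) i (by simpa using hia)
      rw [zero_mul, zero_add] at this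
      exact this
    · rw [hf] at hia
      have := ih (fun i => A (n + i)) (fun q hq i hi => by
        have := h (q + 1) (by simpa using hq) i (by simpa using hi)
        simp only [List.getElem_cons_succ] at this
        rw [← this]; congr 1; ring) (i - n) (by
          simp only [List.flatMap_cons, List.length_append, hf] at hi
          omega)
      simp only [hf]
      rw [← this]; congr 1; omega

variable {d : ℕ}

open Classical in
/-- The numerator of the coefficient at `j`. -/
noncomputable def blockCoeff (x : Fin d → Bool) (c : ℕ → ℤ) (j : Fin d →₀ ℕ) : ℤ :=
  if ExpLe x j then c (∑ a, j a) else 0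

open Classical in
/-- The output array holds the blocks of the exponent vectors in `l`; array `4` holds their degrees
and array `5` marks those that are bounded by `x`. -/
structure Holds (x : Fin d → Bool) (c : ℕ → ℤ) (b : ℤ) (l : List (Fin d →₀ ℕ)) (s : Store) :
    Prop where
  len : s.reg 9 = l.length
  exp : ∀ q (hq : q < l.length) (a : Fin d), s.arr 1 (q * (d + 2) + a) = l[q] a
  num : ∀ q (hq : q < l.length), s.arr 1 (q * (d + 2) + d) = blockCoeff x c l[q]
  den : ∀ q, q < l.length → s.arr 1 (q * (d + 2) + (d + 1)) = b
  deg : ∀ q (hq : q < l.length), s.arr 4 q = (∑ a, l[q] a : ℕ)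
  ok : ∀ q (hq : q < l.length), s.arr 5 q = if ExpLe x l[q] then 1 else 0

lemma Holds.congr {x : Fin d → Bool} {c : ℕ → ℤ} {b : ℤ} {l : List (Fin d →₀ ℕ)} {s s' : Store}
    (h : Holds x c b l s) (h9 : s'.reg 9 = s.reg 9) (ha : s'.arr = s.arr) : Holds x c b l s' := by
  obtain ⟨h1, h2, h3, h4, h5, h6⟩ := h
  refine ⟨h9.trans h1, ?_, ?_, ?_, ?_, ?_⟩ <;> rw [ha] <;> assumption

/-- Copies block p to the end and raises its i-th exponent e by one. The new vector is bounded by x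
exactly if the old one is, x_i = 1 and e = 0, that is, if the product of the old mark, x_i and 1 - e
is positive. The degree then selects the numerator in array 3. -/
def pushCmd : Cmd :=
  forCmd 12 (.get 3) (.write 1 (.get 9 ⊗ₑ (.get 3 ⊕ₑ .lit 2) ⊕ₑ .get 12)
    (.read 1 (.get 11 ⊗ₑ (.get 3 ⊕ₑ .lit 2) ⊕ₑ .get 12))) ;;
  .assign 16 (.read 1 (.get 11 ⊗ₑ (.get 3 ⊕ₑ .lit 2) ⊕ₑ .get 10)) ;;
  .write 1 (.get 9 ⊗ₑ (.get 3 ⊕ₑ .lit 2) ⊕ₑ .get 10) (.get 16 ⊕ₑ .lit 1) ;;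
  .write 4 (.get 9) (.read 4 (.get 11) ⊕ₑ .lit 1) ;;
  .write 1 (.get 9 ⊗ₑ (.get 3 ⊕ₑ .lit 2) ⊕ₑ (.get 3 ⊕ₑ .lit 1)) (.get 7) ;;
  .cond (.read 5 (.get 11) ⊗ₑ .read 0 (.lit 4 ⊕ₑ .get 10) ⊗ₑ (.lit 1 ⊖ₑ .get 16))
    (.write 5 (.get 9) (.lit 1) ;;
      .write 1 (.get 9 ⊗ₑ (.get 3 ⊕ₑ .lit 2) ⊕ₑ .get 3) (.read 3 (.read 4 (.get 9))))
    (.write 5 (.get 9) (.lit 0) ;;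
      .write 1 (.get 9 ⊗ₑ (.get 3 ⊕ₑ .lit 2) ⊕ₑ .get 3) (.lit 0)) ;;
  .assign 9 (.get 9 ⊕ₑ .lit 1)

lemma toNat_address (q d i : ℕ) : ((q : ℤ) * ((d : ℤ) + 2) + (i : ℤ)).toNat = q * (d + 2) + i := by
  rw [← Int.toNat_natCast (q * (d + 2) + i)]
  push_cast
  rfl

lemma toNat_address' (q d : ℕ) :
    ((q : ℤ) * ((d : ℤ) + 2) + ((d : ℤ) + 1)).toNat = q * (d + 2) + (d + 1) := by
  rw [← Int.toNat_natCast (q * (d + 2) + (d + 1))]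
  push_cast
  rfl

variable {B : ℕ} {s : Store}

/-- The effect of `pushCmd` on the memory. -/
lemma wp_pushCmd_memory {n p i δ e : ℕ} (v : ℤ) (hv : |v| ≤ 1) (hi : i < d) (hpn : p < n)
    (hdB : d + 1 ≤ B) (hnB : n + 1 ≤ B) (heB : e + 1 ≤ B) (hδB : δ + 1 ≤ B)
    (h3 : s.reg 3 = d) (h9 : s.reg 9 = n) (h10 : s.reg 10 = i) (h11 : s.reg 11 = p)
    (he : s.arr 1 (p * (d + 2) + i) = e) (hδ : s.arr 4 p = δ) (hx : s.arr 0 (4 + i) = v) :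
    wp B pushCmd (3 * d + 12) (fun s' => s'.reg 9 = n + 1 ∧
      (∀ z, s'.arr 1 z =
        if z = n * (d + 2) + d then
          (if 0 < s.arr 5 p * v * (1 - e) then s.arr 3 (δ + 1) else 0) else
        if z = n * (d + 2) + (d + 1) then s.reg 7 else
        if z = n * (d + 2) + i then (e : ℤ) + 1 else
        if n * (d + 2) ≤ z ∧ z < n * (d + 2) + d then s.arr 1 (p * (d + 2) + (z - n * (d + 2))) else
        s.arr 1 z) ∧
      (∀ z, s'.arr 4 z = if z = n then (δ : ℤ) + 1 else s.arr 4 z) ∧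
      (∀ z, s'.arr 5 z = if z = n then (if 0 < s.arr 5 p * v * (1 - e) then 1 else 0)
        else s.arr 5 z)) s := by
  refine wp_of_bounded fun hbd => ?_
  have hpn' : p * (d + 2) + (d + 2) ≤ n * (d + 2) := by nlinarith
  refine wp_seq (N₁ := 3 * d + 2) (N₂ := 10) (by omega) ?_
  refine wp_for d (fun l s' => ∀ z, s'.arr 1 z =
    if n * (d + 2) ≤ z ∧ z < n * (d + 2) + l then s.arr 1 (p * (d + 2) + (z - n * (d + 2))) else
    s.arr 1 z) (N := 1)
    (by decide) (by decide) hdB (by omega) ?_ (fun j s' v h => by simpa using h) ?_ ?_ ?_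
  · intro s' hf
    have := hf.reg 3 (by decide)
    simp [Expr.eval, Expr.Safe, this, h3]
  · intro l s' hl hf hr hI
    have e3 : s'.reg 3 = d := (hf.reg 3 (by decide)).trans h3
    have e9 : s'.reg 9 = n := (hf.reg 9 (by decide)).trans h9
    have e11 : s'.reg 11 = p := (hf.reg 11 (by decide)).trans h11
    have hval : s'.arr 1 (p * (d + 2) + l) = s.arr 1 (p * (d + 2) + l) := by
      rw [hI, if_neg (by omega)]
    refine wp_write (by decide) (by simp [Expr.Safe]) ?_ ?_
    · simp only [Expr.eval, Op.apply, e3, e11, hr, toNat_address, hval]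
      exact hbd.arr _ _ (by decide)
    · intro z
      simp only [Expr.eval, Op.apply, e3, e9, e11, hr, toNat_address, hval, Store.setArr_arr,
        true_and, hI]
      by_cases hz : z = n * (d + 2) + l
      · rw [if_pos hz, if_pos (by omega)]
        congr 1; omega
      · rw [if_neg hz]
        split_ifs <;> first | rfl | omega
  · intro z
    rw [if_neg (by omega)]
  intro s₁ hf hI
  have e3 : s₁.reg 3 = d := (hf.reg 3 (by decide)).trans h3
  have e7 : s₁.reg 7 = s.reg 7 := hf.reg 7 (by decide)
  have e9 : s₁.reg 9 = n := (hf.reg 9 (by decide)).trans h9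
  have e10 : s₁.reg 10 = i := (hf.reg 10 (by decide)).trans h10
  have e11 : s₁.reg 11 = p := (hf.reg 11 (by decide)).trans h11
  have a0 : s₁.arr 0 = s.arr 0 := hf.arr 0 (by decide)
  have a3 : s₁.arr 3 = s.arr 3 := hf.arr 3 (by decide)
  have a4 : s₁.arr 4 = s.arr 4 := hf.arr 4 (by decide)
  have a5 : s₁.arr 5 = s.arr 5 := hf.arr 5 (by decide)
  have he₁ : s₁.arr 1 (p * (d + 2) + i) = e := by rw [hI, if_neg (by omega), he]
  have t4 : ((4 : ℤ) + i).toNat = 4 + i := by omega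
  have t5 : ((δ : ℤ) + 1).toNat = δ + 1 := by omega
  have hnp : p ≠ n := by omega
  refine wp_seq (N₁ := 1) (N₂ := 9) (by omega) (wp_assign (by decide) (by simp [Expr.Safe]) ?_ ?_)
  · simp only [Expr.eval, Op.apply, e3, e11, e10, toNat_address, he₁]
    rw [Nat.abs_cast]; exact_mod_cast (by omega : e ≤ B)
  simp only [Expr.eval, Op.apply, e3, e11, e10, toNat_address, he₁]
  refine wp_seq (N₁ := 1) (N₂ := 8) (by omega) (wp_write (by decide) (by simp [Expr.Safe]) ?_ ?_)
  · simp [Expr.eval, Op.apply]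
    rw [abs_of_nonneg (by positivity)]; exact_mod_cast heB
  simp only [Expr.eval, Op.apply, Store.setReg_reg, e3, e9, e10, reduceIte, toNat_address,
    show (9 : ℕ) ≠ 16 by decide, show (3 : ℕ) ≠ 16 by decide, show (10 : ℕ) ≠ 16 by decide]
  refine wp_seq (N₁ := 1) (N₂ := 7) (by omega) (wp_write (by decide) (by simp [Expr.Safe]) ?_ ?_)
  · simp [Expr.eval, Op.apply, e11, a4, hδ]
    rw [abs_of_nonneg (by positivity)]; exact_mod_cast hδB
  refine wp_seq (N₁ := 1) (N₂ := 6) (by omega) (wp_write (by decide) (by simp [Expr.Safe]) ?_ ?_)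
  · simp [Expr.eval, e7]
    exact hbd.reg 7
  refine wp_seq (N₁ := 3) (N₂ := 1) (by omega) ?_
  refine wp_cond (by decide) ?_ (fun hc => ?_) (fun hc => ?_)
  · simp [Expr.Safe, Expr.eval, Op.apply, e10, a0, t4, hx]
    omega
  · simp [Expr.eval, Op.apply, e9, e10, e11, a0, a5, t4, hx] at hc
    refine wp_seq (N₁ := 1) (N₂ := 1) (by omega) (wp_write (by decide) (by simp [Expr.Safe]) ?_ ?_)
    · simp [Expr.eval]; omega
    refine wp_write (by decide) (by simp [Expr.Safe]) ?_ ?_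
    · simp [Expr.eval, Op.apply, e9, e11, a3, a4, hδ, t5]
      exact hbd.arr _ _ (by decide)
    refine wp_assign (by decide) (by simp [Expr.Safe]) ?_ ⟨?_, ?_, ?_, ?_⟩
    · simp [Expr.eval, Op.apply, e9]
      rw [abs_of_nonneg (by positivity)]; exact_mod_cast hnB
    · simp [Expr.eval, Op.apply, e9]
    · intro z
      simp [Expr.eval, Op.apply, e3, e7, e9, e11, a3, a4, hδ, t5, toNat_address,
        toNat_address', hc, hI]
    · intro z
      simp [Expr.eval, Op.apply, e9, e11, a4, hδ]
    · intro z
      simp [Expr.eval, Op.apply, e9, a5, hc]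
  · simp [Expr.eval, Op.apply, e9, e10, e11, a0, a5, t4, hx] at hc
    refine wp_seq (N₁ := 1) (N₂ := 1) (by omega) (wp_write (by decide) (by simp [Expr.Safe]) ?_ ?_)
    · simp [Expr.eval]
    refine wp_write (by decide) (by simp [Expr.Safe]) ?_ ?_
    · simp [Expr.eval]
    refine wp_assign (by decide) (by simp [Expr.Safe]) ?_ ⟨?_, ?_, ?_, ?_⟩
    · simp [Expr.eval, Op.apply, e9]
      rw [abs_of_nonneg (by positivity)]; exact_mod_cast hnB
    · simp [Expr.eval, Op.apply, e9]
    · intro z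
      simp [Expr.eval, Op.apply, e3, e7, e9, e11, toNat_address,
        toNat_address', hI, not_lt.2 hc]
    · intro z
      simp [Expr.eval, Op.apply, e9, e11, a4, hδ]
    · intro z
      simp [Expr.eval, Op.apply, e9, a5, not_lt.2 hc]

lemma expLe_add_single {x : Fin d → Bool} {u : Fin d →₀ ℕ} {i : Fin d} :
    ExpLe x (u + Finsupp.single i 1) ↔ ExpLe x u ∧ x i = true ∧ u i = 0 := by
  constructor
  · intro h
    have hi := h i
    have h2 := Bool.toNat_le (x i)
    simp only [Finsupp.add_apply, Finsupp.single_eq_same] at hi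
    refine ⟨fun a => le_trans ?_ (h a), ?_, by omega⟩
    · simp
    · rcases hx : x i
      · simp [hx] at hi
      · rfl
  · rintro ⟨h, hx, h0⟩ a
    rcases eq_or_ne i a with rfl | hne
    · simp [hx, h0]
    · simpa [Finsupp.single_apply, hne] using h a

lemma wp_pushCmd {x : Fin d → Bool} {c : ℕ → ℤ} {b : ℤ} {l : List (Fin d →₀ ℕ)} {p t : ℕ}
    {i : Fin d} (h : Holds x c b l s) (hp : p < l.length) (hdeg : ∑ a, l[p] a < t)
    (hdB : d + 1 ≤ B) (hlB : l.length + 1 ≤ B) (htB : t ≤ B)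
    (h3 : s.reg 3 = d) (h7 : s.reg 7 = b) (h10 : s.reg 10 = i) (h11 : s.reg 11 = p)
    (hx : s.arr 0 (4 + i) = (x i).toNat) (hc : s.arr 3 = c) :
    wp B pushCmd (3 * d + 12) (Holds x c b (l ++ [l[p] + Finsupp.single i 1])) s := by
  classical
  have hle : l[p] i ≤ ∑ a, l[p] a :=
    Finset.single_le_sum (f := fun a => l[p] a) (fun _ _ => Nat.zero_le _) (Finset.mem_univ i)
  have h2 := Bool.toNat_le (x i)
  refine wp_mono (wp_pushCmd_memory (i := i) (n := l.length) (δ := ∑ a, l[p] a) (e := l[p] i)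
    (x i).toNat (by rw [Nat.abs_cast]; exact_mod_cast h2) i.2 hp hdB hlB (by omega) (by omega) h3
    h.len h10 h11 (h.exp p hp i) (h.deg p hp) hx) le_rfl ?_
  rintro s' - ⟨g9, g1, g4, g5⟩
  set j := l[p] + Finsupp.single i 1 with hj
  have hpos : 0 < s.arr 5 p * ((x i).toNat : ℤ) * (1 - (l[p] i : ℤ)) ↔ ExpLe x j := by
    rw [h.ok p hp, hj, expLe_add_single]
    rcases hxi : x i <;> by_cases he : ExpLe x l[p] <;> simp [he]
  have hnew : ∀ {q}, q < (l ++ [j]).length → ¬ q < l.length → q = l.length := by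
    intro q hq hq'
    simp at hq
    omega
  have hadd : ∀ q, q < l.length → q * (d + 2) + (d + 2) ≤ l.length * (d + 2) := by
    intro q hq
    nlinarith
  refine ⟨?_, ?_, ?_, ?_, ?_, ?_⟩
  · simp [g9]
  · intro q hq a
    have ha := a.2
    rw [g1]
    rcases lt_or_ge q l.length with hq' | hq'
    · have := hadd q hq'
      rw [if_neg (by omega), if_neg (by omega), if_neg (by omega), if_neg (by omega),
        List.getElem_append_left hq']
      exact h.exp q hq' a
    · obtain rfl := hnew hq (by omega)
      rw [if_neg (by omega), if_neg (by omega)]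
      have hlast : (l ++ [j])[l.length] = j := by simp
      rw [hlast]
      split_ifs with h1 h2
      · have : a = i := Fin.ext (by omega)
        subst this
        simp [hj]
      · have : i ≠ a := by rintro rfl; exact h1 rfl
        rw [Nat.add_sub_cancel_left, h.exp p hp a]
        simp [hj, this]
      · omega
  · intro q hq
    rw [g1]
    rcases lt_or_ge q l.length with hq' | hq'
    · have := hadd q hq'
      have := i.2
      rw [if_neg (by omega), if_neg (by omega), if_neg (by omega), if_neg (by omega),
        List.getElem_append_left hq']
      exact h.num q hq'
    · obtain rfl := hnew hq (by omega)
      have hlast : (l ++ [j])[l.length] = j := by simp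
      rw [if_pos rfl, hlast, blockCoeff, hj, sum_add_single, ← hj, hc]
      simp only [hpos]
  · intro q hq
    rw [g1]
    rcases lt_or_ge q l.length with hq' | hq'
    · have := hadd q hq'
      have := i.2
      rw [if_neg (by omega), if_neg (by omega), if_neg (by omega), if_neg (by omega)]
      exact h.den q hq'
    · obtain rfl := hnew hq (by omega)
      rw [if_neg (by omega), if_pos rfl, h7]
  · intro q hq
    rw [g4]
    rcases lt_or_ge q l.length with hq' | hq'
    · rw [if_neg (by omega), List.getElem_append_left hq']
      exact h.deg q hq'
    · obtain rfl := hnew hq (by omega)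
      have hlast : (l ++ [j])[l.length] = j := by simp
      rw [if_pos rfl, hlast, hj, sum_add_single]
      push_cast
      rfl
  · intro q hq
    rw [g5]
    rcases lt_or_ge q l.length with hq' | hq'
    · rw [if_neg (by omega), List.getElem_append_left hq']
      exact h.ok q hq'
    · obtain rfl := hnew hq (by omega)
      have hlast : (l ++ [j])[l.length] = j := by simp
      rw [if_pos rfl, hlast]
      simp only [hpos]

def phaseCmd : Cmd :=
  .assign 11 (.lit 0) ;;
  .loop (.get 9 ⊖ₑ .get 11)
    (.cond (.get 8 ⊖ₑ .read 4 (.get 11)) pushCmd .nop ;;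
      .assign 11 (.get 11 ⊕ₑ .lit 1))

lemma wp_phaseCmd {x : Fin d → Bool} {c : ℕ → ℤ} {b : ℤ} {t : ℕ} {i : Fin d}
    (h : ∃ l, Holds x c b l s ∧ ListsBelow t i l)
    (hdB : d + 1 ≤ B) (hlB : (d + t).choose t + 1 ≤ B) (htB : t ≤ B)
    (h3 : s.reg 3 = d) (h7 : s.reg 7 = b) (h8 : s.reg 8 = t) (h10 : s.reg 10 = i)
    (hx : s.arr 0 (4 + i) = (x i).toNat) (hc : s.arr 3 = c) :
    wp B phaseCmd ((d + t).choose t * (3 * d + 15) + 2)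
      (fun s' => ∃ l, Holds x c b l s' ∧ ListsBelow t (i + 1) l) s := by
  obtain ⟨l, hl, hlist⟩ := h
  refine wp_seq (N₁ := 1) (N₂ := (d + t).choose t * (3 * d + 14 + 1) + 1) (by lia)
    (wp_assign (by decide) (by simp [Expr.Safe]) (by simp [Expr.eval]) ?_)
  refine wp_loop (fun p s' => ∃ l, Holds x c b l s' ∧ Extending t i p l ∧ s'.reg 11 = p)
    (by decide) (by simp [Expr.Safe]) ?_ ⟨l, hl.congr (by simp) (by simp), hlist.extending,
      by simp [Expr.eval]⟩ ?_
  · rintro p s' hf ⟨l, hl, hext, h11⟩ hpos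
    simp [Expr.eval, Op.apply, hl.len, h11] at hpos
    have hK : l.length ≤ (d + t).choose t :=
      length_le_choose hext.nodup fun j hj => (hext.of_mem j hj).1
    refine ⟨by omega, wp_seq (N₁ := 3 * d + 13) (N₂ := 1) (by omega) ?_⟩
    have e8 : s'.reg 8 = t := (hf.reg 8 (by decide)).trans h8
    have key : wp B (.cond (.get 8 ⊖ₑ .read 4 (.get 11)) pushCmd .nop) (3 * d + 13)
        (fun s'' => ∃ l', Holds x c b l' s'' ∧ Extending t i (p + 1) l') s' := by
      refine wp_cond (by decide) (by simp [Expr.Safe]) (fun he => ?_) (fun he => ?_)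
      · simp [Expr.eval, Op.apply, e8, h11, hl.deg p hpos] at he
        have he' : ∑ a, l[p] a < t := by exact_mod_cast he
        refine wp_mono (wp_pushCmd hl hpos he' hdB (by omega) htB
          ((hf.reg 3 (by decide)).trans h3) ((hf.reg 7 (by decide)).trans h7)
          ((hf.reg 10 (by decide)).trans h10) h11
          ((congr_fun (hf.arr 0 (by decide)) _).trans hx)
          ((hf.arr 3 (by decide)).trans hc)) le_rfl fun s'' _ h' => ?_
        exact ⟨_, h', hext.step_push hpos he'⟩
      · simp [Expr.eval, Op.apply, e8, h11, hl.deg p hpos] at he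
        have he' : ¬ ∑ a, l[p] a < t := by rw [not_lt]; exact_mod_cast he
        exact wp_mono (wp_nop (Q := fun s'' => s'' = s') rfl) (by omega) fun s'' _ h' =>
          ⟨l, h' ▸ hl, hext.step_skip hpos he'⟩
    refine wp_mono key le_rfl ?_
    rintro s'' hf' ⟨l', hl', hext'⟩
    have e11 : s''.reg 11 = p := (hf'.reg 11 (by decide)).trans h11
    refine wp_assign (by decide) (by simp [Expr.Safe]) ?_ ⟨l', hl'.congr (by simp) (by simp),
      hext', by simp [Expr.eval, Op.apply, e11]⟩
    simp [Expr.eval, Op.apply, e11]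
    rw [abs_of_nonneg (by positivity)]
    exact_mod_cast (by omega : p + 1 ≤ B)
  · rintro p s' hf ⟨l, hl, hext, h11⟩ - hpos
    simp [Expr.eval, Op.apply, hl.len, h11] at hpos
    obtain rfl : p = l.length := le_antisymm hext.le hpos
    exact ⟨l, hl, hext.listsBelow⟩

/-- The list starts with the zero vector, whose exponents need no writing because the output array
is initially zero. -/
def enumCmd : Cmd :=
  .write 1 (.get 3) (.read 3 (.lit 0)) ;;
  .write 1 (.get 3 ⊕ₑ .lit 1) (.get 7) ;;
  .write 5 (.lit 0) (.lit 1) ;;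
  .write 4 (.lit 0) (.lit 0) ;;
  .assign 9 (.lit 1) ;;
  forCmd 10 (.get 3) phaseCmd ;;
  .assign 0 (.get 9 ⊗ₑ (.get 3 ⊕ₑ .lit 2))

/-- The block of the output that belongs to `j`. -/
noncomputable def block (x : Fin d → Bool) (c : ℕ → ℤ) (b : ℤ) (j : Fin d →₀ ℕ) : List ℤ :=
  List.ofFn (fun i => (j i : ℤ)) ++ [blockCoeff x c j, b]

lemma length_block (x : Fin d → Bool) (c : ℕ → ℤ) (b : ℤ) (j : Fin d →₀ ℕ) :
    (block x c b j).length = d + 2 := by simp [block]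

lemma Holds.eq_getElem {x : Fin d → Bool} {c : ℕ → ℤ} {b : ℤ} {l : List (Fin d →₀ ℕ)}
    (h : Holds x c b l s) (i : ℕ) (hi : i < (l.flatMap (block x c b)).length) :
    s.arr 1 i = (l.flatMap (block x c b))[i] := by
  refine eq_getElem_flatMap _ (length_block x c b) l _ (fun q hq i hi => ?_) i hi
  rw [length_block] at hi
  simp only [block, List.getElem_append, List.length_ofFn]
  split_ifs with hid
  · simpa using h.exp q hq ⟨i, hid⟩
  · rcases (by omega : i = d ∨ i = d + 1) with rfl | rfl
    · simpa using h.num q hq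
    · simpa using h.den q hq

lemma wp_enumCmd {x : Fin d → Bool} {c : ℕ → ℤ} {b : ℤ} {t : ℕ}
    (hdB : d + 1 ≤ B) (hlB : (d + t).choose t * (d + 2) + 1 ≤ B) (htB : t ≤ B)
    (h3 : s.reg 3 = d) (h7 : s.reg 7 = b) (h8 : s.reg 8 = t)
    (hx : ∀ i : Fin d, s.arr 0 (4 + i) = (x i).toNat) (hc : s.arr 3 = c)
    (h1 : ∀ z, s.arr 1 z = 0) :
    wp B enumCmd (d * ((d + t).choose t * (3 * d + 15) + 4) + 8)
      (fun s' => ∃ l, ListsBelow t d l ∧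
        s'.reg 0 = ((l.flatMap (block x c b)).length : ℤ) ∧
        ∀ i (hi : i < (l.flatMap (block x c b)).length),
          s'.arr 1 i = (l.flatMap (block x c b))[i]) s := by
  classical
  set K := (d + t).choose t with hK
  refine wp_of_bounded fun hbd => ?_
  have td : ((d : ℤ) + 1).toNat = d + 1 := by omega
  refine wp_seq (N₁ := 1) (N₂ := d * (K * (3 * d + 15) + 4) + 7) (by omega)
    (wp_write (by decide) (by simp [Expr.Safe]) (hbd.arr _ _ (by decide)) ?_)
  refine wp_seq (N₁ := 1) (N₂ := d * (K * (3 * d + 15) + 4) + 6) (by omega)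
    (wp_write (by decide) (by simp [Expr.Safe]) (hbd.reg 7) ?_)
  refine wp_seq (N₁ := 1) (N₂ := d * (K * (3 * d + 15) + 4) + 5) (by omega)
    (wp_write (by decide) (by simp [Expr.Safe]) (by simp [Expr.eval]; omega) ?_)
  refine wp_seq (N₁ := 1) (N₂ := d * (K * (3 * d + 15) + 4) + 4) (by omega)
    (wp_write (by decide) (by simp [Expr.Safe]) (by simp [Expr.eval]) ?_)
  refine wp_seq (N₁ := 1) (N₂ := d * (K * (3 * d + 15) + 4) + 3) (by omega)
    (wp_assign (by decide) (by simp [Expr.Safe]) (by simp [Expr.eval]; omega) ?_)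
  simp only [Expr.eval, Op.apply, h3, Store.setArr_reg, Int.toNat_natCast, td, Int.toNat_zero]
  set s₁ := (((((s.setArr 1 d (s.arr 3 0)).setArr 1 (d + 1) (s.reg 7)).setArr 5 0 1).setArr 4 0
    0).setReg 9 1) with hs₁
  have hinit : Holds x c b [0] s₁ := by
    have hlt : ∀ {q}, q < [(0 : Fin d →₀ ℕ)].length → q = 0 := by
      intro q hq; simpa using hq
    have hle : ExpLe x (0 : Fin d →₀ ℕ) := fun i => by simp
    refine ⟨by simp [hs₁], ?_, ?_, ?_, ?_, ?_⟩
    · intro q hq a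
      obtain rfl := hlt hq
      have := a.2
      simp [hs₁, h1, show (a : ℕ) ≠ d by omega, show (a : ℕ) ≠ d + 1 by omega]
    · intro q hq
      obtain rfl := hlt hq
      simp [hs₁, blockCoeff, hle, hc]
    · intro q hq
      obtain rfl := hlt hq
      simp [hs₁, h7]
    · intro q hq
      obtain rfl := hlt hq
      simp [hs₁]
    · intro q hq
      obtain rfl := hlt hq
      simp [hs₁, hle]
  have a3 : s₁.reg 3 = d := by simp [hs₁, h3]
  have a7 : s₁.reg 7 = b := by simp [hs₁, h7]
  have a8 : s₁.reg 8 = t := by simp [hs₁, h8]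
  have a0 : ∀ i : Fin d, s₁.arr 0 (4 + i) = (x i).toNat := by simp [hs₁, hx]
  have ac : s₁.arr 3 = c := by funext n; simp [hs₁, hc]
  have hKB : K + 1 ≤ B := by nlinarith
  refine wp_seq (N₁ := d * (K * (3 * d + 15) + 4) + 2) (N₂ := 1) (by omega) ?_
  refine wp_for d (fun j s' => ∃ l, Holds x c b l s' ∧ ListsBelow t j l)
    (N := K * (3 * d + 15) + 2) (by decide) (by decide) hdB (by lia) ?_ ?_ ?_
    ⟨[0], hinit.congr (by simp) (by simp), listsBelow_zero t⟩ ?_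
  · intro s' hf
    have := hf.reg 3 (by decide)
    simp [Expr.eval, Expr.Safe, this, a3]
  · rintro j s' v ⟨l, hl, hl'⟩
    exact ⟨l, hl.congr (by simp) (by simp), hl'⟩
  · intro j s' hj hf hr hI
    exact wp_phaseCmd (i := ⟨j, hj⟩) hI hdB hKB htB ((hf.reg 3 (by decide)).trans a3)
      ((hf.reg 7 (by decide)).trans a7) ((hf.reg 8 (by decide)).trans a8) hr
      ((congr_fun (hf.arr 0 (by decide)) _).trans (a0 ⟨j, hj⟩))
      ((hf.arr 3 (by decide)).trans ac)
  · rintro s' hf ⟨l, hl, hlist⟩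
    have e3 : s'.reg 3 = d := (hf.reg 3 (by decide)).trans a3
    have hlen : (l.flatMap (block x c b)).length = l.length * (d + 2) := by
      rw [List.length_flatMap]
      simp [length_block]
    have hlK : l.length ≤ K :=
      length_le_choose hlist.nodup fun j hj => ((hlist.mem_iff j).1 hj).1
    have hl' : Holds x c b l (s'.setReg 0 (l.length * (d + 2))) :=
      hl.congr (by simp) (by simp)
    refine wp_assign (by decide) (by simp [Expr.Safe]) ?_ ⟨l, hlist, ?_, ?_⟩
    · simp only [Expr.eval, Op.apply, e3, hl.len]
      rw [abs_of_nonneg (by positivity)]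
      have : l.length * (d + 2) ≤ K * (d + 2) := Nat.mul_le_mul_right _ hlK
      exact_mod_cast (by omega : l.length * (d + 2) ≤ B)
    · rw [hlen]
      simp [Expr.eval, Op.apply, e3, hl.len]
    · simpa [Expr.eval, Op.apply, e3, hl.len] using hl'.eq_getElem

end RAM

/-! ### The algorithm -/

namespace RAM

/-- Prepares the constant polynomial 1/b. Register 8 is still zero, so the enumeration runs with t =
0. -/
def constCmd (b : ℤ) : Cmd := .write 3 (.lit 0) (.lit 1) ;; .assign 7 (.lit b)

/-- The accuracy entry is read only if r > 0. For r = 0 the permitted time does not depend on γ,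
while this entry may be arbitrarily long. For the same reason `Bounded` exempts the input array and
`Expr.Safe` restricts only the cells actually read. -/
def mainCmd : Cmd :=
  .assign 1 (.read 0 (.lit 0)) ;;
  .assign 2 (.read 0 (.lit 1)) ;;
  .assign 3 (.read 0 (.lit 2)) ;;
  .cond (.get 1)
    (.assign 4 (.read 0 (.lit 3)) ;;
      .cond (.get 4 ⊖ₑ .lit 1) (.assign 15 (.get 1 ⊗ₑ .get 4) ;; coeffCmd) (constCmd 2))
    (constCmd 1) ;;
  enumCmd

variable {d : ℕ} {B : ℕ}

/-- The output of the algorithm: the blocks of all exponent vectors of degree at most `t`. -/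
def OutputsBlocks (x : Fin d → Bool) (t : ℕ) (c : ℕ → ℤ) (b : ℤ) (s : Store) : Prop :=
  ∃ l, ListsBelow t d l ∧
    s.reg 0 = ((l.flatMap (block x c b)).length : ℤ) ∧
    ∀ i (hi : i < (l.flatMap (block x c b)).length), s.arr 1 i = (l.flatMap (block x c b))[i]

lemma bounded_initial (B : ℕ) (input : List ℤ) : Bounded B (initial input) := by
  refine ⟨fun i => ?_, fun a n ha => ?_⟩ <;> simp [initial, *]

lemma initial_thresholdInput (r k : ℕ) (γ : ℝ) (x : Fin d → Bool) :
    (initial (thresholdInput r k γ x)).arr 0 0 = r ∧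
    (initial (thresholdInput r k γ x)).arr 0 1 = k ∧
    (initial (thresholdInput r k γ x)).arr 0 2 = d ∧
    (initial (thresholdInput r k γ x)).arr 0 3 = (⌈Real.logb 2 (1 / γ)⌉₊ : ℤ) ∧
    ∀ i : Fin d, (initial (thresholdInput r k γ x)).arr 0 (4 + i) = (x i).toNat := by
  refine ⟨by simp [initial, thresholdInput], by simp [initial, thresholdInput],
    by simp [initial, thresholdInput], by simp [initial, thresholdInput], fun i => ?_⟩
  simp only [initial, thresholdInput, reduceIte]
  rw [List.getD_append_right _ _ _ _ (by simp)]
  simp [List.getD]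

lemma wp_constCmd {s : Store} (b : ℤ) (hw : (Expr.lit b).weight + bitLen 7 + 1 ≤ 1000)
    (hb : |b| ≤ B) (hB : 1 ≤ B) (h3 : ∀ z, s.arr 3 z = 0) :
    wp B (constCmd b) 2 (fun s' => s'.reg 7 = b ∧
      s'.arr 3 = fun n => if n = 0 then 1 else 0) s := by
  refine wp_seq (N₁ := 1) (N₂ := 1) le_rfl (wp_write (by decide) (by simp [Expr.Safe]) ?_ ?_)
  · simp [Expr.eval]; omega
  refine wp_assign hw trivial (by simpa [Expr.eval] using hb) ⟨by simp [Expr.eval], ?_⟩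
  funext n
  simp [Expr.eval, h3]

section Main

variable {r k : ℕ} {γ : ℝ} {x : Fin d → Bool}

/-- The common beginning and end of all runs. -/
lemma wp_mainCmd {t N : ℕ} {c : ℕ → ℤ} {b : ℤ}
    (hrB : r ≤ B) (hkB : k ≤ B)
    (hdB : d + 1 ≤ B) (hlB : (d + t).choose t * (d + 2) + 1 ≤ B) (htB : t ≤ B)
    (h : ∀ s : Store, (∀ i, i ≠ 1 → i ≠ 2 → i ≠ 3 → s.reg i = 0) → s.reg 1 = r → s.reg 2 = k →
      s.reg 3 = d → s.arr = (initial (thresholdInput r k γ x)).arr →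
      wp B (.cond (.get 1)
        (.assign 4 (.read 0 (.lit 3)) ;;
          .cond (.get 4 ⊖ₑ .lit 1) (.assign 15 (.get 1 ⊗ₑ .get 4) ;; coeffCmd) (constCmd 2))
        (constCmd 1)) N (fun s' => s'.reg 7 = b ∧ s'.reg 8 = t ∧ s'.arr 3 = c) s) :
    wp B mainCmd (N + (d * ((d + t).choose t * (3 * d + 15) + 4) + 11)) (OutputsBlocks x t c b)
      (initial (thresholdInput r k γ x)) := by
  obtain ⟨i0, i1, i2, i3, ix⟩ := initial_thresholdInput r k γ x
  have cast_le : ∀ {n : ℕ}, n ≤ B → |(n : ℤ)| ≤ B := fun h => by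
    rw [Nat.abs_cast]; exact_mod_cast h
  set s₀ := initial (thresholdInput r k γ x) with hs₀
  have h0 : ∀ i, s₀.reg i = 0 := fun i => rfl
  refine wp_seq (N₁ := 1) (N₂ := N + (d * ((d + t).choose t * (3 * d + 15) + 4) + 10)) (by omega)
    (wp_assign (by decide) ?_ ?_ ?_)
  · simpa [Expr.Safe, Expr.eval, i0] using cast_le hrB
  · simpa [Expr.eval, i0] using cast_le hrB
  refine wp_seq (N₁ := 1) (N₂ := N + (d * ((d + t).choose t * (3 * d + 15) + 4) + 9)) (by omega)
    (wp_assign (by decide) ?_ ?_ ?_)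
  · simpa [Expr.Safe, Expr.eval, i1] using cast_le hkB
  · simpa [Expr.eval, i1] using cast_le hkB
  refine wp_seq (N₁ := 1) (N₂ := N + (d * ((d + t).choose t * (3 * d + 15) + 4) + 8)) (by omega)
    (wp_assign (by decide) ?_ ?_ ?_)
  · simpa [Expr.Safe, Expr.eval, i2] using cast_le (by omega)
  · simpa [Expr.eval, i2] using cast_le (by omega)
  simp only [Expr.eval, Store.setReg_arr, Int.toNat_zero, Int.toNat_one, show Int.toNat 2 = 2 from rfl, i0, i1, i2]
  refine wp_seq (N₁ := N) (N₂ := d * ((d + t).choose t * (3 * d + 15) + 4) + 8) le_rfl ?_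
  refine wp_mono (h _ ?_ (by simp) (by simp) (by simp) rfl) le_rfl ?_
  · intro i n1 n2 n3
    simp [n1, n2, n3, h0]
  rintro s₁ f₁ ⟨h7, h8, hc⟩
  refine wp_mono (wp_enumCmd (x := x) hdB hlB htB ((f₁.reg 3 (by decide)).trans (by simp)) h7 h8
    (fun i => (congr_fun (f₁.arr 0 (by decide)) _).trans (ix i)) hc
    (fun z => (congr_fun (f₁.arr 1 (by decide)) z).trans ?_)) le_rfl (fun _ _ h => h)
  simp [hs₀, initial]

lemma wp_mainCmd_const (hr : r = 0 ∨ ⌈Real.logb 2 (1 / γ)⌉₊ ≤ 1)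
    (hrB : r ≤ B) (hkB : k ≤ B) (hdB : d + 1 ≤ B) (hlB : d + 3 ≤ B) :
    wp B mainCmd (d * (3 * d + 19) + 16)
      (OutputsBlocks x 0 (fun n => if n = 0 then 1 else 0) (if r = 0 then 1 else 2))
      (initial (thresholdInput r k γ x)) := by
  obtain ⟨i0, i1, i2, i3, ix⟩ := initial_thresholdInput r k γ x
  refine wp_mono (wp_mainCmd (N := 5) hrB hkB hdB (by simp; omega) (Nat.zero_le _) ?_)
    (by simp; lia) (fun _ _ h => h)
  intro s h0 h1 h2 h3 harr
  have ha3 : ∀ z, s.arr 3 z = 0 := fun z => by rw [harr]; simp [initial]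
  refine wp_cond (by decide) (by simp [Expr.Safe]) (fun he => ?_) (fun he => ?_)
  · simp [Expr.eval, h1] at he
    have hg : ⌈Real.logb 2 (1 / γ)⌉₊ ≤ 1 := by omega
    have hgB : |((⌈Real.logb 2 (1 / γ)⌉₊ : ℕ) : ℤ)| ≤ B := by
      rw [Nat.abs_cast]; exact_mod_cast (by omega)
    refine wp_seq (N₁ := 1) (N₂ := 3) (by omega) (wp_assign (by decide) ?_ ?_ ?_)
    · simpa [Expr.Safe, Expr.eval, harr, i3] using hgB
    · simpa [Expr.eval, harr, i3] using hgB
    refine wp_cond (by decide) (by simp [Expr.Safe]) (fun he' => ?_) (fun he' => ?_)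
    · simp only [Expr.eval, Op.apply, harr, Store.setReg_reg, reduceIte, show Int.toNat 3 = 3 from rfl, i3] at he'
      omega
    · refine wp_mono (wp_constCmd 2 (by decide) (by rw [abs_two]; exact_mod_cast (by omega))
        (by omega) (by simpa using ha3)) le_rfl ?_
      rintro s' f ⟨g1, g2⟩
      refine ⟨by rw [g1, if_neg (by omega)], ?_, g2⟩
      rw [f.reg 8 (by decide)]
      simp [h0]
  · simp [Expr.eval, h1] at he
    refine wp_mono (wp_constCmd 1 (by decide) (by rw [abs_one]; exact_mod_cast (by omega))
      (by omega) ha3) (by omega) ?_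
    rintro s' f ⟨g1, g2⟩
    refine ⟨by rw [g1, if_pos he], ?_, g2⟩
    rw [f.reg 8 (by decide)]
    simp [h0]

lemma wp_mainCmd_main {g R m : ℕ} (hg : ⌈Real.logb 2 (1 / γ)⌉₊ = g) (h : ParamsFit r k g R m)
    (hmin : ∀ j < m, (2 ^ j) ^ 2 < 4 * k * R * (2 * j + 1) ^ 2) (hB : CoeffBounds B r k R m)
    (hRB : R ≤ B) (hdB : d + 1 ≤ B)
    (hlB : (d + 2 * 2 ^ m).choose (2 * 2 ^ m) * (d + 2) + 1 ≤ B) :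
    wp B mainCmd (100 * ((k + 1) * (k + m + 1)) + 4 +
        (d * ((d + 2 * 2 ^ m).choose (2 * 2 ^ m) * (3 * d + 15) + 4) + 11))
      (OutputsBlocks x (2 * 2 ^ m) (coeffNum r k R m) (dampingProd r k R m))
      (initial (thresholdInput r k γ x)) := by
  obtain ⟨i0, i1, i2, i3, ix⟩ := initial_thresholdInput r k γ x
  rw [hg] at i3
  have hr := h.one_le_r
  have hrk := h.r_le
  have hg2 := h.two_le_g
  have hkB := hB.le
  refine wp_mainCmd (by omega) (by omega) hdB hlB hB.two_pow ?_
  intro s h0 h1 h2 h3 harr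
  have hgB : |(g : ℤ)| ≤ B := by
    rw [Nat.abs_cast]; exact_mod_cast h.g_le.trans hRB
  have hRB' : |(R : ℤ)| ≤ B := by
    rw [Nat.abs_cast]; exact_mod_cast hRB
  refine wp_cond (by decide) (by simp [Expr.Safe]) (fun he => ?_) (fun he => ?_)
  · refine wp_seq (N₁ := 1) (N₂ := 100 * ((k + 1) * (k + m + 1)) + 2) (by omega)
      (wp_assign (by decide) ?_ ?_ ?_)
    · simpa [Expr.Safe, Expr.eval, harr, i3] using hgB
    · simpa [Expr.eval, harr, i3] using hgB
    simp only [Expr.eval, harr, show Int.toNat 3 = 3 from rfl, i3]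
    refine wp_cond (by decide) (by simp [Expr.Safe]) (fun he' => ?_) (fun he' => ?_)
    · refine wp_seq (N₁ := 1) (N₂ := 100 * ((k + 1) * (k + m + 1))) (by omega)
        (wp_assign (by decide) (by simp [Expr.Safe]) ?_ ?_)
      · simpa [Expr.eval, Op.apply, h1, h.R_eq] using hRB'
      refine wp_mono (wp_coeffCmd h hmin hB (by simp [h1]) (by simp [h2])
        (by simp [Expr.eval, Op.apply, h1, h.R_eq]) (fun z => ?_)) le_rfl (fun _ _ h => h)
      simp [harr, initial]
    · simp [Expr.eval, Op.apply] at he'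
      omega
  · simp [Expr.eval, h1] at he
    omega

end Main

/-! ### Correctness and running time -/

lemma isCoeffVector_of_listsBelow {x : Fin d → Bool} {t : ℕ} {c : ℕ → ℤ} {b : ℤ} (hb : 0 < b)
    {l : List (Fin d →₀ ℕ)} (hl : ListsBelow t d l) :
    IsCoeffVector t (multilinear x t fun n => (c n : ℝ) / b) (l.flatMap (block x c b)) := by
  classical
  have hmap : (l.map fun j => (j, blockCoeff x c j, b)).map Prod.fst = l := by
    rw [List.map_map]
    exact List.map_id l
  refine ⟨l.map fun j => (j, blockCoeff x c j, b), ?_, ?_, ?_, ?_⟩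
  · rw [hmap]; exact hl.nodup
  · intro j
    rw [hmap, hl.mem_iff]
    exact and_iff_left fun a ha => absurd a.2 (by omega)
  · intro q hq
    obtain ⟨j, hj, rfl⟩ := List.mem_map.1 hq
    refine ⟨hb, ?_⟩
    rw [coeff_multilinear x _ ((hl.mem_iff j).1 hj).1]
    simp only [blockCoeff]
    split_ifs <;> simp
  · rw [List.flatMap_map]
    rfl

lemma exists_outputs {A : Cmd} {x : Fin d → Bool} {r k t N : ℕ} {γ T : ℝ} {c : ℕ → ℤ} {b : ℤ}
    (hb : 0 < b) (hT : ∀ n ≤ t, |(c n : ℝ) / b| ≤ T)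
    (happrox : ∀ z ≤ k, |(if r ≤ z then (1 : ℝ) else 0) -
      ∑ n ∈ Finset.range (t + 1), (z.choose n : ℝ) * ((c n : ℝ) / b)| ≤ γ)
    (hwp : wp B A N (OutputsBlocks x t c b) (initial (thresholdInput r k γ x))) :
    ∃ p ∈ polyFamily d t T,
      (∀ y ∈ weightAtMost d k, |thresholdFamily r x y - MvPolynomial.eval (boolPoint y) p| ≤ γ) ∧
      ∃ (n : ℕ) (out : List ℤ), Outputs A (thresholdInput r k γ x) n out ∧
        IsCoeffVector t p out ∧ n ≤ N * unit B := by
  refine ⟨multilinear x t fun n => (c n : ℝ) / b, multilinear_mem_polyFamily x hT, ?_, ?_⟩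
  · intro y hy
    rw [eval_multilinear]
    have hz : ∑ j, (x j).toNat * (y j).toNat ≤ k := by
      refine le_trans (Finset.sum_le_sum fun j _ => ?_) hy
      have := Bool.toNat_le (x j)
      nlinarith
    unfold thresholdFamily thresholdQuery
    rw [Finset.sum_congr rfl fun j _ => mul_comm (y j).toNat (x j).toNat]
    exact happrox _ hz
  · obtain ⟨n, s', h1, h2, -, l, hl, h3, h4⟩ := hwp (bounded_initial _ _)
    exact ⟨n, _, ⟨s', h1, h3, h4⟩, isCoeffVector_of_listsBelow hb hl, h2⟩

end RAM

/-! ### The cost is polynomial -/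

namespace RAM

lemma unit_two_pow (L : ℕ) : unit (2 ^ L) = 1000 * (L + 1) := by
  rw [unit, Nat.log_pow (by norm_num)]

lemma add_one_le_two_pow (M : ℕ) : M + 1 ≤ 2 ^ M := Nat.lt_two_pow_self

lemma const_cost_le {d M : ℕ} (hM : d + 1 ≤ M) :
    (d * (3 * d + 19) + 16) * unit (2 ^ (20 * M ^ 3)) ≤ 20000000 * M ^ 6 := by
  rw [unit_two_pow]
  have h1 : 1 ≤ M ^ 3 := Nat.one_le_pow _ _ (by omega)
  have h2 : d * (3 * d + 19) + 16 ≤ 40 * M ^ 3 := by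
    have : d * (3 * d + 19) + 16 ≤ 40 * M ^ 2 := by nlinarith
    have h3 : M ^ 2 ≤ M ^ 3 := Nat.pow_le_pow_right (by omega) (by norm_num)
    omega
  calc _ ≤ (40 * M ^ 3) * (1000 * (21 * M ^ 3)) := Nat.mul_le_mul h2 (by omega)
    _ = 840000 * M ^ 6 := by ring
    _ ≤ _ := Nat.mul_le_mul_right _ (by norm_num)

lemma main_cost_le {d k m t K M : ℕ} (hkd : k ≤ d) (hmt : m ≤ t) (htK : t + 1 ≤ K)
    (hM : d + K ≤ M) :
    (100 * ((k + 1) * (k + m + 1)) + 4 + (d * (K * (3 * d + 15) + 4) + 11)) *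
      unit (2 ^ (20 * M ^ 3)) ≤ 20000000 * M ^ 6 := by
  rw [unit_two_pow]
  have h0 : 1 ≤ M := by omega
  have h1 : 1 ≤ M ^ 3 := Nat.one_le_pow _ _ h0
  have h2 : M ^ 2 ≤ M ^ 3 := Nat.pow_le_pow_right h0 (by norm_num)
  have h3 : M ≤ M ^ 3 := Nat.le_self_pow (by norm_num) M
  have a1 : (k + 1) * (k + m + 1) ≤ 2 * M ^ 2 := by
    calc (k + 1) * (k + m + 1) ≤ (M + 0) * (2 * M) := Nat.mul_le_mul (by omega) (by omega)
      _ = _ := by ring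
  have a2 : d * (K * (3 * d + 15) + 4) ≤ 22 * M ^ 3 := by
    have : K * (3 * d + 15) ≤ M * (18 * M) := Nat.mul_le_mul (by omega) (by omega)
    calc d * (K * (3 * d + 15) + 4) ≤ M * (M * (18 * M) + 4) := Nat.mul_le_mul (by omega) (by omega)
      _ = 18 * M ^ 3 + 4 * M := by ring
      _ ≤ _ := by omega
  calc _ ≤ (237 * M ^ 3) * (1000 * (21 * M ^ 3)) := Nat.mul_le_mul (by omega) (by omega)
    _ = 4977000 * M ^ 6 := by ring
    _ ≤ _ := Nat.mul_le_mul_right _ (by norm_num)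

/-- Both r + 1 and 2^m are at most of order M and R ≤ M². So the bit length of the main power is at
most 3M · M · 2M, and a bound B of cubic bit length suffices. -/
lemma size_le {d r k R m t K M : ℕ} (hr : 1 ≤ r) (hrk : r ≤ k) (hkd : k ≤ d)
    (hR : R ≤ (2 ^ m) ^ 2) (ht : t = 2 * 2 ^ m) (htK : t + 1 ≤ K) (hM : d + K ≤ M) :
    2 * 6 ^ k * ((2 * (k + 2 * R)) ^ 2 ^ m) ^ (r + 1) ≤ 2 ^ (20 * M ^ 3) ∧
    R ≤ 2 ^ (20 * M ^ 3) ∧ d + 1 ≤ 2 ^ (20 * M ^ 3) ∧ K * (d + 2) + 1 ≤ 2 ^ (20 * M ^ 3) := by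
  have hW : 1 ≤ 2 ^ m := Nat.one_le_two_pow
  have hM4 : 4 ≤ M := by omega
  have hMM := add_one_le_two_pow M
  have hW' : 2 ^ m ≤ M := by omega
  have hR' : R ≤ M ^ 2 := hR.trans (Nat.pow_le_pow_left hW' 2)
  have h13 : M ≤ M ^ 3 := Nat.le_self_pow (by norm_num) M
  have h23 : M ^ 2 ≤ M ^ 3 := Nat.pow_le_pow_right (by omega) (by norm_num)
  have hsq : M ^ 2 ≤ 2 ^ (2 * M) := by
    rw [mul_comm 2 M, pow_mul]
    exact Nat.pow_le_pow_left (by omega) 2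
  have hpow : ∀ {a : ℕ}, a ≤ 20 * M ^ 3 → 2 ^ a ≤ 2 ^ (20 * M ^ 3) := fun h =>
    Nat.pow_le_pow_right (by norm_num) h
  refine ⟨?_, ?_, ?_, ?_⟩
  · have a1 : 2 * (k + 2 * R) ≤ 2 ^ (3 * M) := by
      have e1 : 2 * (k + 2 * R) ≤ 6 * M ^ 2 := by nlinarith
      have e2 : 6 ≤ 2 ^ M := by
        calc 6 ≤ 2 ^ 4 := by norm_num
          _ ≤ 2 ^ M := Nat.pow_le_pow_right (by norm_num) hM4
      calc 2 * (k + 2 * R) ≤ 6 * M ^ 2 := e1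
        _ ≤ 2 ^ M * 2 ^ (2 * M) := Nat.mul_le_mul e2 hsq
        _ = 2 ^ (3 * M) := by rw [← pow_add]; congr 1; ring
    have a2 : ((2 * (k + 2 * R)) ^ 2 ^ m) ^ (r + 1) ≤ 2 ^ (6 * M ^ 3) := by
      rw [← pow_mul]
      calc (2 * (k + 2 * R)) ^ (2 ^ m * (r + 1)) ≤ (2 ^ (3 * M)) ^ (2 ^ m * (r + 1)) :=
            Nat.pow_le_pow_left a1 _
        _ = 2 ^ (3 * M * (2 ^ m * (r + 1))) := by rw [← pow_mul]
        _ ≤ 2 ^ (6 * M ^ 3) := by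
          refine Nat.pow_le_pow_right (by norm_num) ?_
          calc 3 * M * (2 ^ m * (r + 1)) ≤ 3 * M * (M * (2 * M)) :=
                Nat.mul_le_mul_left _ (Nat.mul_le_mul hW' (by omega))
            _ = 6 * M ^ 3 := by ring
    have a3 : 6 ^ k ≤ 2 ^ (3 * M) := by
      calc 6 ^ k ≤ 8 ^ M := (Nat.pow_le_pow_left (by norm_num) k).trans
            (Nat.pow_le_pow_right (by norm_num) (by omega))
        _ = 2 ^ (3 * M) := by rw [pow_mul]; norm_num
    calc 2 * 6 ^ k * ((2 * (k + 2 * R)) ^ 2 ^ m) ^ (r + 1)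
        ≤ 2 * 2 ^ (3 * M) * 2 ^ (6 * M ^ 3) := by gcongr
      _ = 2 ^ (1 + 3 * M + 6 * M ^ 3) := by rw [pow_add, pow_add, pow_one]
      _ ≤ _ := hpow (by omega)
  · exact hR'.trans (hsq.trans (hpow (by omega)))
  · exact (by omega : d + 1 ≤ 2 ^ M).trans (hpow (by omega))
  · have : K * (d + 2) + 1 ≤ (M + 1) ^ 2 := by nlinarith
    refine this.trans (le_trans ?_ (hpow (a := 2 * M) (by omega)))
    rw [mul_comm 2 M, pow_mul]
    exact Nat.pow_le_pow_left hMM 2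

/-- Makes 2^m polynomial in binom(d+t, t), which the running time may depend on. -/
lemma succ_le_choose {d t : ℕ} (hd : 1 ≤ d) : t + 1 ≤ (d + t).choose t := by
  calc t + 1 = (1 + t).choose t := by rw [add_comm 1 t, Nat.choose_succ_self_right]
    _ ≤ (d + t).choose t := Nat.choose_le_choose t (by omega)

lemma polynomial_time {C d K n : ℕ} {T : ℝ} (hC : 20000000000 ≤ C)
    (hn : n ≤ 20000000 * (d + K) ^ 6) :
    (n : ℝ) ≤ C * (1 + Real.log (Fintype.card (Fin d → Bool)) + (K : ℝ) +
      max 0 (Real.log T)) ^ C := by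
  set V := 1 + Real.log (Fintype.card (Fin d → Bool)) + (K : ℝ) + max 0 (Real.log T) with hV
  have hcard : Real.log (Fintype.card (Fin d → Bool)) = d * Real.log 2 := by
    simp
  have hlog := Real.log_two_gt_d9
  have hd0 : (0 : ℝ) ≤ d := Nat.cast_nonneg d
  have hK0 : (0 : ℝ) ≤ K := Nat.cast_nonneg K
  have hT0 : (0 : ℝ) ≤ max 0 (Real.log T) := le_max_left _ _
  have hdV : (d : ℝ) * Real.log 2 ≥ d * 0.5 := by
    apply mul_le_mul_of_nonneg_left _ hd0
    linarith
  -- The dimension is paid for by log |X| = d log 2 ≥ d/2.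
  have hM : ((d + K : ℕ) : ℝ) ≤ 2 * V := by
    push_cast
    rw [hV, hcard]
    linarith
  have hV1 : 1 ≤ V := by
    rw [hV, hcard]
    linarith
  have hnr : (n : ℝ) ≤ 20000000 * ((d + K : ℕ) : ℝ) ^ 6 := by exact_mod_cast hn
  have hCr : (20000000000 : ℝ) ≤ C := by exact_mod_cast hC
  calc (n : ℝ) ≤ 20000000 * ((d + K : ℕ) : ℝ) ^ 6 := hnr
    _ ≤ 20000000 * (2 * V) ^ 6 := by gcongr
    _ = 1280000000 * V ^ 6 := by ring
    _ ≤ C * V ^ C := by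
      apply mul_le_mul (by linarith) _ (by positivity) (by positivity)
      exact pow_le_pow_right₀ hV1 (by omega)

end RAM

/-! ### The two cases of the theorem -/

lemma sqrt_eq_zero_of_eq_zero {d r k : ℕ} {γ : ℝ} (hkd : k ≤ d) (hd : d = 0) :
    Real.sqrt (k * r * max 0 (Real.log (1 / γ))) = 0 := by
  obtain rfl : k = 0 := by omega
  simp

lemma one_le_rpow_softO {C d r k : ℕ} {γ : ℝ} (hkd : k ≤ d) :
    (1 : ℝ) ≤ (d : ℝ) ^ softO C (Real.sqrt (k * r * max 0 (Real.log (1 / γ)))) := by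
  rcases Nat.eq_zero_or_pos d with hd | hd
  -- For d = 0 also k = 0, so the exponent vanishes and 0^0 = 1.
  · rw [sqrt_eq_zero_of_eq_zero hkd hd]
    simp [softO]
  · exact Real.one_le_rpow (by exact_mod_cast hd) (softO_nonneg C (Real.sqrt_nonneg _))

open RAM in
lemma approximates_const {C r k d : ℕ} (hC : 20000000000 ≤ C) (hrk : r ≤ k) (hkd : k ≤ d) {γ T : ℝ}
    (hγ : 0 < γ) (h : r = 0 ∨ ⌈Real.logb 2 (1 / γ)⌉₊ ≤ 1) (hT : 1 ≤ T) :
    EfficientlyUniformlyApproximates mainCmd C (thresholdInput r k γ) 0 T γ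
      (thresholdFamily (d := d) r) (weightAtMost d k) := by
  intro x
  set M := d + 1 with hM
  have hL : M + 3 ≤ 2 ^ (20 * M ^ 3) := by
    have h1 := add_one_le_two_pow (20 * M ^ 3)
    have h2 : M ≤ M ^ 3 := Nat.le_self_pow (by norm_num) M
    omega
  have hwp := wp_mainCmd_const (B := 2 ^ (20 * M ^ 3)) (k := k) (x := x) h (by omega) (by omega)
    (by omega) (by omega)
  refine Exists.elim (exists_outputs (T := T) (γ := γ) ?_ ?_ ?_ hwp) ?_
  rotate_right
  · rintro p ⟨hp, hpy, n, out, hout, hvec, hn⟩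
    refine ⟨p, hp, hpy, n, out, hout, hvec, polynomial_time hC ?_⟩
    rw [add_zero, Nat.choose_zero_right]
    exact hn.trans (const_cost_le le_rfl)
  · split_ifs <;> norm_num
  · intro n hn
    obtain rfl : n = 0 := by omega
    refine le_trans ?_ hT
    split_ifs <;> norm_num
  · intro z hz
    by_cases hr : r = 0
    · simp [hr, hγ.le]
    -- Accuracy at most one bit means γ ≥ 1/2, so the constant 1/2 is good enough.
    · have hg : Real.logb 2 (1 / γ) ≤ 1 := by
        have := Nat.ceil_le.1 (h.resolve_left hr)
        exact_mod_cast this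
      have hg' : 1 / 2 ≤ γ := by
        rw [Real.logb_le_iff_le_rpow (by norm_num) (by positivity), Real.rpow_one,
          div_le_iff₀ hγ] at hg
        linarith
      simp only [hr, zero_add, Finset.range_one, Finset.sum_singleton, Nat.choose_zero_right,
        reduceIte]
      split_ifs <;> norm_num [abs_le] <;> linarith

open RAM in
lemma approximates_main {C r k d g R m : ℕ} (hC : 20000000000 ≤ C) (hkd : k ≤ d) {γ T : ℝ}
    (hg : ⌈Real.logb 2 (1 / γ)⌉₊ = g) (h : ParamsFit r k g R m)
    (hmin : ∀ j < m, (2 ^ j) ^ 2 < 4 * k * R * (2 * j + 1) ^ 2)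
    (hγ : (1 / 2) ^ g ≤ γ) (hT : 1 ≤ T) (hT' : 2 ≤ d → (2 : ℝ) ^ (2 * 2 ^ m + 1) ≤ T) :
    EfficientlyUniformlyApproximates mainCmd C (thresholdInput r k γ) (2 * 2 ^ m) T γ
      (thresholdFamily (d := d) r) (weightAtMost d k) := by
  intro x
  have hr := h.one_le_r
  have hrk := h.r_le
  set K := (d + 2 * 2 ^ m).choose (2 * 2 ^ m) with hK
  have htK : 2 * 2 ^ m + 1 ≤ K := succ_le_choose (by omega)
  have hR : R ≤ (2 ^ m) ^ 2 := le_trans (Nat.le_mul_of_pos_left _ (by omega)) h.four_mul_le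
  obtain ⟨s1, s2, s3, s4⟩ := size_le hr hrk hkd hR rfl htK le_rfl
  have hmt : m ≤ 2 * 2 ^ m := by have := add_one_le_two_pow m; omega
  have hwp := wp_mainCmd_main (B := 2 ^ (20 * (d + K) ^ 3)) (x := x) hg h hmin (coeffBounds h s1)
    s2 s3 s4
  have hb := h.dampingProd_pos
  have hbr : (0 : ℝ) < dampingProd r k R m := by exact_mod_cast hb
  refine Exists.elim (exists_outputs (T := T) (γ := γ) hb ?_ ?_ hwp) ?_
  rotate_right
  · rintro p ⟨hp, hpy, n, out, hout, hvec, hn⟩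
    exact ⟨p, hp, hpy, n, out, hout, hvec,
      polynomial_time hC (hn.trans (main_cost_le hkd hmt htK le_rfl))⟩
  · intro n hn
    rw [abs_div, abs_of_pos hbr, div_le_iff₀ hbr]
    rcases le_or_gt d 1 with hd | hd
    · obtain rfl : k = 1 := by omega
      have h1 : |(coeffNum r 1 R m n : ℝ)| ≤ dampingProd r 1 R m := by
        exact_mod_cast h.abs_coeffNum_le_of_k_eq_one n
      exact h1.trans (le_mul_of_one_le_left hbr.le hT)
    · have h1 : |(coeffNum r k R m n : ℝ)| ≤ 2 ^ (n + 1) * dampingProd r k R m := by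
        exact_mod_cast h.abs_coeffNum_le n
      refine h1.trans (mul_le_mul_of_nonneg_right (le_trans ?_ (hT' hd)) hbr.le)
      exact pow_le_pow_right₀ (by norm_num) (by omega)
  · exact fun z hz => (h.approx hz).trans hγ

/-- The accuracy in bits is comparable to `log (1 / γ)`. -/
lemma bits_bounds {γ : ℝ} (hγ : 0 < γ) {g : ℕ} (hg : ⌈Real.logb 2 (1 / γ)⌉₊ = g) (h2 : 2 ≤ g) :
    (1 / 2) ^ g ≤ γ ∧ (g : ℝ) ≤ 3 * max 0 (Real.log (1 / γ)) := by
  have h1 : Real.logb 2 (1 / γ) ≤ g := by rw [← hg]; exact Nat.le_ceil _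
  have h3 : 1 < Real.logb 2 (1 / γ) := by
    have : 1 < ⌈Real.logb 2 (1 / γ)⌉₊ := by omega
    exact_mod_cast Nat.lt_ceil.1 this
  have h4 : (g : ℝ) < Real.logb 2 (1 / γ) + 1 := by
    rw [← hg]; exact Nat.ceil_lt_add_one (by linarith)
  constructor
  · rw [Real.logb_le_iff_le_rpow (by norm_num) (by positivity), Real.rpow_natCast,
      div_le_iff₀ hγ] at h1
    rw [one_div, inv_pow, inv_le_iff_one_le_mul₀ (by positivity)]
    linarith
  · have hlog := Real.log_two_gt_d9
    -- Since log₂(1/γ) > 1, rounding up at most doubles it; the factor 3 then covers 2 / log 2.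
    have h5 : (g : ℝ) ≤ 2 * Real.logb 2 (1 / γ) := by linarith
    have h6 : Real.logb 2 (1 / γ) * Real.log 2 = Real.log (1 / γ) := by
      rw [Real.logb, div_mul_cancel₀]
      linarith
    have h7 : Real.log (1 / γ) ≤ max 0 (Real.log (1 / γ)) := le_max_right _ _
    nlinarith

theorem mainTheorem7 :
    ∃ (C : ℕ) (A : RAM.Cmd), ∀ r k d : ℕ, r ≤ k → k ≤ d → ∀ γ : ℝ, 0 < γ →
      ∃ (t : ℕ) (T : ℝ),
        (t : ℝ) ≤ softO C (Real.sqrt (k * r * max 0 (Real.log (1 / γ)))) ∧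
        T ≤ (d : ℝ) ^ softO C (Real.sqrt (k * r * max 0 (Real.log (1 / γ)))) ∧
        EfficientlyUniformlyApproximates A C (thresholdInput r k γ) t T γ
          (thresholdFamily (d := d) r) (weightAtMost d k) := by
  -- The size asked for by `RAM.polynomial_time`; `le_softO` only needs 600.
  obtain ⟨C, hC⟩ : ∃ C : ℕ, 20000000000 ≤ C := ⟨_, le_rfl⟩
  refine ⟨C, RAM.mainCmd, fun r k d hrk hkd γ hγ => ?_⟩
  set s := Real.sqrt (k * r * max 0 (Real.log (1 / γ))) with hs
  have hs0 : 0 ≤ s := Real.sqrt_nonneg _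
  have hT : (1 : ℝ) ≤ (d : ℝ) ^ softO C s := one_le_rpow_softO hkd
  by_cases hconst : r = 0 ∨ ⌈Real.logb 2 (1 / γ)⌉₊ ≤ 1
  · exact ⟨0, _, by simpa using softO_nonneg C hs0, le_rfl,
      approximates_const hC hrk hkd hγ hconst hT⟩
  rw [not_or] at hconst
  obtain ⟨hr, hg1⟩ := hconst
  obtain ⟨g, hg⟩ : ∃ g, ⌈Real.logb 2 (1 / γ)⌉₊ = g := ⟨_, rfl⟩
  have hg2 : 2 ≤ g := by omega
  obtain ⟨hγg, hgl⟩ := bits_bounds hγ hg hg2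
  obtain ⟨m, hm, hmin⟩ := exists_min_exponent (4 * k * (r * g))
  have hfit : ParamsFit r k g (r * g) m := ⟨by omega, hrk, hg2, rfl, hm⟩
  have hsize : (2 * 2 ^ m + 3 : ℝ) ≤ softO C s := by
    refine le_softO (a := k * (r * g)) (by omega) hs0 ?_ ?_ ?_
    · have : 1 * (1 * 2) ≤ k * (r * g) :=
        Nat.mul_le_mul (by omega) (Nat.mul_le_mul (by omega) hg2)
      omega
    · rw [hs, Real.sq_sqrt (by positivity)]
      push_cast
      calc (k : ℝ) * (r * g) ≤ k * (r * (3 * max 0 (Real.log (1 / γ)))) := by gcongr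
        _ = _ := by ring
    · intro j hj
      rw [← mul_assoc 4 k]
      exact hmin j hj
  refine ⟨2 * 2 ^ m, (d : ℝ) ^ softO C s, ?_, le_rfl,
    approximates_main hC hkd hg hfit hmin hγg hT fun hd => ?_⟩
  · push_cast
    linarith
  -- The surplus in `hsize` admits the exponent t + 1, and 2 ≤ d changes the base.
  · have hd' : (2 : ℝ) ≤ d := by exact_mod_cast hd
    calc (2 : ℝ) ^ (2 * 2 ^ m + 1) = (2 : ℝ) ^ ((2 * 2 ^ m + 1 : ℕ) : ℝ) :=
          (Real.rpow_natCast _ _).symm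
      _ ≤ (2 : ℝ) ^ softO C s := by
          apply Real.rpow_le_rpow_of_exponent_le (by norm_num)
          push_cast
          linarith
      _ ≤ (d : ℝ) ^ softO C s :=
          Real.rpow_le_rpow (by norm_num) hd' (softO_nonneg C hs0)
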